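/- Let $p$ be a prime, $k$ a field of characteristic $p$ and $G$ a finite group. All modules are finitely generated. A $kG$-module is a $p$-permutation module if its restriction to every $p$-subgroup $P$ of $G$ has a $k$-basis permuted by $P$. $T(kG)$ denotes the Grothendieck group of $p$-permutation $kG$-modules with respect to split exact sequences, and the Lefschetz invariant of a bounded complex $C$ of $p$-permutation modules is $\Lambda(C)=\sum_{n}(-1)^n[C_n]\in T(kG)$. Write $\simeq$ for homotopy equivalence of chain complexes and $(-)^*$ for the $k$-dual. A bounded chain complex $C$ of $p$-permutation $kG$-modules is endotrivial if $C^*\otimes_k C\simeq k[0]$. Let $\mathcal{E}_k(G)$ be the set of homotopy classes of such complexes. $(kG,kG)$-bimodules are identified with $k[G\times G]$-modules via $g\cdot m\cdot h=(g,h^{-1})m$. A splendid Rickard autoequivalence of $kG$ is a bounded complex $\Gamma$ of $p$-permutation $k[G\times G]$-modules with $\Gamma\otimes_{kG}\Gamma^*\simeq kG[0]$ and $\Gamma^*\otimes_{kG}\Gamma\simeq kG[0]$ as complexes of $(kG,kG)$-bimodules, such that every indecomposable direct summand of every $\Gamma_n$ has a vertex of the form $\{(\varphi(g),g)\mid g\in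 Q\}$, where $\varphi:Q\to P$ is an isomorphism between $p$-subgroups of $G$. Let $\mathcal{S}_k(kG)$ be the set of homotopy classes of such complexes. Let $\Delta G=\{(g,g)\mid g\in G\}\cong G$, let $\operatorname{Ind}_{\Delta G}^{G\times G}$ be induction from $kG$-modules (via $G\cong\Delta G$) to $k[G\times G]$-modules, and use the same symbol for the induced homomorphism $T(kG)\to T(k[G\times G])$. Theorem. (1) If $C$ is an endotrivial complex of $p$-permutation $kG$-modules, then $\operatorname{Ind}_{\Delta G}^{G\times G}C$, viewed as a complex of $(kG,kG)$-bimodules, is a splendid Rickard autoequivalence of $kG$, and $\Lambda(\operatorname{Ind}_{\Delta G}^{G\times G}C)=\operatorname{Ind}_{\Delta G}^{G\times G}(\Lambda(C))$ in $T(k[G\times G])$. (2) $\mathcal{E}_k(G)$ is an abelian group with multiplication $[C][D]=[C\otimes_k D]$, $\mathcal{S}_k(kG)$ is a group with multiplication $[\Gamma][\Gamma']=[\Gamma\otimes_{kG}\Gamma']$, and $[C]\mapsto[\operatorname{Ind}_{\Delta G}^{G\times G}C]$ is a well-defined injective group homomorphism $\mathcal{E}_k(G)\to\mathcal{S}_k(kG)$.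 -/

import Mathlib

open CategoryTheory CategoryTheory.Limits
open scoped TensorProduct

universe u

noncomputable section

namespace EndotrivialComplexes

/-! ### Chain complexes indexed by `ℤ` -/

/-- The sign rule for total complexes of chain complexes indexed by `ℤ`: on `C i ⊗ D j` the
differential of the total complex is `c ⊗ id + (-1) ^ i (id ⊗ d)`. -/
instance tensorSignsDown : ComplexShape.TensorSigns (ComplexShape.down ℤ) where
  ε' := MonoidHom.mk' Int.negOnePow Int.negOnePow_add
  rel_add p q r hpq := by
    simp only [ComplexShape.down_Rel] at hpq ⊢
    omega
  add_rel p q r hpq := by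
    simp only [ComplexShape.down_Rel] at hpq ⊢
    omega
  ε'_succ p q hpq := by
    simp only [ComplexShape.down_Rel] at hpq
    subst hpq
    change Int.negOnePow q = - Int.negOnePow (q + 1)
    rw [Int.negOnePow_succ, neg_neg]

/-- The complex concentrated in degree `0`. -/
abbrev inDegreeZero {C : Type*} [Category C] [Preadditive C] [HasZeroObject C] (M : C) :
    ChainComplex C ℤ :=
  (HomologicalComplex.single C (ComplexShape.down ℤ) 0).obj M

/-- The dual `C^*` of a chain complex `C` with respect to a contravariant additive functor `F`
(below: a `k`-linear dual). It has `F (C (-n))` in degree `n`, and its differential from degree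
`n` to degree `n - 1` is `(-1) ^ (n + 1)` times `F` of the differential `C (-n + 1) ⟶ C (-n)`. -/
@[simps]
def dualComplex {C D : Type*} [Category C] [Category D] [Preadditive C] [Preadditive D]
    (F : Cᵒᵖ ⥤ D) [F.PreservesZeroMorphisms] (K : ChainComplex C ℤ) : ChainComplex D ℤ where
  X n := F.obj (Opposite.op (K.X (-n)))
  d n m := (n + 1).negOnePow • F.map (K.d (-m) (-n)).op
  shape n m h := by
    rw [K.shape, op_zero, F.map_zero, smul_zero]
    simp only [ComplexShape.down_Rel] at h ⊢
    omega
  d_comp_d' n m l _ _ := by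
    rw [Linear.units_smul_comp, Linear.comp_units_smul, ← F.map_comp, ← op_comp,
      K.d_comp_d, op_zero, F.map_zero, smul_zero, smul_zero]

/-- Homotopy equivalence of chain complexes. -/
def HEquiv {C : Type*} [Category C] [Preadditive C] (K L : ChainComplex C ℤ) : Prop :=
  Nonempty (HomotopyEquiv K L)

/-! ### Dual modules, bimodules, and the tensor product over a group algebra

A `kG`-module is an object of `Rep k G`. A `(kG, kH)`-bimodule `M` is an object of
`Rep k (G × H)`: the two descriptions correspond by `g · m · h = (g, h⁻¹) m`. -/

section Functors

variable (k : Type u) [Field k] (G H K : Type u) [Group G] [Group H] [Group K]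

/-- The `k`-dual `M^* = Hom_k(M, k)` of a `kG`-module, with `(g f)(m) = f(g⁻¹ m)`. -/
def dualFunctor : (Rep.{u} k G)ᵒᵖ ⥤ Rep.{u} k G where
  obj M := Rep.of M.unop.ρ.dual
  map {M N} f := Rep.ofHom ⟨f.unop.hom.toLinearMap.dualMap, fun g ↦ by
    ext φ x
    simp [Module.Dual.transpose_apply, Rep.hom_comm_apply]⟩
  map_id _ := rfl
  map_comp _ _ := rfl

instance : (dualFunctor k G).Additive where
  map_add {M N f g} := by
    apply Rep.hom_ext
    apply Representation.IntertwiningMap.ext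
    refine LinearMap.ext fun φ ↦ LinearMap.ext fun x ↦ ?_
    exact LinearMap.map_add φ _ _

/-- The dual of a `(kG, kH)`-bimodule `M`: the `(kH, kG)`-bimodule `Hom_k(M, k)` with
`(h · f · g)(m) = f(g · m · h)`. In terms of groups, `(h, g)` acts by `f ↦ f ∘ (g, h)⁻¹`. -/
def bimoduleDual : (Rep.{u} k (G × H))ᵒᵖ ⥤ Rep.{u} k (H × G) :=
  dualFunctor k (G × H) ⋙ Rep.resFunctor (MulEquiv.prodComm : H × G ≃* G × H).toMonoidHom

instance : (bimoduleDual k G H).Additive := by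
  unfold bimoduleDual
  infer_instance

/-- The regular bimodule `kG`, where `(a, b)` sends `x` to `a x b⁻¹`. -/
def regularRepresentation : Representation k (G × G) (MonoidAlgebra k G) where
  toFun g := MonoidAlgebra.mapDomainLinearMap k k fun x ↦ g.1 * x * g.2⁻¹
  map_one' := by ext; simp
  map_mul' _ _ := by ext; simp [mul_assoc]

/-- The regular bimodule `kG` as an object of the category of bimodules. -/
def regularBimodule : Rep.{u} k (G × G) := Rep.of (regularRepresentation k G)

variable {k G H K}

/-- The action of `H` on `M ⊗_k N`, for a `(kG, kH)`-bimodule `M` and a `(kH, kK)`-bimodule `N`,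
given by `h (m ⊗ n) = m · h⁻¹ ⊗ h · n`. -/
abbrev middleAction (M : Rep.{u} k (G × H)) (N : Rep.{u} k (H × K)) :
    Representation k H (M.V ⊗[k] N.V) :=
  Representation.tprod (M.ρ.comp (MonoidHom.inr G H)) (N.ρ.comp (MonoidHom.inl H K))

/-- The action of `G × K` on the quotient `M ⊗_{kH} N` of `M ⊗_k N` by the relations
`m · h⁻¹ ⊗ h · n = m ⊗ n`, that is, `m · h ⊗ n = m ⊗ h · n`; it is given by
`g · (m ⊗ n) · x = g · m ⊗ n · x`. -/
def bimoduleTensorRepresentation (M : Rep.{u} k (G × H)) (N : Rep.{u} k (H × K)) :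
    Representation k (G × K) (middleAction M N).Coinvariants where
  toFun x := Representation.Coinvariants.map _ _
    ⟨TensorProduct.map (M.ρ (x.1, 1)) (N.ρ (1, x.2)), fun h ↦ by
      ext m n
      simp [← Module.End.mul_apply, ← map_mul]⟩
  map_one' := by
    ext
    simp [← Prod.one_eq_mk]
  map_mul' x y := by
    have h1 : ((x * y).1, (1 : H)) = (x.1, 1) * (y.1, 1) := by simp
    have h2 : ((1 : H), (x * y).2) = (1, x.2) * (1, y.2) := by simp
    ext m n
    simp only [h1, h2, map_mul]
    rfl

/-- The `(kG, kK)`-bimodule `M ⊗_{kH} N`. -/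
def bimoduleTensorObj (M : Rep.{u} k (G × H)) (N : Rep.{u} k (H × K)) : Rep.{u} k (G × K) :=
  Rep.of (bimoduleTensorRepresentation M N)

/-- Functoriality of `M ⊗_{kH} N` in both variables. -/
def bimoduleTensorMap {M M' : Rep.{u} k (G × H)} {N N' : Rep.{u} k (H × K)}
    (f : M ⟶ M') (g : N ⟶ N') : bimoduleTensorObj M N ⟶ bimoduleTensorObj M' N' :=
  Rep.ofHom ⟨Representation.Coinvariants.map (middleAction M N) (middleAction M' N')
    ⟨TensorProduct.map f.hom.toLinearMap g.hom.toLinearMap, fun h ↦ by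
      ext m n
      simp [Rep.hom_comm_apply]⟩, fun x ↦ by
      ext m n
      simp [bimoduleTensorRepresentation, Rep.hom_comm_apply]⟩

lemma bimoduleTensor_hom_ext {M : Rep.{u} k (G × H)} {N : Rep.{u} k (H × K)}
    {L : Rep.{u} k (G × K)} {f g : bimoduleTensorObj M N ⟶ L}
    (h : ∀ (m : M) (n : N),
      f.hom.toLinearMap (Representation.Coinvariants.mk (middleAction M N) (m ⊗ₜ[k] n)) =
        g.hom.toLinearMap (Representation.Coinvariants.mk (middleAction M N) (m ⊗ₜ[k] n))) :
    f = g := by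
  have : f.hom.toLinearMap = g.hom.toLinearMap :=
    Representation.Coinvariants.hom_ext (TensorProduct.ext' h)
  exact Rep.hom_ext (Representation.IntertwiningMap.ext this)

variable (k G H K)

/-- The bifunctor `(M, N) ↦ M ⊗_{kH} N` on bimodules. -/
def bimoduleTensor : Rep.{u} k (G × H) ⥤ Rep.{u} k (H × K) ⥤ Rep.{u} k (G × K) where
  obj M :=
    { obj := fun N ↦ bimoduleTensorObj M N
      map := fun g ↦ bimoduleTensorMap (𝟙 M) g
      map_id := fun _ ↦ bimoduleTensor_hom_ext fun _ _ ↦ rfl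
      map_comp := fun _ _ ↦ bimoduleTensor_hom_ext fun _ _ ↦ rfl }
  map f :=
    { app := fun N ↦ bimoduleTensorMap f (𝟙 N)
      naturality := fun _ _ _ ↦ bimoduleTensor_hom_ext fun _ _ ↦ rfl }
  map_id _ := by
    ext N : 2
    exact bimoduleTensor_hom_ext fun _ _ ↦ rfl
  map_comp _ _ := by
    ext N : 2
    exact bimoduleTensor_hom_ext fun _ _ ↦ rfl

instance : (bimoduleTensor k G H K).Additive where
  map_add {M M' f g} := by
    ext N : 2
    refine bimoduleTensor_hom_ext fun m n ↦ ?_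
    exact (congrArg (Representation.Coinvariants.mk (middleAction M' N))
      (TensorProduct.add_tmul (f.hom m) (g.hom m) n)).trans (map_add _ _ _)

instance (M : Rep.{u} k (G × H)) : ((bimoduleTensor k G H K).obj M).Additive where
  map_add {N N' f g} := by
    refine bimoduleTensor_hom_ext fun m n ↦ ?_
    exact (congrArg (Representation.Coinvariants.mk (middleAction M N'))
      (TensorProduct.tmul_add m (f.hom n) (g.hom n))).trans (map_add _ _ _)

end Functors

/-! ### `p`-permutation modules, vertices, the trivial source group -/

section PPermutation

variable (p : ℕ) {k : Type u} [Field k] {G : Type u} [Group G]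

/-- A finitely generated `kG`-module is a `p`-permutation module if its restriction to each
`p`-subgroup `P` of `G` is a permutation module, i.e. has a `k`-basis that is permuted by `P`. -/
def IsPPermutation (M : Rep.{u} k G) : Prop :=
  Module.Finite k M ∧ ∀ P : Subgroup G, IsPGroup p P →
    ∃ (ι : Type u) (b : Module.Basis ι k M), ∀ g ∈ P, ∀ i, ∃ j, M.ρ g (b i) = b j

/-- `M` is relatively `H`-projective: it is a direct summand of a module induced from `H`. -/
def IsRelativelyProjective (M : Rep.{u} k G) (H : Subgroup G) : Prop :=
  ∃ N : Rep.{u} k H, Module.Finite k N ∧ Nonempty (Retract M (Rep.ind H.subtype N))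

/-- `P` is a vertex of the (indecomposable) module `M`: it is minimal among the subgroups for
which `M` is relatively projective. -/
def IsVertex (M : Rep.{u} k G) (P : Subgroup G) : Prop :=
  Minimal (IsRelativelyProjective M) P

/-- The subgroup `Δ(P, φ, Q) = {(φ(g), g) | g ∈ Q}` of `G × H`, for an isomorphism `φ : Q → P`
from a `p`-subgroup of `H` to a `p`-subgroup of `G`. -/
def IsTwistedDiagonal {H : Type u} [Group H] (D : Subgroup (G × H)) : Prop :=
  ∃ (P : Subgroup G) (Q : Subgroup H) (φ : Q ≃* P), IsPGroup p P ∧ IsPGroup p Q ∧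
    (D : Set (G × H)) = Set.range fun g : Q ↦ ((φ g : G), (g : H))

variable (k G)

/-- `p`-permutation `kG`-modules. -/
structure PPermModule where
  /-- the module -/
  module : Rep.{u} k G
  isPPermutation : IsPPermutation p module

/-- The relations `[B] = [A] + [C]` for all split exact sequences `0 → A → B → C → 0`. -/
def splitRelations : AddSubgroup (FreeAbelianGroup (PPermModule p k G)) :=
  AddSubgroup.closure {x | ∃ A B C : PPermModule p k G,
    Nonempty (B.module ≅ A.module ⊞ C.module) ∧
      x = FreeAbelianGroup.of B - (FreeAbelianGroup.of A + FreeAbelianGroup.of C)}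

/-- (The additive group of) the trivial source ring `T(kG)`: the Grothendieck group of
`p`-permutation `kG`-modules with respect to split exact sequences. -/
abbrev TrivialSource : Type (u + 1) :=
  FreeAbelianGroup (PPermModule p k G) ⧸ splitRelations p k G

variable {p k G}

/-- The class `[M]` in `T(kG)`. -/
def PPermModule.cls (M : PPermModule p k G) : TrivialSource p k G :=
  QuotientAddGroup.mk (FreeAbelianGroup.of M)

end PPermutation

/-! ### Induction from the diagonal subgroup -/

section Induction

variable (p : ℕ) (k : Type u) [Field k] (G : Type u) [Group G]

/-- The diagonal embedding `G → G × G`, with image `ΔG`. -/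
abbrev diag : G →* G × G := (MonoidHom.id G).prod (MonoidHom.id G)

/-- The functor `Ind_{ΔG}^{G × G}` from `kG`-modules to `(kG, kG)`-bimodules. -/
abbrev indDiag : Rep.{u} k G ⥤ Rep.{u} k (G × G) := Rep.indFunctor k (diag G)

instance : (indDiag k G).Additive where
  map_add {M N f g} := by
    apply Rep.hom_ext
    apply Representation.IntertwiningMap.ext
    refine Representation.IndV.hom_ext _ _ fun h ↦ LinearMap.ext fun m ↦ ?_
    exact (congrArg (Representation.Coinvariants.mk _)
      (TensorProduct.tmul_add (MonoidAlgebra.single h (1 : k)) (f.hom m) (g.hom m))).trans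
        (map_add _ _ _)

variable {p k G}

/-- The underlying vector space of `Ind_{ΔG}^{G × G} M` is `⨁_{x ∈ G} M`, where
`(a, b) ⊗ m` corresponds to `b⁻¹ m` in the component `a⁻¹ b`. -/
def indDiagEquiv (M : Rep.{u} k G) : (Rep.ind (diag G) M).V ≃ₗ[k] (G →₀ M) :=
  LinearEquiv.ofLinearMap
    (Representation.Coinvariants.lift _ (TensorProduct.lift
      ((Finsupp.lift _ _ _ fun x : G × G ↦ Finsupp.lsingle (x.1⁻¹ * x.2) ∘ₗ M.ρ x.2⁻¹) ∘ₗ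
        (MonoidAlgebra.coeffLinearEquiv k).toLinearMap)) fun g ↦ by ext; simp [mul_assoc])
    (Finsupp.lsum k fun x ↦ Representation.IndV.mk (diag G) M.ρ (1, x) ∘ₗ M.ρ x)
    (by ext; simp)
    (Representation.IndV.hom_ext _ _ fun x ↦ LinearMap.ext fun m ↦ by simp)

lemma indDiagEquiv_symm_single (M : Rep.{u} k G) (x : G) (m : M) :
    (indDiagEquiv M).symm (Finsupp.single x m) =
      Representation.IndV.mk (diag G) M.ρ (1, x) (M.ρ x m) := by
  change (Finsupp.lsum k fun x ↦ Representation.IndV.mk (diag G) M.ρ (1, x) ∘ₗ M.ρ x)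
    (Finsupp.single x m) = _
  rw [Finsupp.lsum_single]
  rfl

lemma indDiagEquiv_symm_action (M : Rep.{u} k G) (g : G × G) (x : G) (m : M) :
    (Rep.ind (diag G) M).ρ g ((indDiagEquiv M).symm (Finsupp.single x m)) =
      (indDiagEquiv M).symm (Finsupp.single (g.1 * x * g.2⁻¹) (M.ρ g.2 m)) := by
  obtain ⟨a, b⟩ := g
  rw [indDiagEquiv_symm_single, indDiagEquiv_symm_single]
  refine (Representation.ind_mk (diag G) M.ρ (a, b) (1, x) (M.ρ x m)).trans ?_
  have h := Representation.Coinvariants.mk_self_apply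
    (Representation.tprod ((Representation.leftRegular k (G × G)).comp (diag G)) M.ρ) a
    (MonoidAlgebra.single ((1, x) * (a, b)⁻¹) (1 : k) ⊗ₜ[k] M.ρ x m)
  refine h.symm.trans ?_
  simp [mul_assoc]

/-- Induction from `ΔG` to `G × G` preserves `p`-permutation modules. -/
lemma indDiag_isPPermutation [Finite G] {M : Rep.{u} k G} (hM : IsPPermutation p M) :
    IsPPermutation p ((indDiag k G).obj M) := by
  obtain ⟨hfin, hM⟩ := hM
  refine ⟨Module.Finite.equiv (indDiagEquiv M).symm, fun P hP ↦ ?_⟩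
  obtain ⟨ι, b, hb⟩ := hM (P.map (MonoidHom.snd G G)) (hP.map _)
  refine ⟨_, (Finsupp.basis fun _ : G ↦ b).map (indDiagEquiv M).symm, fun g hg i ↦ ?_⟩
  obtain ⟨j, hj⟩ := hb g.2 ⟨g, hg, rfl⟩ i.2
  refine ⟨⟨g.1 * i.1 * g.2⁻¹, j⟩, ?_⟩
  rw [Module.Basis.map_apply, Module.Basis.map_apply, Finsupp.coe_basis]
  refine (indDiagEquiv_symm_action M g i.1 (b i.2)).trans ?_
  rw [hj]

/-- Induction of `p`-permutation modules. -/
def PPermModule.indDiag [Finite G] (M : PPermModule p k G) : PPermModule p k (G × G) :=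
  ⟨(EndotrivialComplexes.indDiag k G).obj M.module, indDiag_isPPermutation M.isPPermutation⟩

variable (p k G)

/-- The homomorphism `Ind_{ΔG}^{G × G} : T(kG) → T(k[G × G])`, `[M] ↦ [Ind_{ΔG}^{G × G} M]`. -/
def indTrivialSource [Finite G] : TrivialSource p k G →+ TrivialSource p k (G × G) :=
  QuotientAddGroup.map _ _ (FreeAbelianGroup.map PPermModule.indDiag) (by
    rw [splitRelations, AddSubgroup.closure_le]
    rintro _ ⟨A, B, C, ⟨e⟩, rfl⟩
    have := preservesBinaryBiproducts_of_preservesBiproducts (indDiag k G)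
    refine AddSubgroup.subset_closure ⟨A.indDiag, B.indDiag, C.indDiag,
      ⟨(indDiag k G).mapIso e ≪≫ (indDiag k G).mapBiprod _ _⟩, ?_⟩
    simp only [map_sub, map_add, FreeAbelianGroup.map_of_apply])

variable {p}

lemma indTrivialSource_cls [Finite G] (M : PPermModule p k G) :
    indTrivialSource p k G M.cls = M.indDiag.cls := by
  simp [indTrivialSource, PPermModule.cls]

end Induction

/-! ### Complexes of `p`-permutation modules -/

section Complexes

variable (p : ℕ) (k : Type u) [Field k] (G H K : Type u) [Group G] [Group H] [Group K]

/-- Bounded chain complexes of `p`-permutation `kG`-modules. -/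
structure PPermComplex where
  /-- the complex -/
  complex : ChainComplex (Rep.{u} k G) ℤ
  bounded : ∃ a b : ℤ, ∀ n, n < a ∨ b < n → IsZero (complex.X n)
  isPPermutation : ∀ n, IsPPermutation p (complex.X n)

variable {p k G H K}

/-- The term in degree `n`. -/
abbrev PPermComplex.term (C : PPermComplex p k G) (n : ℤ) : PPermModule p k G :=
  ⟨C.complex.X n, C.isPPermutation n⟩

/-- The Lefschetz invariant `Λ(C) = ∑ (-1)^n [C_n]` in `T(kG)` (a finite sum). -/
def lefschetz (C : PPermComplex p k G) : TrivialSource p k G :=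
  ∑ᶠ n : ℤ, (n.negOnePow : ℤ) • (C.term n).cls

lemma PPermModule.cls_eq_zero {M : PPermModule p k G} (h : IsZero M.module) : M.cls = 0 := by
  have hrel : FreeAbelianGroup.of M - (FreeAbelianGroup.of M + FreeAbelianGroup.of M) ∈
      splitRelations p k G :=
    AddSubgroup.subset_closure ⟨M, M, M, ⟨h.iso ((biprod_isZero_iff _ _).2 ⟨h, h⟩)⟩, rfl⟩
  have := (QuotientAddGroup.eq_zero_iff _).2 hrel
  rw [QuotientAddGroup.mk_sub, QuotientAddGroup.mk_add] at this
  simpa [PPermModule.cls] using this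

/-- The sum defining `Λ(C)` has only finitely many nonzero terms. -/
lemma lefschetz_support_finite (C : PPermComplex p k G) :
    (Function.support fun n : ℤ ↦ (n.negOnePow : ℤ) • (C.term n).cls).Finite := by
  obtain ⟨a, b, h⟩ := C.bounded
  refine (Set.finite_Icc a b).subset fun n hn ↦ ?_
  by_contra hab
  refine hn ?_
  have : n < a ∨ b < n := by
    simp only [Set.mem_Icc] at hab
    omega
  change (n.negOnePow : ℤ) • (C.term n).cls = 0
  rw [PPermModule.cls_eq_zero (h n this), smul_zero]

/-- `C` is endotrivial: `C^* ⊗_k C` is homotopy equivalent to `k` in degree `0`. -/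
def IsEndotrivial (C : PPermComplex p k G) : Prop :=
  HEquiv (HomologicalComplex.tensorObj (dualComplex (dualFunctor k G) C.complex) C.complex)
    (inDegreeZero (Rep.trivial k G k))

/-- The complex of `(kG, kG)`-bimodules `Ind_{ΔG}^{G × G} C`. -/
def PPermComplex.indDiag [Finite G] (C : PPermComplex p k G) : PPermComplex p k (G × G) where
  complex := ((EndotrivialComplexes.indDiag k G).mapHomologicalComplex _).obj C.complex
  bounded := by
    obtain ⟨a, b, h⟩ := C.bounded
    exact ⟨a, b, fun n hn ↦ (EndotrivialComplexes.indDiag k G).map_isZero (h n hn)⟩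
  isPPermutation n := indDiag_isPPermutation (C.isPPermutation n)

/-- The tensor product `Γ ⊗_{kH} Γ'` of complexes of bimodules. -/
abbrev bimoduleTensorComplex (Γ : ChainComplex (Rep.{u} k (G × H)) ℤ)
    (Γ' : ChainComplex (Rep.{u} k (H × K)) ℤ) : ChainComplex (Rep.{u} k (G × K)) ℤ :=
  HomologicalComplex.mapBifunctor Γ Γ' (bimoduleTensor k G H K) (ComplexShape.down ℤ)

/-- A bounded complex `Γ` of `p`-permutation `(kG, kH)`-bimodules is a splendid Rickard complex
if `Γ ⊗_{kH} Γ^* ≃ kG` and `Γ^* ⊗_{kG} Γ ≃ kH`, and each indecomposable direct summand of each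
term of `Γ` has a twisted diagonal vertex. -/
structure IsSplendidRickard (Γ : PPermComplex p k (G × H)) : Prop where
  tensor_dual : HEquiv
    (bimoduleTensorComplex Γ.complex (dualComplex (bimoduleDual k G H) Γ.complex))
    (inDegreeZero (regularBimodule k G))
  dual_tensor : HEquiv
    (bimoduleTensorComplex (dualComplex (bimoduleDual k G H) Γ.complex) Γ.complex)
    (inDegreeZero (regularBimodule k H))
  vertex : ∀ (n : ℤ) (U : Rep.{u} k (G × H)), Indecomposable U →
    Nonempty (Retract U (Γ.complex.X n)) →
      ∃ D : Subgroup (G × H), IsVertex U D ∧ IsTwistedDiagonal p D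

lemma HEquiv.equivalence {C : Type*} [Category C] [Preadditive C] :
    Equivalence (HEquiv (C := C)) where
  refl K := ⟨HomotopyEquiv.refl K⟩
  symm := fun ⟨e⟩ ↦ ⟨e.symm⟩
  trans := fun ⟨e⟩ ⟨f⟩ ↦ ⟨e.trans f⟩

variable (p k G)

/-- Endotrivial complexes of `p`-permutation `kG`-modules. -/
abbrev Endotrivial : Type (u + 1) := {C : PPermComplex p k G // IsEndotrivial C}

/-- Splendid Rickard autoequivalences of `kG`, i.e. splendid Rickard complexes between `kG`
and `kG`. -/
abbrev SplendidAuto : Type (u + 1) := {Γ : PPermComplex p k (G × G) // IsSplendidRickard Γ}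

/-- Homotopy equivalence of endotrivial complexes. -/
abbrev endotrivialSetoid : Setoid (Endotrivial p k G) where
  r C D := HEquiv C.1.complex D.1.complex
  iseqv := HEquiv.equivalence.comap fun C : Endotrivial p k G ↦ C.1.complex

/-- Homotopy equivalence of splendid Rickard autoequivalences. -/
abbrev splendidAutoSetoid : Setoid (SplendidAuto p k G) where
  r Γ Γ' := HEquiv Γ.1.complex Γ'.1.complex
  iseqv := HEquiv.equivalence.comap fun Γ : SplendidAuto p k G ↦ Γ.1.complex

/-- The set underlying `E_k(G)`: homotopy classes of endotrivial complexes. -/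
abbrev EndotrivialClass : Type (u + 1) := Quotient (endotrivialSetoid p k G)

/-- The set underlying `S_k(kG)`: homotopy classes of splendid Rickard autoequivalences. -/
abbrev SplendidAutoClass : Type (u + 1) := Quotient (splendidAutoSetoid p k G)

variable {p k G}

/-- The class `[C]` in `E_k(G)`. -/
abbrev Endotrivial.cls (C : Endotrivial p k G) : EndotrivialClass p k G :=
  Quotient.mk (endotrivialSetoid p k G) C

/-- The class `[Γ]` in `S_k(kG)`. -/
abbrev SplendidAuto.cls (Γ : SplendidAuto p k G) : SplendidAutoClass p k G :=
  Quotient.mk (splendidAutoSetoid p k G) Γ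

end Complexes

end EndotrivialComplexes

end

/-! Both sets of homotopy classes are mapped injectively, compatibly with products, into one
semigroup `BimoduleClass k G`: homotopy classes of bounded complexes of (kG, kG)-bimodules under
⊗_{kG}, with kG[0] as a left unit. Four isomorphisms of modules carry the argument: Ind M ⊗_{kG} Ind
N ≅ Ind (M ⊗_k N) (`indTensorIso`), Ind k ≅ kG (`indTrivialIso`), Ind (M^*) ≅ (Ind M)^*
(`indDualIso`) and Ind M ⊗_{kG} k ≅ M (`recoverNatIso`). They extend to total complexes. The last
one shows that induction detects homotopy equivalence (`indClass_eq_iff`); with the others, C is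
endotrivial exactly when [(Ind C)^*][Ind C] = 1 (`isEndotrivial_iff`, `PPermComplex.indClass_dual`).
The product in the other order is also 1 because ⊗_k is symmetric, so Ind C is a Rickard complex.

The vertex condition is replaced by a condition that is easier to propagate. Over a field of
characteristic p, p-permutation modules are the direct summands of finitely generated permutation
modules (`IsPPermutation.isPermRetract`, `IsPermRetract.isPPermutation`). For a p-permutation
bimodule, all indecomposable summands have twisted diagonal vertices exactly when it is a summand of
a permutation bimodule on whose basis G × 1 and 1 × G act freely (`isPermRetract_axes`,
`IsPermRetract.exists_isVertex`). Modules induced from ΔG have this property, and it passes to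
duals, finite sums and tensor products over kG.

To see that Γ ⊗_{kG} Γ' is again a Rickard complex one needs (M ⊗_{kH} N)^* ≅ N^* ⊗_{kH} M^*. This
can fail in general, but it holds when N is projective as a left module, by a trace argument
(`isIso_dualTensorHom`, `IsPermRetract.exists_trace`). Associativity, units, inverses,
commutativity, multiplicativity and injectivity are then all checked in the semigroup. The Lefschetz
formula is termwise additivity of induction. -/

noncomputable section

namespace EndotrivialComplexes

/-! ### Additive functors and essentially finite coproducts -/

section Coproducts

variable {C D : Type*} [Category C] [Category D] [Preadditive C] [Preadditive D]

/-- An additive functor preserves coproducts with only finitely many nonzero terms. -/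
lemma preservesColimit_of_essentiallyFinite {J : Type*} (f : J → C) (s : Finset J)
    (hs : ∀ j ∉ s, IsZero (f j)) (F : C ⥤ D) [F.Additive] :
    PreservesColimit (Discrete.functor f) F := by
  classical
  refine ⟨fun {c} hc ↦ ⟨?_⟩⟩
  -- The coproduct may be infinite and is not assumed to be a biproduct, but zero morphisms already
  -- give it projections onto its summands.
  let π (j : J) : c.pt ⟶ f j := hc.desc (Cofan.mk (f j) fun i ↦
    if h : i = j then eqToHom (congrArg f h) else 0)
  have hπ (i j : J) : c.ι.app ⟨i⟩ ≫ π j = if h : i = j then eqToHom (congrArg f h) else 0 :=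
    hc.fac _ _
  -- Summands outside `s` vanish, so the identity is a finite sum of idempotents. An additive
  -- functor preserves this equation, and it forces the image cocone to be a coproduct.
  have hsum : ∑ j ∈ s, π j ≫ c.ι.app ⟨j⟩ = 𝟙 c.pt := by
    refine hc.hom_ext fun ⟨i⟩ ↦ ?_
    rw [Preadditive.comp_sum, Category.comp_id]
    by_cases hi : i ∈ s
    · rw [Finset.sum_eq_single_of_mem i hi]
      · rw [← Category.assoc, hπ, dif_pos rfl, eqToHom_refl]
        exact Category.id_comp _
      · intro j _ hj
        rw [← Category.assoc, hπ, dif_neg (Ne.symm hj)]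
        exact zero_comp
    · exact (hs i hi).eq_of_src _ _
  refine
    { desc := fun t ↦ ∑ j ∈ s, F.map (π j) ≫ t.ι.app ⟨j⟩
      fac := ?_
      uniq := ?_ }
  · rintro t ⟨i⟩
    by_cases hi : i ∈ s
    · rw [Preadditive.comp_sum, Finset.sum_eq_single_of_mem i hi]
      · refine (Category.assoc _ _ _).symm.trans ?_
        change (F.map (c.ι.app ⟨i⟩) ≫ F.map (π i)) ≫ _ = _
        rw [← F.map_comp, hπ, dif_pos rfl, eqToHom_refl]
        exact (congrArg (· ≫ _) (F.map_id _)).trans (Category.id_comp _)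
      · intro j _ hj
        refine (Category.assoc _ _ _).symm.trans ?_
        change (F.map (c.ι.app ⟨i⟩) ≫ F.map (π j)) ≫ _ = _
        rw [← F.map_comp, hπ, dif_neg (Ne.symm hj), F.map_zero]
        exact zero_comp
    · exact (F.map_isZero (hs i hi)).eq_of_src _ _
  · intro t m hm
    have h1 : m = F.map (𝟙 c.pt) ≫ m := by
      rw [F.map_id]
      exact (Category.id_comp _).symm
    rw [h1, ← hsum, F.map_sum, Preadditive.sum_comp]
    refine Finset.sum_congr rfl fun j _ ↦ ?_
    rw [F.map_comp, Category.assoc]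
    exact congrArg _ (hm ⟨j⟩)

end Coproducts

section Bounded

variable {C : Type*} [Category C] [HasZeroMorphisms C]

/-- A complex all of whose nonzero terms lie in a bounded range of degrees. -/
def IsBounded (K : ChainComplex C ℤ) : Prop :=
  ∃ a b : ℤ, ∀ n, n < a ∨ b < n → IsZero (K.X n)

end Bounded

open HomologicalComplex

/-! ### Total complexes of bifunctors -/

section Total

variable {C₁ C₂ D : Type*} [Category C₁] [Category C₂] [Category D]
  [Preadditive C₁] [Preadditive C₂] [Preadditive D]
  (T : C₁ ⥤ C₂ ⥤ D) [T.Additive] [∀ X, (T.obj X).Additive]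
  (K : ChainComplex C₁ ℤ) (L : ChainComplex C₂ ℤ)
  [HasMapBifunctor K L T (ComplexShape.down ℤ)]

lemma isZero_obj_obj_of_left {C₁ C₂ D : Type*} [Category C₁] [Category C₂] [Category D]
    [Preadditive C₁] [Preadditive D] (T : C₁ ⥤ C₂ ⥤ D) [T.PreservesZeroMorphisms] {X : C₁} (hX : IsZero X) (Y : C₂) : IsZero ((T.obj X).obj Y) := by
  rw [IsZero.iff_id_eq_zero, ← NatTrans.id_app, ← T.map_id, hX.eq_of_src (𝟙 X) 0, T.map_zero]
  rfl

/-- The total complex of `T(K, L)`. -/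
abbrev tot : ChainComplex D ℤ := mapBifunctor K L T (ComplexShape.down ℤ)

/-- The inclusion of a summand of the total complex. -/
abbrev totι (i j n : ℤ) (h : i + j = n) : (T.obj (K.X i)).obj (L.X j) ⟶ (tot T K L).X n :=
  ιMapBifunctor K L T (ComplexShape.down ℤ) i j n h

variable {T K L} in
lemma tot_hom_ext {Y : D} {n : ℤ} {f g : (tot T K L).X n ⟶ Y}
    (h : ∀ i j (h : i + j = n), totι T K L i j n h ≫ f = totι T K L i j n h ≫ g) : f = g :=
  mapBifunctor.hom_ext h

lemma totι_d (i j n : ℤ) (h : i + j = n) :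
    totι T K L i j n h ≫ (tot T K L).d n (n - 1) =
      (T.map (K.d i (i - 1))).app (L.X j) ≫ totι T K L (i - 1) j (n - 1) (by omega) +
        i.negOnePow • (T.obj (K.X i)).map (L.d j (j - 1)) ≫
          totι T K L i (j - 1) (n - 1) (by omega) := by
  rw [mapBifunctor.d_eq, Preadditive.comp_add, mapBifunctor.ι_D₁, mapBifunctor.ι_D₂,
    mapBifunctor.d₁_eq (i₁' := i - 1) _ _ _ _ (by simp) _ _ (by simp; omega),
    mapBifunctor.d₂_eq (i₂' := j - 1) _ _ _ _ _ (by simp) _ (by simp; omega)]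
  congr 1
  exact one_smul _ _

/-- The projection to a summand of the total complex. -/
def totπ (i j n : ℤ) : (tot T K L).X n ⟶ (T.obj (K.X i)).obj (L.X j) :=
  -- No relation between `i`, `j` and `n` is required: when `i + j ≠ n` no summand matches and the
  -- morphism is zero.
  mapBifunctorDesc fun i' j' _ ↦ if h : i' = i ∧ j' = j then
    eqToHom (by rw [h.1, h.2]) else 0

lemma totι_totπ_self (i j n : ℤ) (h : i + j = n) :
    totι T K L i j n h ≫ totπ T K L i j n = 𝟙 _ := by
  refine (ι_mapBifunctorDesc _ _ _ _).trans ?_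
  rw [dif_pos ⟨rfl, rfl⟩, eqToHom_refl]

lemma totι_totπ_self_assoc (i j n : ℤ) (h : i + j = n) {Z : D}
    (f : (T.obj (K.X i)).obj (L.X j) ⟶ Z) :
    totι T K L i j n h ≫ totπ T K L i j n ≫ f = f := by
  rw [← Category.assoc, totι_totπ_self, Category.id_comp]

lemma totι_totπ_ne (i j i' j' n : ℤ) (h : i + j = n) (hne : i ≠ i') :
    totι T K L i j n h ≫ totπ T K L i' j' n = 0 := by
  refine (ι_mapBifunctorDesc _ _ _ _).trans ?_
  rw [dif_neg fun h ↦ hne h.1]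

lemma totι_totπ_ne_assoc (i j i' j' n : ℤ) (h : i + j = n) (hne : i ≠ i') {Z : D}
    (f : (T.obj (K.X i')).obj (L.X j') ⟶ Z) :
    totι T K L i j n h ≫ totπ T K L i' j' n ≫ f = 0 ≫ f := by
  rw [← Category.assoc, totι_totπ_ne _ _ _ _ _ _ _ _ _ hne]

/-- In total degree `n` the first index determines the second, so boundedness of `K` alone leaves
finitely many nonzero summands. -/
lemma sum_totπ_totι {a b : ℤ} (hK : ∀ n, n < a ∨ b < n → IsZero (K.X n)) (n : ℤ) :
    ∑ i ∈ Finset.Icc a b, totπ T K L i (n - i) n ≫ totι T K L i (n - i) n (by omega) =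
      𝟙 ((tot T K L).X n) := by
  refine tot_hom_ext fun i j h ↦ ?_
  obtain rfl : j = n - i := by omega
  rw [Preadditive.comp_sum, Category.comp_id]
  by_cases hi : i ∈ Finset.Icc a b
  · rw [Finset.sum_eq_single_of_mem i hi, totι_totπ_self_assoc]
    intro i' _ hne
    rw [totι_totπ_ne_assoc _ _ _ _ _ _ _ _ _ (Ne.symm hne), zero_comp]
  · have : IsZero ((T.obj (K.X i)).obj (L.X (n - i))) := by
      rw [Finset.mem_Icc] at hi
      exact isZero_obj_obj_of_left T (hK i (by omega)) _
    exact this.eq_of_src _ _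

variable {T K L} in
lemma isBounded_tot (hK : IsBounded K) (hL : IsBounded L) : IsBounded (tot T K L) := by
  obtain ⟨a, b, hK⟩ := hK
  obtain ⟨a', b', hL⟩ := hL
  refine ⟨a + a', b + b', fun n hn ↦ (IsZero.iff_id_eq_zero _).2 (tot_hom_ext fun i j h ↦ ?_)⟩
  have : IsZero ((T.obj (K.X i)).obj (L.X j)) := by
    by_cases hi : i < a ∨ b < i
    · exact isZero_obj_obj_of_left T (hK i hi) _
    · exact (T.obj _).map_isZero (hL j (by omega))
  exact this.eq_of_src _ _

-- Supplies the hypotheses of the associator in `nonempty_tot_assoc_iso`. The functors there are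
-- only known to be additive, which suffices because boundedness of `K` makes each of these
-- coproducts essentially finite.
omit [∀ X, (T.obj X).Additive] in
lemma preservesColimit_fiber {E : Type*} [Category E] [Preadditive E]
    {K : ChainComplex C₁ ℤ} (hK : IsBounded K) (L : ChainComplex C₂ ℤ)
    (F : D ⥤ E) [F.Additive] (n : ℤ) :
    PreservesColimit (Discrete.functor (GradedObject.mapObjFun
      (((GradedObject.mapBifunctor T ℤ ℤ).obj K.X).obj L.X)
        (fun p : ℤ × ℤ ↦ p.1 + p.2) n)) F := by
  classical
  obtain ⟨a, b, hK⟩ := hK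
  let g : ℤ → (fun p : ℤ × ℤ ↦ p.1 + p.2) ⁻¹' {n} := fun i ↦ ⟨(i, n - i), by simp⟩
  refine preservesColimit_of_essentiallyFinite _ ((Finset.Icc a b).image g) ?_ F
  rintro ⟨⟨i, j⟩, hij⟩ hi
  have hi' : i ∉ Finset.Icc a b := fun h ↦ hi (Finset.mem_image.2 ⟨i, h, Subtype.ext (by
    simp only [Set.mem_preimage, Set.mem_singleton_iff] at hij
    simp only [g, Prod.mk.injEq, true_and]
    omega)⟩)
  rw [Finset.mem_Icc] at hi'
  exact isZero_obj_obj_of_left T (hK i (by omega)) _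

end Total

/-! ### A recognition criterion for total complexes -/

section Universal

variable {C₁ C₂ D : Type*} [Category C₁] [Category C₂] [Category D]
  [Preadditive C₁] [Preadditive C₂] [Preadditive D]
  (T : C₁ ⥤ C₂ ⥤ D) [T.Additive] [∀ X, (T.obj X).Additive]
  {K : ChainComplex C₁ ℤ} {L : ChainComplex C₂ ℤ}
  [HasMapBifunctor K L T (ComplexShape.down ℤ)]

/-- A complex `Z` whose terms decompose in the same way as those of the total complex of
`T(K, L)`, compatibly with the differentials, is isomorphic to that total complex. -/
lemma nonempty_tot_iso {Z : ChainComplex D ℤ} {a b : ℤ}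
    (hK : ∀ n, n < a ∨ b < n → IsZero (K.X n))
    (α : ∀ i j n : ℤ, i + j = n → ((T.obj (K.X i)).obj (L.X j) ⟶ Z.X n))
    (β : ∀ i j n : ℤ, i + j = n → (Z.X n ⟶ (T.obj (K.X i)).obj (L.X j)))
    (h_self : ∀ i j n h, α i j n h ≫ β i j n h = 𝟙 _)
    (h_ne : ∀ i j i' j' n h h', i ≠ i' → α i j n h ≫ β i' j' n h' = 0)
    (h_sum : ∀ n, ∑ i ∈ Finset.Icc a b, β i (n - i) n (by omega) ≫ α i (n - i) n (by omega) =
      𝟙 (Z.X n))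
    (h_d : ∀ i j n h, α i j n h ≫ Z.d n (n - 1) =
      (T.map (K.d i (i - 1))).app (L.X j) ≫ α (i - 1) j (n - 1) (by omega) +
        i.negOnePow • (T.obj (K.X i)).map (L.d j (j - 1)) ≫ α i (j - 1) (n - 1) (by omega)) :
    Nonempty (tot T K L ≅ Z) := by
  have hα (i j n : ℤ) (h : i + j = n) :
      totι T K L i j n h ≫ mapBifunctorDesc (fun i j h ↦ α i j n h) = α i j n h :=
    ι_mapBifunctorDesc _ _ _ _
  refine ⟨Hom.isoOfComponents (fun n ↦
    { hom := mapBifunctorDesc fun i j h ↦ α i j n h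
      inv := ∑ i ∈ Finset.Icc a b, β i (n - i) n (by omega) ≫ totι T K L i (n - i) n (by omega)
      hom_inv_id := ?_
      inv_hom_id := ?_ }) ?_⟩
  · refine tot_hom_ext fun i j h ↦ ?_
    obtain rfl : j = n - i := by omega
    rw [reassoc_of% hα, Preadditive.comp_sum, Category.comp_id]
    by_cases hi : i ∈ Finset.Icc a b
    · rw [Finset.sum_eq_single_of_mem i hi, reassoc_of% h_self]
      intro i' _ hne
      rw [reassoc_of% (h_ne i (n - i) i' (n - i') n h (by omega) (Ne.symm hne)), zero_comp]
    · rw [Finset.mem_Icc] at hi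
      exact (isZero_obj_obj_of_left T (hK i (by omega)) _).eq_of_src _ _
  · rw [Preadditive.sum_comp, ← h_sum n]
    refine Finset.sum_congr rfl fun i _ ↦ ?_
    rw [Category.assoc, hα]
  · rintro n n' hn
    obtain rfl : n' = n - 1 := by simp only [ComplexShape.down_Rel] at hn; omega
    refine tot_hom_ext fun i j h ↦ ?_
    dsimp only
    rw [reassoc_of% hα, h_d, reassoc_of% totι_d, Preadditive.add_comp, Category.assoc, hα,
      Linear.units_smul_comp, Category.assoc, hα]

end Universal

/-! ### Total complexes under functors and under exchange of the factors -/

section Naturality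

variable {C₁ C₂ D C₁' C₂' D' : Type*} [Category C₁] [Category C₂] [Category D]
  [Category C₁'] [Category C₂'] [Category D']
  [Preadditive C₁] [Preadditive C₂] [Preadditive D]
  [Preadditive C₁'] [Preadditive C₂'] [Preadditive D']
  (T : C₁ ⥤ C₂ ⥤ D) [T.Additive] [∀ X, (T.obj X).Additive]
  (T' : C₁' ⥤ C₂' ⥤ D') [T'.Additive] [∀ X, (T'.obj X).Additive]
  {K : ChainComplex C₁ ℤ} {L : ChainComplex C₂ ℤ}
  [HasMapBifunctor K L T (ComplexShape.down ℤ)]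

/-- An additive functor commutes with total complexes. -/
lemma nonempty_tot_map_iso (F₁ : C₁ ⥤ C₁') (F₂ : C₂ ⥤ C₂') (H : D ⥤ D')
    [F₁.Additive] [F₂.Additive] [H.Additive]
    (e : ∀ X Y, (T'.obj (F₁.obj X)).obj (F₂.obj Y) ≅ H.obj ((T.obj X).obj Y))
    (he₁ : ∀ {X X' : C₁} (f : X ⟶ X') (Y : C₂), (T'.map (F₁.map f)).app (F₂.obj Y) ≫
      (e X' Y).hom = (e X Y).hom ≫ H.map ((T.map f).app Y))
    (he₂ : ∀ (X : C₁) {Y Y' : C₂} (g : Y ⟶ Y'), (T'.obj (F₁.obj X)).map (F₂.map g) ≫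
      (e X Y').hom = (e X Y).hom ≫ H.map ((T.obj X).map g))
    [HasMapBifunctor ((F₁.mapHomologicalComplex _).obj K) ((F₂.mapHomologicalComplex _).obj L) T'
      (ComplexShape.down ℤ)] (hK : IsBounded K) :
    Nonempty (tot T' ((F₁.mapHomologicalComplex _).obj K) ((F₂.mapHomologicalComplex _).obj L) ≅
      (H.mapHomologicalComplex _).obj (tot T K L)) := by
  obtain ⟨a, b, hK⟩ := hK
  refine nonempty_tot_iso T' (a := a) (b := b) (fun n hn ↦ F₁.map_isZero (hK n hn))
    (fun i j n h ↦ (e (K.X i) (L.X j)).hom ≫ H.map (totι T K L i j n h))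
    (fun i j n h ↦ H.map (totπ T K L i j n) ≫ (e (K.X i) (L.X j)).inv) ?_ ?_ ?_ ?_
  · intro i j n h
    change ((e (K.X i) (L.X j)).hom ≫ H.map (totι T K L i j n h)) ≫
      H.map (totπ T K L i j n) ≫ (e (K.X i) (L.X j)).inv = 𝟙 _
    rw [Category.assoc, ← H.map_comp_assoc, totι_totπ_self, H.map_id, Category.id_comp,
      Iso.hom_inv_id]
  · intro i j i' j' n h h' hne
    change ((e (K.X i) (L.X j)).hom ≫ H.map (totι T K L i j n h)) ≫
      H.map (totπ T K L i' j' n) ≫ (e (K.X i') (L.X j')).inv = 0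
    rw [Category.assoc, ← H.map_comp_assoc, totι_totπ_ne _ _ _ _ _ _ _ _ _ hne, H.map_zero,
      zero_comp, comp_zero]
  · intro n
    refine Eq.trans ?_ (H.map_id _)
    rw [← sum_totπ_totι T K L hK n, H.map_sum]
    refine Finset.sum_congr rfl fun i _ ↦ ?_
    change (H.map (totπ T K L i (n - i) n) ≫ (e (K.X i) (L.X (n - i))).inv) ≫
      (e (K.X i) (L.X (n - i))).hom ≫ H.map (totι T K L i (n - i) n (by omega)) = _
    rw [Category.assoc, Iso.inv_hom_id_assoc, ← H.map_comp]
  · intro i j n h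
    change ((e (K.X i) (L.X j)).hom ≫ H.map (totι T K L i j n h)) ≫
      H.map ((tot T K L).d n (n - 1)) =
        (T'.map (F₁.map (K.d i (i - 1)))).app (F₂.obj (L.X j)) ≫ (e (K.X (i - 1)) (L.X j)).hom ≫
          H.map (totι T K L (i - 1) j (n - 1) (by omega)) +
        i.negOnePow • (T'.obj (F₁.obj (K.X i))).map (F₂.map (L.d j (j - 1))) ≫
          (e (K.X i) (L.X (j - 1))).hom ≫ H.map (totι T K L i (j - 1) (n - 1) (by omega))
    rw [Category.assoc, ← H.map_comp, totι_d, H.map_add, H.map_comp, Preadditive.comp_add,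
      reassoc_of% (he₁ (K.d i (i - 1)) (L.X j)).symm, Functor.map_units_smul, H.map_comp,
      Linear.comp_units_smul, reassoc_of% (he₂ (K.X i) (L.d j (j - 1))).symm]

/-- The total complexes of `T(K, L)` and `T'(L, K)` are isomorphic if `T` and `T'` agree up to
the order of the arguments. -/
lemma nonempty_tot_flip_iso (T'' : C₂ ⥤ C₁ ⥤ D) [T''.Additive] [∀ X, (T''.obj X).Additive]
    (e : ∀ X Y, (T.obj X).obj Y ≅ (T''.obj Y).obj X)
    (he₁ : ∀ {X X' : C₁} (f : X ⟶ X') (Y : C₂), (T.map f).app Y ≫ (e X' Y).hom =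
      (e X Y).hom ≫ (T''.obj Y).map f)
    (he₂ : ∀ (X : C₁) {Y Y' : C₂} (g : Y ⟶ Y'), (T.obj X).map g ≫ (e X Y').hom =
      (e X Y).hom ≫ (T''.map g).app X)
    [HasMapBifunctor L K T'' (ComplexShape.down ℤ)] (hK : IsBounded K) :
    Nonempty (tot T K L ≅ tot T'' L K) := by
  obtain ⟨a, b, hK⟩ := hK
  refine nonempty_tot_iso T (a := a) (b := b) hK
    -- Exchanging the factors gives a chain map only with the Koszul sign (-1)^{ij}.
    (fun i j n h ↦ (i * j).negOnePow • (e (K.X i) (L.X j)).hom ≫ totι T'' L K j i n (by omega))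
    (fun i j n h ↦ (i * j).negOnePow • totπ T'' L K j i n ≫ (e (K.X i) (L.X j)).inv) ?_ ?_ ?_ ?_
  · intro i j n h
    rw [Linear.units_smul_comp, Linear.comp_units_smul, smul_smul, Int.units_mul_self, one_smul,
      Category.assoc, totι_totπ_self_assoc, Iso.hom_inv_id]
  · intro i j i' j' n h h' hne
    rw [Linear.units_smul_comp, Linear.comp_units_smul, Category.assoc, totι_totπ_ne_assoc,
      zero_comp, comp_zero, smul_zero, smul_zero]
    omega
  · intro n
    refine tot_hom_ext fun j i h ↦ ?_
    rw [Preadditive.comp_sum, Category.comp_id]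
    obtain rfl : j = n - i := by omega
    by_cases hi : i ∈ Finset.Icc a b
    · rw [Finset.sum_eq_single_of_mem i hi]
      · rw [Linear.units_smul_comp, Linear.comp_units_smul, Linear.comp_units_smul,
          Linear.comp_units_smul, smul_smul, Int.units_mul_self, one_smul, Category.assoc,
          Iso.inv_hom_id_assoc, totι_totπ_self_assoc]
      · intro i' _ hne
        rw [Linear.units_smul_comp, Linear.comp_units_smul, Category.assoc,
          Linear.comp_units_smul, totι_totπ_ne_assoc, zero_comp, smul_zero]
        omega
    · rw [Finset.mem_Icc] at hi
      exact ((T''.obj _).map_isZero (hK i (by omega))).eq_of_src _ _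
  · intro i j n h
    rw [Linear.units_smul_comp, Category.assoc, totι_d, Preadditive.comp_add, smul_add,
      Linear.comp_units_smul, reassoc_of% (he₁ (K.d i (i - 1)) (L.X j)).symm,
      reassoc_of% (he₂ (K.X i) (L.d j (j - 1))).symm, smul_smul, add_comm, Linear.comp_units_smul,
      Linear.comp_units_smul, smul_smul, ← Int.negOnePow_add, ← Int.negOnePow_add]
    -- The signs agree since ij + j ≡ (i - 1)j mod 2 for the differential of `K`, and ij = i + i(j -
    -- 1) for that of `L`.
    congr 2
    · rw [sub_mul, one_mul, Int.negOnePow_sub, Int.negOnePow_add]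
    · rw [mul_sub, mul_one, show i + (i * j - i) = i * j by ring]

end Naturality

open HomologicalComplex Opposite

/-! ### The differential of a total complex in terms of projections -/

section Projections

variable {C₁ C₂ D : Type*} [Category C₁] [Category C₂] [Category D]
  [Preadditive C₁] [Preadditive C₂] [Preadditive D]
  (T : C₁ ⥤ C₂ ⥤ D) [T.Additive] [∀ X, (T.obj X).Additive]
  (K : ChainComplex C₁ ℤ) (L : ChainComplex C₂ ℤ)
  [HasMapBifunctor K L T (ComplexShape.down ℤ)]

/-- Dualizing turns the projections of a total complex into the inclusions of its dual, so `totι_d`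
has to be transposed. The degrees are independent variables linked by equations so that negated
degrees such as `-(i - 1)` can be substituted. -/
lemma d_totπ {i i' j j' n n' : ℤ} (hi : i' = i + 1) (hj : j' = j + 1) (hn : n = n' + 1)
    (h : i + j = n') :
    (tot T K L).d n n' ≫ totπ T K L i j n' =
      totπ T K L i' j n ≫ (T.map (K.d i' i)).app (L.X j) +
        i.negOnePow • totπ T K L i j' n ≫ (T.obj (K.X i)).map (L.d j' j) := by
  obtain rfl : i = i' - 1 := by omega
  obtain rfl : j = j' - 1 := by omega
  obtain rfl : n' = n - 1 := by omega
  refine tot_hom_ext fun p q hpq ↦ ?_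
  rw [reassoc_of% totι_d, Preadditive.add_comp, Preadditive.comp_add, Linear.units_smul_comp,
    Linear.comp_units_smul, Category.assoc, Category.assoc]
  congr 1
  · by_cases hp : p = i'
    · subst hp
      obtain rfl : q = j' - 1 := by omega
      rw [totι_totπ_self_assoc, totι_totπ_self, Category.comp_id]
    · rw [totι_totπ_ne _ _ _ _ _ _ _ _ _ (by omega), totι_totπ_ne_assoc _ _ _ _ _ _ _ _ _ hp,
        zero_comp, comp_zero]
  · by_cases hp : p = i' - 1
    · subst hp
      obtain rfl : q = j' := by omega
      rw [totι_totπ_self_assoc, totι_totπ_self, Category.comp_id]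
    · rw [totι_totπ_ne _ _ _ _ _ _ _ _ _ hp, totι_totπ_ne_assoc _ _ _ _ _ _ _ _ _ hp,
        zero_comp, comp_zero, smul_zero, smul_zero]

end Projections

/-! ### Duals of total complexes -/

section Dual

lemma isZero_dualComplex_X {C D : Type*} [Category C] [Category D] [Preadditive C]
    [Preadditive D] (F : Cᵒᵖ ⥤ D) [F.Additive] {K : ChainComplex C ℤ} {n : ℤ}
    (h : IsZero (K.X (-n))) : IsZero ((dualComplex F K).X n) := by
  rw [IsZero.iff_id_eq_zero]
  change 𝟙 (F.obj (op (K.X (-n)))) = 0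
  rw [← F.map_id, ← op_id, h.eq_of_src (𝟙 (K.X (-n))) 0, op_zero, F.map_zero]

lemma IsBounded.dual {C D : Type*} [Category C] [Category D] [Preadditive C] [Preadditive D]
    (F : Cᵒᵖ ⥤ D) [F.Additive] {K : ChainComplex C ℤ} (hK : IsBounded K) :
    IsBounded (dualComplex F K) := by
  obtain ⟨a, b, hK⟩ := hK
  exact ⟨-b, -a, fun n hn ↦ isZero_dualComplex_X F (hK (-n) (by omega))⟩

variable {C₁ C₂ D C₁' C₂' D' : Type*} [Category C₁] [Category C₂] [Category D]
  [Category C₁'] [Category C₂'] [Category D']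
  [Preadditive C₁] [Preadditive C₂] [Preadditive D]
  [Preadditive C₁'] [Preadditive C₂'] [Preadditive D']
  (T : C₁ ⥤ C₂ ⥤ D) [T.Additive] [∀ X, (T.obj X).Additive]
  (T' : C₂' ⥤ C₁' ⥤ D') [T'.Additive] [∀ X, (T'.obj X).Additive]
  {K : ChainComplex C₁ ℤ} {L : ChainComplex C₂ ℤ}
  [HasMapBifunctor K L T (ComplexShape.down ℤ)]

/-- The dual of a total complex is the total complex of the duals, in the opposite order. -/
lemma nonempty_tot_dual_iso (F₁ : C₁ᵒᵖ ⥤ C₁') (F₂ : C₂ᵒᵖ ⥤ C₂') (F₃ : Dᵒᵖ ⥤ D')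
    [F₁.Additive] [F₂.Additive] [F₃.Additive]
    (φ : ∀ X Y, (T'.obj (F₂.obj (op Y))).obj (F₁.obj (op X)) ⟶ F₃.obj (op ((T.obj X).obj Y)))
    (hφ₁ : ∀ {X X' : C₁} (f : X ⟶ X') (Y : C₂), (T'.obj (F₂.obj (op Y))).map (F₁.map f.op) ≫
      φ X Y = φ X' Y ≫ F₃.map ((T.map f).app Y).op)
    (hφ₂ : ∀ (X : C₁) {Y Y' : C₂} (g : Y ⟶ Y'), (T'.map (F₂.map g.op)).app (F₁.obj (op X)) ≫
      φ X Y = φ X Y' ≫ F₃.map ((T.obj X).map g).op)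
    (hφ : ∀ i j, IsIso (φ (K.X i) (L.X j)))
    [HasMapBifunctor (dualComplex F₂ L) (dualComplex F₁ K) T' (ComplexShape.down ℤ)]
    (hL : IsBounded L) :
    Nonempty (tot T' (dualComplex F₂ L) (dualComplex F₁ K) ≅ dualComplex F₃ (tot T K L)) := by
  obtain ⟨a, b, hL⟩ := hL
  -- `φ` is invertible only at the terms of the two complexes, so its inverse is chosen there and
  -- not as a natural transformation.
  let ψ (i j : ℤ) : F₃.obj (op ((T.obj (K.X i)).obj (L.X j))) ⟶
      (T'.obj (F₂.obj (op (L.X j)))).obj (F₁.obj (op (K.X i))) :=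
    @inv _ _ _ _ (φ (K.X i) (L.X j)) (hφ i j)
  have hφψ (i j : ℤ) : φ (K.X i) (L.X j) ≫ ψ i j = 𝟙 _ := @IsIso.hom_inv_id _ _ _ _ _ (hφ i j)
  have hψφ (i j : ℤ) : ψ i j ≫ φ (K.X i) (L.X j) = 𝟙 _ := @IsIso.inv_hom_id _ _ _ _ _ (hφ i j)
  refine nonempty_tot_iso T' (a := -b) (b := -a)
    (fun n hn ↦ isZero_dualComplex_X F₂ (hL (-n) (by omega)))
    -- Dualizing negates degrees and reverses the factors: summand (i, j) corresponds to (-j, -i) in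
    -- the original complex.
    (fun i j n h ↦ φ (K.X (-j)) (L.X (-i)) ≫ F₃.map (totπ T K L (-j) (-i) (-n)).op)
    (fun i j n h ↦ F₃.map (totι T K L (-j) (-i) (-n) (by omega)).op ≫
      ψ (-j) (-i)) ?_ ?_ ?_ ?_
  · intro i j n h
    change (φ (K.X (-j)) (L.X (-i)) ≫ F₃.map (totπ T K L (-j) (-i) (-n)).op) ≫
      F₃.map (totι T K L (-j) (-i) (-n) (by omega)).op ≫ ψ (-j) (-i) = 𝟙 _
    rw [Category.assoc, ← F₃.map_comp_assoc, ← op_comp, totι_totπ_self, op_id, F₃.map_id,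
      Category.id_comp, hφψ]
  · intro i j i' j' n h h' hne
    change (φ (K.X (-j)) (L.X (-i)) ≫ F₃.map (totπ T K L (-j) (-i) (-n)).op) ≫
      F₃.map (totι T K L (-j') (-i') (-n) (by omega)).op ≫ ψ (-j') (-i') = 0
    rw [Category.assoc, ← F₃.map_comp_assoc, ← op_comp,
      totι_totπ_ne _ _ _ _ _ _ _ _ _ (by omega), op_zero, F₃.map_zero, zero_comp, comp_zero]
  · intro n
    -- The decomposition is indexed by the degree in `L`, because it is `L` that is bounded here.
    have hsum' : ∑ i ∈ Finset.Icc (-b) (-a), totπ T K L (-(n - i)) (-i) (-n) ≫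
        totι T K L (-(n - i)) (-i) (-n) (by omega) = 𝟙 ((tot T K L).X (-n)) := by
      refine tot_hom_ext fun p q hpq ↦ ?_
      rw [Preadditive.comp_sum, Category.comp_id]
      obtain ⟨i, rfl⟩ : ∃ i, q = -i := ⟨-q, by omega⟩
      obtain rfl : p = -(n - i) := by omega
      by_cases hi : i ∈ Finset.Icc (-b) (-a)
      · rw [Finset.sum_eq_single_of_mem i hi, totι_totπ_self_assoc]
        intro i' _ hne
        rw [totι_totπ_ne_assoc _ _ _ _ _ _ _ _ _ (by omega), zero_comp]
      · rw [Finset.mem_Icc] at hi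
        exact ((T.obj _).map_isZero (hL (-i) (by omega))).eq_of_src _ _
    have hsum : ∑ i ∈ Finset.Icc (-b) (-a), F₃.map (totι T K L (-(n - i)) (-i) (-n) (by omega)).op ≫
        F₃.map (totπ T K L (-(n - i)) (-i) (-n)).op = F₃.map (𝟙 ((tot T K L).X (-n))).op := by
      rw [← hsum', op_sum, F₃.map_sum]
      refine Finset.sum_congr rfl fun i _ ↦ ?_
      rw [op_comp, F₃.map_comp]
    refine Eq.trans ?_ (hsum.trans (F₃.map_id _))
    refine Finset.sum_congr rfl fun i _ ↦ ?_
    change (F₃.map (totι T K L (-(n - i)) (-i) (-n) (by omega)).op ≫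
      ψ (-(n - i)) (-i)) ≫ φ (K.X (-(n - i))) (L.X (-i)) ≫
        F₃.map (totπ T K L (-(n - i)) (-i) (-n)).op = _
    rw [Category.assoc, reassoc_of% hψφ]
  · intro i j n h
    change (φ (K.X (-j)) (L.X (-i)) ≫ F₃.map (totπ T K L (-j) (-i) (-n)).op) ≫
      ((n + 1).negOnePow • F₃.map ((tot T K L).d (-(n - 1)) (-n)).op) =
      (T'.map ((i + 1).negOnePow • F₂.map (L.d (-(i - 1)) (-i)).op)).app (F₁.obj (op (K.X (-j)))) ≫
        φ (K.X (-j)) (L.X (-(i - 1))) ≫ F₃.map (totπ T K L (-j) (-(i - 1)) (-(n - 1))).op +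
      i.negOnePow • (T'.obj (F₂.obj (op (L.X (-i))))).map
        ((j + 1).negOnePow • F₁.map (K.d (-(j - 1)) (-j)).op) ≫
        φ (K.X (-(j - 1))) (L.X (-i)) ≫ F₃.map (totπ T K L (-(j - 1)) (-i) (-(n - 1))).op
    have hs : (T'.map ((i + 1).negOnePow • F₂.map (L.d (-(i - 1)) (-i)).op)).app
        (F₁.obj (op (K.X (-j)))) = (i + 1).negOnePow •
          (T'.map (F₂.map (L.d (-(i - 1)) (-i)).op)).app (F₁.obj (op (K.X (-j)))) := by
      rw [T'.map_units_smul]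
      rfl
    rw [hs, Functor.map_units_smul, Linear.units_smul_comp, Linear.units_smul_comp,
      reassoc_of% (hφ₁ (K.d (-(j - 1)) (-j)) (L.X (-i))),
      reassoc_of% (hφ₂ (K.X (-j)) (L.d (-(i - 1)) (-i))), Linear.comp_units_smul, Category.assoc,
      ← F₃.map_comp, ← op_comp, ← F₃.map_comp, ← F₃.map_comp, ← op_comp, ← op_comp,
      d_totπ T K L (i := -j) (i' := -(j - 1)) (j := -i) (j' := -(i - 1)) (by omega) (by omega)
        (by omega) (by omega), op_add, F₃.map_add, Preadditive.comp_add, smul_add, add_comm]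
    -- With n = i + j, the exponent n + 1 - j equals i + 1 on the part from `L`, and n + 1 = i + (j
    -- + 1) on the part from `K`. These are the signs prescribed by `dualComplex`, so no further
    -- sign is needed in the isomorphism.
    congr 1
    · have : ((-j).negOnePow • totπ T K L (-j) (-(i - 1)) (-(n - 1)) ≫
          (T.obj (K.X (-j))).map (L.d (-(i - 1)) (-i))).op = (-j).negOnePow •
          (totπ T K L (-j) (-(i - 1)) (-(n - 1)) ≫
            (T.obj (K.X (-j))).map (L.d (-(i - 1)) (-i))).op := rfl
      rw [this, F₃.map_units_smul, Linear.comp_units_smul, smul_smul, ← Int.negOnePow_add]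
      congr 2
      obtain rfl : n = i + j := h.symm
      ring
    · rw [smul_smul, ← Int.negOnePow_add]
      congr 2
      omega

end Dual

/-! ### Unit complexes -/

section Unit

variable {C₁ C₂ : Type*} [Category C₁] [Category C₂] [Preadditive C₁] [Preadditive C₂]
  [HasZeroObject C₁] (T : C₁ ⥤ C₂ ⥤ C₂) [T.Additive] [∀ X, (T.obj X).Additive]

/-- If `T(M, -)` is the identity functor, then the total complex of `T(M[0], L)` is `L`. -/
lemma nonempty_tot_unit_iso {M : C₁} (e : T.obj M ≅ 𝟭 C₂) (L : ChainComplex C₂ ℤ)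
    [HasMapBifunctor (inDegreeZero M) L T (ComplexShape.down ℤ)] :
    Nonempty (tot T (inDegreeZero M) L ≅ L) := by
  have hzero (n : ℤ) (hn : n ≠ 0) : IsZero ((inDegreeZero M).X n) :=
    isZero_single_obj_X _ _ _ _ hn
  let f (i : ℤ) (hi : i = 0) : (inDegreeZero M).X i ≅ M :=
    singleObjXIsoOfEq (ComplexShape.down ℤ) 0 M i hi
  let g (i j n : ℤ) (h : i + j = n) (hi : i = 0) :
      (T.obj ((inDegreeZero M).X i)).obj (L.X j) ≅ L.X n :=
    (T.mapIso (f i hi)).app _ ≪≫ e.app (L.X j) ≪≫ L.XIsoOfEq (by omega)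
  refine nonempty_tot_iso T (a := 0) (b := 0) (fun n hn ↦ hzero n (by omega))
    (fun i j n h ↦ if hi : i = 0 then (g i j n h hi).hom else 0)
    (fun i j n h ↦ if hi : i = 0 then (g i j n h hi).inv else 0) ?_ ?_ ?_ ?_
  · intro i j n h
    by_cases hi : i = 0
    · rw [dif_pos hi, dif_pos hi, Iso.hom_inv_id]
    · exact (isZero_obj_obj_of_left T (hzero i hi) _).eq_of_src _ _
  · intro i j i' j' n h h' hne
    by_cases hi : i = 0
    · rw [dif_neg (c := i' = 0) (by omega), comp_zero]
    · rw [dif_neg hi, zero_comp]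
  · intro n
    rw [Finset.Icc_self, Finset.sum_singleton, dif_pos rfl, dif_pos rfl, Iso.inv_hom_id]
  · intro i j n h
    by_cases hi : i = 0
    · subst hi
      obtain rfl : j = n := by omega
      rw [dif_pos rfl, dif_neg (by omega), dif_pos rfl, comp_zero, zero_add, Int.negOnePow_zero,
        one_smul]
      have hg (j : ℤ) : (g 0 j j (zero_add j) rfl).hom =
          (T.map (f 0 rfl).hom).app (L.X j) ≫ e.hom.app (L.X j) := by
        simp only [g, Iso.trans_hom, Iso.app_hom, Functor.mapIso_hom, XIsoOfEq_rfl, Iso.refl_hom]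
        exact congrArg _ (Category.comp_id _)
      rw [hg, hg, NatTrans.naturality_assoc, Category.assoc]
      exact congrArg _ (e.hom.naturality _).symm
    · exact (isZero_obj_obj_of_left T (hzero i hi) _).eq_of_src _ _

end Unit

open HomologicalComplex Opposite

/-! ### Homotopy invariance of total complexes -/

section Homotopy

variable {C₁ C₂ D : Type*} [Category C₁] [Category C₂] [Category D]
  [Preadditive C₁] [Preadditive C₂] [Preadditive D]
  (T : C₁ ⥤ C₂ ⥤ D) [T.Additive] [∀ X, (T.obj X).Additive]
  [∀ (K : ChainComplex C₁ ℤ) (L : ChainComplex C₂ ℤ), HasMapBifunctor K L T (ComplexShape.down ℤ)]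

lemma mapBifunctorMap_comp {K K' K'' : ChainComplex C₁ ℤ} {L L' L'' : ChainComplex C₂ ℤ}
    (f : K ⟶ K') (f' : K' ⟶ K'') (g : L ⟶ L') (g' : L' ⟶ L'') :
    mapBifunctorMap f g T (ComplexShape.down ℤ) ≫ mapBifunctorMap f' g' T (ComplexShape.down ℤ) =
      mapBifunctorMap (f ≫ f') (g ≫ g') T (ComplexShape.down ℤ) := by
  ext n : 1
  refine tot_hom_ext fun i j h ↦ ?_
  rw [comp_f, ι_mapBifunctorMap_assoc, ι_mapBifunctorMap, ι_mapBifunctorMap, comp_f, comp_f,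
    T.map_comp, NatTrans.comp_app, Functor.map_comp]
  simp only [Category.assoc, NatTrans.naturality_assoc]

lemma mapBifunctorMap_id (K : ChainComplex C₁ ℤ) (L : ChainComplex C₂ ℤ) :
    mapBifunctorMap (𝟙 K) (𝟙 L) T (ComplexShape.down ℤ) = 𝟙 _ := by
  ext n : 1
  refine tot_hom_ext fun i j h ↦ ?_
  rw [ι_mapBifunctorMap, id_f, id_f, id_f, T.map_id, CategoryTheory.Functor.map_id, NatTrans.id_app,
    Category.id_comp, Category.id_comp, Category.comp_id]

/-- Only one variable is changed at a time, passing through `tot T K' L`, since a homotopy in a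
single variable induces a homotopy of total complexes. -/
lemma HEquiv.tot {K K' : ChainComplex C₁ ℤ} {L L' : ChainComplex C₂ ℤ}
    (hK : HEquiv K K') (hL : HEquiv L L') : HEquiv (tot T K L) (tot T K' L') := by
  obtain ⟨e⟩ := hK
  obtain ⟨e'⟩ := hL
  refine HEquiv.equivalence.trans (y := EndotrivialComplexes.tot T K' L) ⟨
    { hom := mapBifunctorMap e.hom (𝟙 L) T _
      inv := mapBifunctorMap e.inv (𝟙 L) T _
      homotopyHomInvId := (Homotopy.ofEq (mapBifunctorMap_comp _ _ _ _ _)).trans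
        ((mapBifunctorMapHomotopy₁ e.homotopyHomInvId _ T _).trans
          (Homotopy.ofEq (by rw [Category.comp_id, mapBifunctorMap_id])))
      homotopyInvHomId := (Homotopy.ofEq (mapBifunctorMap_comp _ _ _ _ _)).trans
        ((mapBifunctorMapHomotopy₁ e.homotopyInvHomId _ T _).trans
          (Homotopy.ofEq (by rw [Category.comp_id, mapBifunctorMap_id]))) }⟩ ⟨
    { hom := mapBifunctorMap (𝟙 K') e'.hom T _
      inv := mapBifunctorMap (𝟙 K') e'.inv T _
      homotopyHomInvId := (Homotopy.ofEq (mapBifunctorMap_comp _ _ _ _ _)).trans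
        ((mapBifunctorMapHomotopy₂ _ e'.homotopyHomInvId T _).trans
          (Homotopy.ofEq (by rw [Category.comp_id, mapBifunctorMap_id])))
      homotopyInvHomId := (Homotopy.ofEq (mapBifunctorMap_comp _ _ _ _ _)).trans
        ((mapBifunctorMapHomotopy₂ _ e'.homotopyInvHomId T _).trans
          (Homotopy.ofEq (by rw [Category.comp_id, mapBifunctorMap_id]))) }⟩

end Homotopy

/-! ### Formal properties of homotopy equivalence and boundedness -/

section HEquiv

variable {C D : Type*} [Category C] [Category D] [Preadditive C] [Preadditive D]

lemma HEquiv.of_iso {K L : ChainComplex C ℤ} (h : Nonempty (K ≅ L)) : HEquiv K L :=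
  h.map HomotopyEquiv.ofIso

lemma HEquiv.symm {K L : ChainComplex C ℤ} (h : HEquiv K L) : HEquiv L K :=
  HEquiv.equivalence.symm h

lemma HEquiv.trans {K L M : ChainComplex C ℤ} (h : HEquiv K L) (h' : HEquiv L M) : HEquiv K M :=
  HEquiv.equivalence.trans h h'

lemma HEquiv.map (F : C ⥤ D) [F.Additive] {K L : ChainComplex C ℤ} (h : HEquiv K L) :
    HEquiv ((F.mapHomologicalComplex _).obj K) ((F.mapHomologicalComplex _).obj L) :=
  Nonempty.map F.mapHomotopyEquiv h

lemma IsBounded.map (F : C ⥤ D) [F.Additive] {K : ChainComplex C ℤ} (h : IsBounded K) :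
    IsBounded ((F.mapHomologicalComplex _).obj K) := by
  obtain ⟨a, b, h⟩ := h
  exact ⟨a, b, fun n hn ↦ F.map_isZero (h n hn)⟩

lemma isBounded_inDegreeZero [HasZeroObject C] (M : C) : IsBounded (inDegreeZero M) :=
  ⟨0, 0, fun _ _ ↦ isZero_single_obj_X _ _ _ _ (by omega)⟩

end HEquiv

/-! ### Duality of complexes -/

section Duality

variable {C D C' D' : Type*} [Category C] [Category D] [Category C'] [Category D']
  [Preadditive C] [Preadditive D] [Preadditive C'] [Preadditive D']

lemma nonempty_dualComplex_iso (F : Cᵒᵖ ⥤ D) [F.Additive] {K L : ChainComplex C ℤ}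
    (h : Nonempty (K ≅ L)) : Nonempty (dualComplex F K ≅ dualComplex F L) := by
  obtain ⟨e⟩ := h
  refine ⟨Hom.isoOfComponents (fun n ↦ F.mapIso ((eval C _ (-n)).mapIso e.symm).op) ?_⟩
  intro n m _
  change F.map (e.inv.f (-n)).op ≫ ((n + 1).negOnePow • F.map (L.d (-m) (-n)).op) =
    ((n + 1).negOnePow • F.map (K.d (-m) (-n)).op) ≫ F.map (e.inv.f (-m)).op
  rw [Linear.comp_units_smul, Linear.units_smul_comp, ← F.map_comp, ← F.map_comp, ← op_comp,
    ← op_comp, e.inv.comm]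

/-- Functors that commute with duality of objects commute with duality of complexes. -/
lemma nonempty_map_dualComplex_iso (F : Cᵒᵖ ⥤ D) (F' : C'ᵒᵖ ⥤ D') (H : C ⥤ C') (H' : D ⥤ D')
    [F.Additive] [F'.Additive] [H.Additive] [H'.Additive]
    (e : ∀ X : C, H'.obj (F.obj (op X)) ≅ F'.obj (op (H.obj X)))
    (he : ∀ {X Y : C} (f : X ⟶ Y), H'.map (F.map f.op) ≫ (e X).hom =
      (e Y).hom ≫ F'.map (H.map f).op) (K : ChainComplex C ℤ) :
    Nonempty ((H'.mapHomologicalComplex _).obj (dualComplex F K) ≅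
      dualComplex F' ((H.mapHomologicalComplex _).obj K)) := by
  refine ⟨Hom.isoOfComponents (fun n ↦ e (K.X (-n))) ?_⟩
  intro n m _
  change (e (K.X (-n))).hom ≫ ((n + 1).negOnePow • F'.map (H.map (K.d (-m) (-n))).op) =
    H'.map ((n + 1).negOnePow • F.map (K.d (-m) (-n)).op) ≫ (e (K.X (-m))).hom
  rw [H'.map_units_smul, Linear.comp_units_smul, Linear.units_smul_comp, he]

/-- A complex of reflexive objects is isomorphic to its double dual. -/
lemma nonempty_dualComplex_dualComplex_iso (F : Cᵒᵖ ⥤ D) (F' : Dᵒᵖ ⥤ C)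
    [F.Additive] [F'.Additive]
    (e : ∀ X : C, X ⟶ F'.obj (op (F.obj (op X))))
    (he : ∀ {X Y : C} (f : X ⟶ Y), f ≫ e Y = e X ≫ F'.map (F.map f.op).op)
    (K : ChainComplex C ℤ) (hK : ∀ n, IsIso (e (K.X n))) :
    Nonempty (K ≅ dualComplex F' (dualComplex F K)) := by
  let ε (n : ℤ) : K.X n ≅ F'.obj (op (F.obj (op (K.X n)))) := @asIso _ _ _ _ (e (K.X n)) (hK n)
  -- The signs of the two dual differentials multiply to (-1)^{(n + 1) + (-(n - 1) + 1)} = -1. The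
  -- factor (-1)^n in degree `n` absorbs this.
  refine ⟨Hom.isoOfComponents (fun n ↦ n.negOnePow • (K.XIsoOfEq (neg_neg n).symm ≪≫
    ε (- -n))) ?_⟩
  rintro n m hnm
  obtain rfl : m = n - 1 := by simp only [ComplexShape.down_Rel] at hnm; omega
  change (n.negOnePow • ((K.XIsoOfEq (neg_neg n).symm).hom ≫ e (K.X (- -n)))) ≫
      ((n + 1).negOnePow • F'.map (((-(n - 1) + 1).negOnePow •
        F.map (K.d (- -n) (- -(n - 1))).op)).op) =
    K.d n (n - 1) ≫ ((n - 1).negOnePow •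
      ((K.XIsoOfEq (neg_neg (n - 1)).symm).hom ≫ e (K.X (- -(n - 1)))))
  have h : (((-(n - 1) + 1).negOnePow • F.map (K.d (- -n) (- -(n - 1))).op)).op =
      (-(n - 1) + 1).negOnePow • (F.map (K.d (- -n) (- -(n - 1))).op).op := rfl
  rw [h, F'.map_units_smul, Linear.units_smul_comp, Linear.comp_units_smul,
    Linear.comp_units_smul, Linear.comp_units_smul, smul_smul, smul_smul, Category.assoc, ← he,
    ← Int.negOnePow_add, ← Int.negOnePow_add, XIsoOfEq_hom_comp_d_assoc,
    d_comp_XIsoOfEq_hom_assoc]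
  congr 1
  rw [Int.negOnePow_eq_iff]
  -- The exponents n + 3 and n - 1 differ by 4 = 2 + 2.
  exact ⟨2, by ring⟩

lemma nonempty_dualComplex_single_iso [HasZeroObject C] [HasZeroObject D] (F : Cᵒᵖ ⥤ D)
    [F.Additive] (M : C) :
    Nonempty (dualComplex F (inDegreeZero M) ≅ inDegreeZero (F.obj (op M))) := by
  have h1 (n : ℤ) (hn : n ≠ 0) : IsZero ((dualComplex F (inDegreeZero M)).X n) :=
    isZero_dualComplex_X F (isZero_single_obj_X _ _ _ _ (by omega))
  have h2 (n : ℤ) (hn : n ≠ 0) : IsZero ((inDegreeZero (F.obj (op M))).X n) :=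
    isZero_single_obj_X _ _ _ _ hn
  refine ⟨Hom.isoOfComponents (fun n ↦ if hn : n = 0 then
    (F.mapIso (singleObjXIsoOfEq (ComplexShape.down ℤ) 0 M (-n) (by omega)).symm.op) ≪≫
      (singleObjXIsoOfEq (ComplexShape.down ℤ) 0 (F.obj (op M)) n hn).symm
    else (h1 n hn).iso (h2 n hn)) ?_⟩
  intro n m hnm
  simp only [ComplexShape.down_Rel] at hnm
  by_cases hn : n = 0
  · exact (h2 m (by omega)).eq_of_tgt _ _
  · exact (h1 n hn).eq_of_src _ _

end Duality

/-! ### Associativity of total complexes -/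

section Associativity

variable {C₁ C₂ C₃ C₁₂ C₂₃ D : Type*} [Category C₁] [Category C₂] [Category C₃] [Category C₁₂]
  [Category C₂₃] [Category D] [Preadditive C₁] [Preadditive C₂] [Preadditive C₃]
  [Preadditive C₁₂] [Preadditive C₂₃] [Preadditive D]
  (T₁₂ : C₁ ⥤ C₂ ⥤ C₁₂) [T₁₂.Additive] [∀ X, (T₁₂.obj X).Additive]
  (T : C₁₂ ⥤ C₃ ⥤ D) [T.Additive] [∀ X, (T.obj X).Additive]
  (T₂₃ : C₂ ⥤ C₃ ⥤ C₂₃) [T₂₃.Additive] [∀ X, (T₂₃.obj X).Additive]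
  (T' : C₁ ⥤ C₂₃ ⥤ D) [T'.Additive] [∀ X, (T'.obj X).Additive]
  [∀ (K : ChainComplex C₁ ℤ) (L : ChainComplex C₂ ℤ),
    HasMapBifunctor K L T₁₂ (ComplexShape.down ℤ)]
  [∀ (K : ChainComplex C₁₂ ℤ) (L : ChainComplex C₃ ℤ),
    HasMapBifunctor K L T (ComplexShape.down ℤ)]
  [∀ (K : ChainComplex C₂ ℤ) (L : ChainComplex C₃ ℤ),
    HasMapBifunctor K L T₂₃ (ComplexShape.down ℤ)]
  [∀ (K : ChainComplex C₁ ℤ) (L : ChainComplex C₂₃ ℤ),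
    HasMapBifunctor K L T' (ComplexShape.down ℤ)]

/-- The only obstruction is that the outer functors must preserve the coproducts forming the inner
total complexes. Boundedness of the first factor of each inner product ensures this, so `K₃` may be
unbounded. -/
lemma nonempty_tot_assoc_iso (e : bifunctorComp₁₂ T₁₂ T ≅ bifunctorComp₂₃ T' T₂₃)
    {K₁ : ChainComplex C₁ ℤ} {K₂ : ChainComplex C₂ ℤ} (K₃ : ChainComplex C₃ ℤ)
    (h₁ : IsBounded K₁) (h₂ : IsBounded K₂) :
    Nonempty (tot T (tot T₁₂ K₁ K₂) K₃ ≅ tot T' K₁ (tot T₂₃ K₂ K₃)) := by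
  have : HasGoodTrifunctor₁₂Obj T₁₂ T K₁ K₂ K₃ (ComplexShape.down ℤ) (ComplexShape.down ℤ) := by
    intro n i
    have : (T.flip.obj (K₃.X i)).Additive := { }
    exact preservesColimit_fiber T₁₂ h₁ K₂ _ n
  have : HasGoodTrifunctor₂₃Obj T' T₂₃ K₁ K₂ K₃ (ComplexShape.down ℤ) (ComplexShape.down ℤ)
      (ComplexShape.down ℤ) := by
    intro i n
    exact preservesColimit_fiber T₂₃ h₂ K₃ _ n
  exact ⟨mapBifunctorAssociator e K₁ K₂ K₃ (ComplexShape.down ℤ) (ComplexShape.down ℤ)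
    (ComplexShape.down ℤ)⟩

end Associativity

/-! ### The tensor product over a group algebra -/

section BimoduleTensor

variable {k : Type u} [Field k] {G H K J : Type u} [Group G] [Group H] [Group K] [Group J]

lemma rep_hom_ext {M N : Rep.{u} k G} {f g : M ⟶ N}
    (h : ∀ x : M, f.hom.toLinearMap x = g.hom.toLinearMap x) : f = g :=
  Rep.hom_ext (Representation.IntertwiningMap.ext (LinearMap.ext h))

/-- A linear map that commutes with the group action, as a morphism. -/
def homMk {M N : Rep.{u} k G} (f : M.V →ₗ[k] N.V) (hf : ∀ g x, f (M.ρ g x) = N.ρ g (f x)) :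
    M ⟶ N :=
  Rep.ofHom (⟨f, fun g ↦ LinearMap.ext (hf g)⟩ : M.ρ.IntertwiningMap N.ρ)

/-- A linear equivalence that commutes with the group action, as an isomorphism. -/
def isoMk {M N : Rep.{u} k G} (f : M.V ≃ₗ[k] N.V) (hf : ∀ g x, f (M.ρ g x) = N.ρ g (f x)) :
    M ≅ N where
  hom := homMk f.toLinearMap hf
  inv := homMk f.symm.toLinearMap fun g x ↦ by
    apply f.injective
    simp [hf]
  hom_inv_id := rep_hom_ext fun x ↦ f.symm_apply_apply x
  inv_hom_id := rep_hom_ext fun x ↦ f.apply_symm_apply x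

@[simp]
lemma rho_one_one (M : Rep.{u} k (G × H)) (m : M) : M.ρ (1, 1) m = m := by
  rw [← Prod.one_eq_mk, map_one, Module.End.one_apply]

variable {M : Rep.{u} k (G × H)} {N : Rep.{u} k (H × K)} {L : Rep.{u} k (K × J)}

variable (M N) in
/-- The pure tensors of `M ⊗_{kH} N`. -/
def pure : M.V →ₗ[k] N.V →ₗ[k] (bimoduleTensorObj M N).V :=
  (TensorProduct.mk k M.V N.V).compr₂ (Representation.Coinvariants.mk (middleAction M N))

lemma pure_middle (h : H) (m : M) (n : N) :
    pure M N (M.ρ (1, h) m) (N.ρ (h, 1) n) = pure M N m n :=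
  Representation.Coinvariants.mk_self_apply (middleAction M N) h (m ⊗ₜ[k] n)

lemma pure_middle' (h : H) (m : M) (n : N) :
    pure M N (M.ρ (1, h) m) n = pure M N m (N.ρ (h⁻¹, 1) n) := by
  rw [← pure_middle h m, ← Module.End.mul_apply (N.ρ _), ← map_mul]
  simp

lemma rho_pure (x : G × K) (m : M) (n : N) :
    (bimoduleTensorObj M N).ρ x (pure M N m n) = pure M N (M.ρ (x.1, 1) m) (N.ρ (1, x.2) n) :=
  rfl

lemma tensor_ext {W : Type*} [AddCommGroup W] [Module k W]
    {f g : (bimoduleTensorObj M N).V →ₗ[k] W} (h : ∀ m n, f (pure M N m n) = g (pure M N m n)) :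
    f = g :=
  Representation.Coinvariants.hom_ext (TensorProduct.ext' h)

lemma tensor_induction {P : (bimoduleTensorObj M N).V → Prop} (pure : ∀ m n, P (pure M N m n))
    (add : ∀ x y, P x → P y → P (x + y)) (x : (bimoduleTensorObj M N).V) : P x := by
  obtain ⟨t, rfl⟩ := Representation.Coinvariants.mk_surjective (middleAction M N) x
  induction t with
  | zero =>
    have h := pure 0 0
    rw [map_zero] at h ⊢
    exact h
  | tmul m n => exact pure m n
  | add s t hs ht => rw [map_add]; exact add _ _ hs ht

/-- Linear maps out of `M ⊗_{kH} N`. -/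
def tensorLift {W : Type*} [AddCommGroup W] [Module k W] (f : M.V →ₗ[k] N.V →ₗ[k] W)
    (hf : ∀ h m n, f (M.ρ (1, h) m) (N.ρ (h, 1) n) = f m n) :
    (bimoduleTensorObj M N).V →ₗ[k] W :=
  Representation.Coinvariants.lift (middleAction M N) (TensorProduct.lift f)
    fun h ↦ TensorProduct.ext' fun m n ↦ hf h m n

lemma tensorLift_pure {W : Type*} [AddCommGroup W] [Module k W] (f : M.V →ₗ[k] N.V →ₗ[k] W) (hf)
    (m : M) (n : N) : tensorLift f hf (pure M N m n) = f m n := rfl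

lemma tensor_ext_left {W : Type*} [AddCommGroup W] [Module k W]
    {f g : (bimoduleTensorObj (bimoduleTensorObj M N) L).V →ₗ[k] W}
    (h : ∀ m n l, f (pure _ L (pure M N m n) l) = g (pure _ L (pure M N m n) l)) : f = g := by
  refine tensor_ext fun x l ↦ ?_
  revert x
  exact LinearMap.congr_fun (f := f ∘ₗ (pure (bimoduleTensorObj M N) L).flip l)
    (g := g ∘ₗ (pure (bimoduleTensorObj M N) L).flip l) (tensor_ext fun m n ↦ h m n l)

lemma tensor_ext_right {W : Type*} [AddCommGroup W] [Module k W]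
    {f g : (bimoduleTensorObj M (bimoduleTensorObj N L)).V →ₗ[k] W}
    (h : ∀ m n l, f (pure M _ m (pure N L n l)) = g (pure M _ m (pure N L n l))) : f = g := by
  refine tensor_ext fun m x ↦ ?_
  revert x
  exact LinearMap.congr_fun (f := f ∘ₗ pure M (bimoduleTensorObj N L) m)
    (g := g ∘ₗ pure M (bimoduleTensorObj N L) m) (tensor_ext fun n l ↦ h m n l)

variable (M N L)

/-- The linear map `(m ⊗ n) ⊗ l ↦ m ⊗ (n ⊗ l)`. -/
def assocLinear : (bimoduleTensorObj (bimoduleTensorObj M N) L).V →ₗ[k]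
    (bimoduleTensorObj M (bimoduleTensorObj N L)).V :=
  tensorLift (tensorLift
    (LinearMap.mk₂ k (fun m n ↦ pure M (bimoduleTensorObj N L) m ∘ₗ pure N L n)
      (by intros; ext; simp) (by intros; ext; simp) (by intros; ext; simp) (by intros; ext; simp))
    fun h m n ↦ LinearMap.ext fun l ↦ by
      change pure M (bimoduleTensorObj N L) (M.ρ (1, h) m) (pure N L (N.ρ (h, 1) n) l) =
        pure M (bimoduleTensorObj N L) m (pure N L n l)
      rw [← pure_middle h m, rho_pure, rho_one_one])
    fun h x l ↦ by
      induction x using tensor_induction with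
      | pure m n =>
        change pure M (bimoduleTensorObj N L) (M.ρ (1, 1) m)
          (pure N L (N.ρ (1, h) n) (L.ρ (h, 1) l)) =
          pure M (bimoduleTensorObj N L) m (pure N L n l)
        rw [pure_middle, rho_one_one]
      | add x y hx hy => simp only [map_add, LinearMap.add_apply, hx, hy]

/-- The linear map `n ⊗ l ↦ (m ⊗ n) ⊗ l`. -/
def assocAux (m : M) : (bimoduleTensorObj N L).V →ₗ[k]
    (bimoduleTensorObj (bimoduleTensorObj M N) L).V :=
  tensorLift
    (LinearMap.mk₂ k (fun n l ↦ pure (bimoduleTensorObj M N) L (pure M N m n) l)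
      (by intros; simp) (by intros; simp) (by intros; simp) (by intros; simp))
    (fun h n l ↦ by
      change pure (bimoduleTensorObj M N) L (pure M N m (N.ρ (1, h) n)) (L.ρ (h, 1) l) =
        pure (bimoduleTensorObj M N) L (pure M N m n) l
      rw [← pure_middle h (pure M N m n), rho_pure, rho_one_one])

lemma assocAux_pure (m : M) (n : N) (l : L) : assocAux M N L m (pure N L n l) =
    pure (bimoduleTensorObj M N) L (pure M N m n) l := rfl

/-- The linear map `m ⊗ (n ⊗ l) ↦ (m ⊗ n) ⊗ l`. -/
def assocLinearInv : (bimoduleTensorObj M (bimoduleTensorObj N L)).V →ₗ[k]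
    (bimoduleTensorObj (bimoduleTensorObj M N) L).V :=
  tensorLift (LinearMap.mk₂ k (fun m x ↦ assocAux M N L m x)
      (fun m m' x ↦ by
        induction x using tensor_induction with
        | pure n l => simp [assocAux_pure]
        | add x y hx hy => rw [map_add, hx, hy, map_add, map_add]; abel)
      (fun c m x ↦ by
        induction x using tensor_induction with
        | pure n l => simp [assocAux_pure]
        | add x y hx hy => rw [map_add, hx, hy, map_add, smul_add])
      (by intros; simp) (by intros; simp))
    fun h m x ↦ by
      induction x using tensor_induction with
      | pure n l =>
        change pure (bimoduleTensorObj M N) L (pure M N (M.ρ (1, h) m) (N.ρ (h, 1) n))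
          (L.ρ (1, 1) l) = pure (bimoduleTensorObj M N) L (pure M N m n) l
        rw [pure_middle, rho_one_one]
      | add x y hx hy => simp only [map_add, hx, hy]

/-- The associativity isomorphism. -/
def assocIso : bimoduleTensorObj (bimoduleTensorObj M N) L ≅
    bimoduleTensorObj M (bimoduleTensorObj N L) :=
  isoMk (LinearEquiv.ofLinearMap (assocLinear M N L) (assocLinearInv M N L)
    (tensor_ext_right fun _ _ _ ↦ rfl) (tensor_ext_left fun _ _ _ ↦ rfl))
    fun g x ↦ by
      refine LinearMap.congr_fun
        (f := assocLinear M N L ∘ₗ (bimoduleTensorObj (bimoduleTensorObj M N) L).ρ g)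
        (g := (bimoduleTensorObj M (bimoduleTensorObj N L)).ρ g ∘ₗ assocLinear M N L)
        (tensor_ext_left fun m n l ↦ ?_) x
      change pure M (bimoduleTensorObj N L) (M.ρ (g.1, 1) m)
        (pure N L (N.ρ (1, 1) n) (L.ρ (1, g.2) l)) =
          pure M (bimoduleTensorObj N L) (M.ρ (g.1, 1) m)
            (pure N L (N.ρ (1, 1) n) (L.ρ (1, g.2) l))
      rfl

variable (k G H K J) in
/-- Associativity of the tensor product of bimodules, as an isomorphism of trifunctors. -/
def assocNatIso : bifunctorComp₁₂ (bimoduleTensor k G H K) (bimoduleTensor k G K J) ≅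
    bifunctorComp₂₃ (bimoduleTensor k G H J) (bimoduleTensor k H K J) :=
  NatIso.ofComponents (fun M ↦ NatIso.ofComponents (fun N ↦ NatIso.ofComponents
    (fun L ↦ assocIso M N L)
    (fun f ↦ rep_hom_ext (LinearMap.congr_fun (tensor_ext_left fun _ _ _ ↦ rfl))))
    (fun f ↦ by
      ext L : 2
      exact rep_hom_ext (LinearMap.congr_fun (tensor_ext_left fun _ _ _ ↦ rfl))))
    (fun f ↦ by
      ext N L : 4
      exact rep_hom_ext (LinearMap.congr_fun (tensor_ext_left fun _ _ _ ↦ rfl)))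

end BimoduleTensor

/-! ### The regular bimodule as a left unit -/

section Unit

variable (k : Type u) [Field k] (G H : Type u) [Group G] [Group H]

variable {G H} in
/-- The basis element of the regular bimodule given by `x : G`. -/
def regularSingle (x : G) : (regularBimodule k G).V := MonoidAlgebra.single x (1 : k)

lemma rho_regularSingle (a : G × G) (x : G) :
    (regularBimodule k G).ρ a (regularSingle k x) = regularSingle k (a.1 * x * a.2⁻¹) := by
  change regularRepresentation k G a (MonoidAlgebra.single x 1) = MonoidAlgebra.single _ 1
  simp [regularRepresentation]

variable {k G H} in
lemma regular_ext {W : Type*} [AddCommGroup W] [Module k W]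
    {f g : (regularBimodule k G).V →ₗ[k] W}
    (h : ∀ x, f (regularSingle k x) = g (regularSingle k x)) : f = g :=
  MonoidAlgebra.lhom_ext' (R := k) fun x ↦ LinearMap.ext_ring (h x)

variable {k G H} in
lemma regular_tensor_ext {N : Rep.{u} k (G × H)} {W : Type*} [AddCommGroup W] [Module k W]
    {f g : (bimoduleTensorObj (regularBimodule k G) N).V →ₗ[k] W}
    (h : ∀ x n, f (pure (regularBimodule k G) N (regularSingle k x) n) =
      g (pure (regularBimodule k G) N (regularSingle k x) n)) : f = g := by
  refine tensor_ext fun m n ↦ ?_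
  revert m
  exact LinearMap.congr_fun (f := f ∘ₗ (pure (regularBimodule k G) N).flip n)
    (g := g ∘ₗ (pure (regularBimodule k G) N).flip n) (regular_ext fun x ↦ h x n)

variable {G H}

/-- The bilinear map `kG × N → N` given by the action of `G` on `N`. -/
def actionLinear (N : Rep.{u} k (G × H)) : (regularBimodule k G).V →ₗ[k] N.V →ₗ[k] N.V :=
  (Finsupp.lift (Module.End k N.V) k G fun x : G ↦ N.ρ (x, 1)) ∘ₗ
    (MonoidAlgebra.coeffLinearEquiv k).toLinearMap

lemma actionLinear_single (N : Rep.{u} k (G × H)) (x : G) (n : N) :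
    actionLinear k N (regularSingle k x) n = N.ρ (x, 1) n := by
  change (Finsupp.lift (Module.End k N.V) k G fun x : G ↦ N.ρ (x, 1)) (Finsupp.single x (1 : k)) n
    = _
  simp

/-- The linear map `kG ⊗_{kG} N → N`. -/
def unitLinear (N : Rep.{u} k (G × H)) :
    (bimoduleTensorObj (regularBimodule k G) N).V →ₗ[k] N.V :=
  tensorLift (actionLinear k N) fun h m n ↦ by
    revert m
    refine LinearMap.congr_fun (f := (actionLinear k N).flip (N.ρ (h, 1) n) ∘ₗ
      (regularBimodule k G).ρ (1, h)) (g := (actionLinear k N).flip n) (regular_ext fun x ↦ ?_)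
    simp only [LinearMap.comp_apply, LinearMap.flip_apply]
    rw [rho_regularSingle, actionLinear_single, actionLinear_single, ← Module.End.mul_apply,
      ← map_mul]
    simp

lemma unitLinear_pure_single (N : Rep.{u} k (G × H)) (x : G) (n : N) :
    unitLinear k N (pure (regularBimodule k G) N (regularSingle k x) n) = N.ρ (x, 1) n :=
  actionLinear_single k N x n

/-- The isomorphism `kG ⊗_{kG} N ≅ N`. -/
def unitIso (N : Rep.{u} k (G × H)) : bimoduleTensorObj (regularBimodule k G) N ≅ N :=
  isoMk (LinearEquiv.ofLinearMap (unitLinear k N)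
    (pure (regularBimodule k G) N (regularSingle k 1))
    (LinearMap.ext fun n ↦ by simp [unitLinear_pure_single])
    (regular_tensor_ext fun x n ↦ by
      -- In kG ⊗_{kG} N one has 1 ⊗ xn = x ⊗ n. Writing x as the inverse of x⁻¹ brings this into the
      -- form of `pure_middle'`.
      rw [LinearMap.comp_apply, unitLinear_pure_single, LinearMap.id_apply, ← inv_inv x,
        ← pure_middle', rho_regularSingle]
      simp))
    fun g ↦ LinearMap.congr_fun
      (f := unitLinear k N ∘ₗ (bimoduleTensorObj (regularBimodule k G) N).ρ g)
      (g := N.ρ g ∘ₗ unitLinear k N)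
      (regular_tensor_ext fun x n ↦ by
        simp only [LinearMap.comp_apply, rho_pure, rho_regularSingle, unitLinear_pure_single,
          ← Module.End.mul_apply, ← map_mul]
        congr 2
        ext <;> simp)

variable (G H) in
/-- `kG` is a unit for the tensor product of bimodules. -/
def unitNatIso : (bimoduleTensor k G G H).obj (regularBimodule k G) ≅ 𝟭 _ :=
  NatIso.ofComponents (unitIso k) fun {N N'} f ↦ by
    refine rep_hom_ext (LinearMap.congr_fun (regular_tensor_ext fun x n ↦ ?_))
    change unitLinear k N' (pure (regularBimodule k G) N' (regularSingle k x)
      (f.hom.toLinearMap n)) =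
      f.hom.toLinearMap (unitLinear k N (pure (regularBimodule k G) N (regularSingle k x) n))
    rw [unitLinear_pure_single, unitLinear_pure_single]
    exact (Rep.hom_comm_apply f _ _).symm

end Unit

/-! ### Induction from the diagonal subgroup -/

section Ind

variable {k : Type u} [Field k] {G : Type u} [Group G]

/-- The element of `Ind_{ΔG}^{G × G} M` given by `m` in the component `x`. -/
def indSingle (M : Rep.{u} k G) (x : G) : M.V →ₗ[k] ((indDiag k G).obj M).V :=
  (indDiagEquiv M).symm.toLinearMap ∘ₗ Finsupp.lsingle x

lemma rho_indSingle (M : Rep.{u} k G) (g : G × G) (x : G) (m : M) :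
    ((indDiag k G).obj M).ρ g (indSingle M x m) =
      indSingle M (g.1 * x * g.2⁻¹) (M.ρ g.2 m) :=
  indDiagEquiv_symm_action M g x m

lemma ind_ext {M : Rep.{u} k G} {W : Type*} [AddCommGroup W] [Module k W]
    {f g : ((indDiag k G).obj M).V →ₗ[k] W}
    (h : ∀ x m, f (indSingle M x m) = g (indSingle M x m)) : f = g := by
  have : f ∘ₗ (indDiagEquiv M).symm.toLinearMap = g ∘ₗ (indDiagEquiv M).symm.toLinearMap :=
    Finsupp.lhom_ext h
  refine LinearMap.ext fun x ↦ ?_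
  have h' := LinearMap.congr_fun this (indDiagEquiv M x)
  simpa using h'

lemma ind_induction {M : Rep.{u} k G} {P : ((indDiag k G).obj M).V → Prop}
    (single : ∀ x m, P (indSingle M x m)) (add : ∀ x y, P x → P y → P (x + y))
    (x : ((indDiag k G).obj M).V) : P x := by
  obtain ⟨y, rfl⟩ := (indDiagEquiv M).symm.surjective x
  induction y using Finsupp.induction_linear with
  | zero =>
    have h := single 1 0
    rw [map_zero] at h ⊢
    exact h
  | single x m => exact single x m
  | add x y hx hy => rw [map_add]; exact add _ _ hx hy

/-- Linear maps out of `Ind_{ΔG}^{G × G} M`. -/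
def indLift {M : Rep.{u} k G} {W : Type*} [AddCommGroup W] [Module k W] (f : G → M.V →ₗ[k] W) :
    ((indDiag k G).obj M).V →ₗ[k] W :=
  Finsupp.lsum k f ∘ₗ (indDiagEquiv M).toLinearMap

lemma indLift_single {M : Rep.{u} k G} {W : Type*} [AddCommGroup W] [Module k W]
    (f : G → M.V →ₗ[k] W) (x : G) (m : M) : indLift f (indSingle M x m) = f x m := by
  simp [indLift, indSingle]

lemma indDiag_map_single {M N : Rep.{u} k G} (f : M ⟶ N) (x : G) (m : M) :
    ((indDiag k G).map f).hom.toLinearMap (indSingle M x m) =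
      indSingle N x (f.hom.toLinearMap m) := by
  change ((indDiag k G).map f).hom.toLinearMap ((indDiagEquiv M).symm (Finsupp.single x m)) =
    (indDiagEquiv N).symm (Finsupp.single x _)
  rw [indDiagEquiv_symm_single, indDiagEquiv_symm_single]
  change Representation.IndV.mk (diag G) N.ρ (1, x) (f.hom (M.ρ x m)) = _
  rw [Rep.hom_comm_apply]
  rfl

variable (k G) in
/-- The linear equivalence `Ind_{ΔG}^{G × G} k ≃ kG`. -/
def indTrivialEquiv : ((indDiag k G).obj (Rep.trivial k G k)).V ≃ₗ[k] (regularBimodule k G).V :=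
  (indDiagEquiv (Rep.trivial k G k)).trans (MonoidAlgebra.coeffLinearEquiv k).symm

lemma indTrivialEquiv_single (x : G) (c : k) :
    indTrivialEquiv k G (indSingle (Rep.trivial k G k) x c) = c • regularSingle k x := by
  change (MonoidAlgebra.coeffLinearEquiv k).symm (indDiagEquiv (Rep.trivial k G k)
    ((indDiagEquiv (Rep.trivial k G k)).symm (Finsupp.single x c))) =
      c • MonoidAlgebra.single x (1 : k)
  rw [LinearEquiv.apply_symm_apply, MonoidAlgebra.smul_single, smul_eq_mul, mul_one]
  rfl

variable (k G) in
/-- The regular bimodule is induced from the trivial module. -/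
def indTrivialIso : (indDiag k G).obj (Rep.trivial k G k) ≅ regularBimodule k G :=
  isoMk (indTrivialEquiv k G) fun g ↦ LinearMap.congr_fun
    (f := (indTrivialEquiv k G).toLinearMap ∘ₗ ((indDiag k G).obj (Rep.trivial k G k)).ρ g)
    (g := (regularBimodule k G).ρ g ∘ₗ (indTrivialEquiv k G).toLinearMap)
    (ind_ext fun x (c : k) ↦ by
      change indTrivialEquiv k G (((indDiag k G).obj (Rep.trivial k G k)).ρ g
        (indSingle _ x c)) = (regularBimodule k G).ρ g (indTrivialEquiv k G (indSingle _ x c))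
      rw [rho_indSingle, indTrivialEquiv_single, indTrivialEquiv_single, map_smul,
        rho_regularSingle]
      rfl)

/-! ### Tensor products of induced modules -/

section Tensor

open MonoidalCategory

variable (M N : Rep.{u} k G)

lemma rho_tmul (g : G) (m : M) (n : N) :
    (M ⊗ N).ρ g (m ⊗ₜ[k] n) = M.ρ g m ⊗ₜ[k] N.ρ g n := rfl

/-- `(m in x) ⊗ (n in y) ↦ (y⁻¹ m ⊗ n in x y)`. -/
def indTensorBilinear : ((indDiag k G).obj M).V →ₗ[k]
    ((indDiag k G).obj N).V →ₗ[k] ((indDiag k G).obj (M ⊗ N)).V :=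
  -- The element n in component y is y · (n in component 1). Moving y across the tensor sign sends m
  -- in component x to y⁻¹m in component xy, which gives this formula and also the inverse map.
  indLift fun x ↦ LinearMap.flip (indLift fun y ↦
    LinearMap.flip ((TensorProduct.mk k M.V N.V).compr₂ (indSingle (M ⊗ N) (x * y)) ∘ₗ M.ρ y⁻¹))

lemma indTensorBilinear_single (x y : G) (m : M) (n : N) :
    indTensorBilinear M N (indSingle M x m) (indSingle N y n) =
      indSingle (M ⊗ N) (x * y) (M.ρ y⁻¹ m ⊗ₜ n) := by
  rw [indTensorBilinear, indLift_single, LinearMap.flip_apply, indLift_single]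
  rfl

/-- `(m in x) ⊗ (n in y) ↦ (y⁻¹ m ⊗ n in x y)`, on the tensor product. -/
def indTensorLinear : (bimoduleTensorObj ((indDiag k G).obj M) ((indDiag k G).obj N)).V →ₗ[k]
    ((indDiag k G).obj (M ⊗ N)).V :=
  tensorLift (indTensorBilinear M N) fun h m n ↦ by
    induction m using ind_induction with
    | add x y hx hy => simp only [map_add, LinearMap.add_apply, hx, hy]
    | single x m =>
      induction n using ind_induction with
      | add x y hx hy => simp only [map_add, hx, hy]
      | single y n =>
        rw [rho_indSingle, rho_indSingle, indTensorBilinear_single, indTensorBilinear_single,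
          ← Module.End.mul_apply, ← map_mul]
        simp

lemma indTensorLinear_pure (x y : G) (m : M) (n : N) :
    indTensorLinear M N (pure _ _ (indSingle M x m) (indSingle N y n)) =
      indSingle (M ⊗ N) (x * y) (M.ρ y⁻¹ m ⊗ₜ n) :=
  indTensorBilinear_single M N x y m n

variable {M N} in
lemma ind_tensor_ext {W : Type*} [AddCommGroup W] [Module k W]
    {f g : (bimoduleTensorObj ((indDiag k G).obj M) ((indDiag k G).obj N)).V →ₗ[k] W}
    (h : ∀ x y m n, f (pure _ _ (indSingle M x m) (indSingle N y n)) =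
      g (pure _ _ (indSingle M x m) (indSingle N y n))) : f = g := by
  refine tensor_ext fun m n ↦ ?_
  induction m using ind_induction with
  | add x y hx hy => simp only [map_add, LinearMap.add_apply, hx, hy]
  | single x m =>
    induction n using ind_induction with
    | add x y hx hy => simp only [map_add, hx, hy]
    | single y n => exact h x y m n

/-- `(m ⊗ n in z) ↦ (m in z) ⊗ (n in 1)`. -/
def indTensorLinearInv : ((indDiag k G).obj (M ⊗ N)).V →ₗ[k]
    (bimoduleTensorObj ((indDiag k G).obj M) ((indDiag k G).obj N)).V :=
  indLift fun z ↦ TensorProduct.lift ((pure _ _).compl₁₂ (indSingle M z) (indSingle N 1))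

lemma indTensorLinearInv_single (z : G) (m : M) (n : N) :
    indTensorLinearInv M N (indSingle (M ⊗ N) z (m ⊗ₜ n)) =
      pure _ _ (indSingle M z m) (indSingle N 1 n) := by
  rw [indTensorLinearInv, indLift_single]
  rfl

/-- The isomorphism `Ind M ⊗_{kG} Ind N ≅ Ind (M ⊗ N)`. -/
def indTensorIso : bimoduleTensorObj ((indDiag k G).obj M) ((indDiag k G).obj N) ≅
    (indDiag k G).obj (M ⊗ N) :=
  isoMk (LinearEquiv.ofLinearMap (indTensorLinear M N) (indTensorLinearInv M N)
    (ind_ext fun z t ↦ by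
      revert t
      refine LinearMap.congr_fun (f := (indTensorLinear M N ∘ₗ indTensorLinearInv M N) ∘ₗ
        indSingle (M ⊗ N) z) (g := indSingle (M ⊗ N) z) (TensorProduct.ext' fun m n ↦ ?_)
      rw [LinearMap.comp_apply, LinearMap.comp_apply, indTensorLinearInv_single,
        indTensorLinear_pure]
      simp)
    (ind_tensor_ext fun x y m n ↦ by
      rw [LinearMap.comp_apply, indTensorLinear_pure, indTensorLinearInv_single]
      have h := pure_middle (M := (indDiag k G).obj M) (N := (indDiag k G).obj N) y⁻¹
        (indSingle M x m) (indSingle N y n)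
      rw [rho_indSingle, rho_indSingle] at h
      simpa using h))
    fun g ↦ LinearMap.congr_fun
      (f := indTensorLinear M N ∘ₗ (bimoduleTensorObj _ _).ρ g)
      (g := ((indDiag k G).obj (M ⊗ N)).ρ g ∘ₗ indTensorLinear M N)
      (ind_tensor_ext fun x y m n ↦ by
        rw [LinearMap.comp_apply, LinearMap.comp_apply, rho_pure, rho_indSingle, rho_indSingle,
          indTensorLinear_pure, indTensorLinear_pure, rho_indSingle, rho_tmul]
        simp only [← Module.End.mul_apply, ← map_mul]
        simp [mul_assoc])

lemma indTensorIso_hom_pure (x y : G) (m : M) (n : N) :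
    (indTensorIso M N).hom.hom.toLinearMap (pure _ _ (indSingle M x m) (indSingle N y n)) =
      indSingle (M ⊗ N) (x * y) (M.ρ y⁻¹ m ⊗ₜ n) :=
  indTensorBilinear_single M N x y m n

variable {M N}

lemma indTensorIso_naturality_left {M' : Rep.{u} k G} (f : M ⟶ M') :
    ((bimoduleTensor k G G G).map ((indDiag k G).map f)).app ((indDiag k G).obj N) ≫
      (indTensorIso M' N).hom = (indTensorIso M N).hom ≫
        (indDiag k G).map (((curriedTensor (Rep.{u} k G)).map f).app N) := by
  refine rep_hom_ext (LinearMap.congr_fun (ind_tensor_ext fun x y m n ↦ ?_))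
  change (indTensorIso M' N).hom.hom.toLinearMap (pure _ _
    (((indDiag k G).map f).hom.toLinearMap (indSingle M x m)) (indSingle N y n)) =
    ((indDiag k G).map (((curriedTensor (Rep.{u} k G)).map f).app N)).hom.toLinearMap
      ((indTensorIso M N).hom.hom.toLinearMap (pure _ _ (indSingle M x m) (indSingle N y n)))
  rw [indDiag_map_single, indTensorIso_hom_pure, indTensorIso_hom_pure]
  refine Eq.trans ?_ (indDiag_map_single (((curriedTensor (Rep.{u} k G)).map f).app N) (x * y)
    (M.ρ y⁻¹ m ⊗ₜ[k] n)).symm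
  congr 1
  change M'.ρ y⁻¹ (f.hom m) ⊗ₜ[k] n = f.hom (M.ρ y⁻¹ m) ⊗ₜ[k] n
  rw [Rep.hom_comm_apply]

lemma indTensorIso_naturality_right {N' : Rep.{u} k G} (f : N ⟶ N') :
    ((bimoduleTensor k G G G).obj ((indDiag k G).obj M)).map ((indDiag k G).map f) ≫
      (indTensorIso M N').hom = (indTensorIso M N).hom ≫
        (indDiag k G).map (((curriedTensor (Rep.{u} k G)).obj M).map f) := by
  refine rep_hom_ext (LinearMap.congr_fun (ind_tensor_ext fun x y m n ↦ ?_))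
  change (indTensorIso M N').hom.hom.toLinearMap (pure _ _ (indSingle M x m)
    (((indDiag k G).map f).hom.toLinearMap (indSingle N y n))) =
    ((indDiag k G).map (((curriedTensor (Rep.{u} k G)).obj M).map f)).hom.toLinearMap
      ((indTensorIso M N).hom.hom.toLinearMap (pure _ _ (indSingle M x m) (indSingle N y n)))
  rw [indDiag_map_single, indTensorIso_hom_pure, indTensorIso_hom_pure]
  exact (indDiag_map_single (((curriedTensor (Rep.{u} k G)).obj M).map f) (x * y)
    (M.ρ y⁻¹ m ⊗ₜ[k] n)).symm

end Tensor

/-! ### Recovering a module from the induced bimodule -/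

section Recover

variable (k G) in
/-- The functor that sends a `(kG, kG)`-bimodule `M` to the `kG`-module `M ⊗_{kG} k`. -/
def coinvariantsRight : Rep.{u} k (G × G) ⥤ Rep.{u} k G :=
  -- The left module k is regarded as a bimodule with the one-element group acting on the right, so
  -- that the bimodule tensor product applies. Restriction along G → G × 1 then removes that group.
  (bimoduleTensor k G G PUnit.{u + 1}).flip.obj (Rep.trivial k (G × PUnit.{u + 1}) k) ⋙
    Rep.resFunctor ((MonoidHom.id G).prod (1 : G →* PUnit.{u + 1}))

instance : (coinvariantsRight k G).Additive where
  map_add {M N f g} := by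
    have h := congrArg (fun φ ↦ φ.app (Rep.trivial k (G × PUnit.{u + 1}) k))
      ((bimoduleTensor k G G PUnit.{u + 1}).map_add (f := f) (g := g))
    exact congrArg (Rep.resFunctor ((MonoidHom.id G).prod (1 : G →* PUnit.{u + 1}))).map h

/-- `(m in x) ⊗ c ↦ c x m`. -/
def recoverLinear (M : Rep.{u} k G) :
    (bimoduleTensorObj ((indDiag k G).obj M) (Rep.trivial k (G × PUnit.{u + 1}) k)).V →ₗ[k] M.V :=
  tensorLift ((LinearMap.lsmul k M.V).flip ∘ₗ indLift fun x ↦ M.ρ x)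
    fun h m c ↦ by
      change c • indLift (fun x ↦ M.ρ x) _ = c • indLift (fun x ↦ M.ρ x) _
      congr 1
      induction m using ind_induction with
      | add x y hx hy => simp only [map_add, hx, hy]
      | single x m =>
        rw [rho_indSingle, indLift_single, indLift_single, ← Module.End.mul_apply, ← map_mul]
        simp

lemma recoverLinear_pure (M : Rep.{u} k G) (x : G) (m : M) (c : k) :
    recoverLinear M (pure _ (Rep.trivial k (G × PUnit.{u + 1}) k) (indSingle M x m) c) =
      c • M.ρ x m := by
  change c • indLift (fun x ↦ M.ρ x) (indSingle M x m) = _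
  rw [indLift_single]

lemma recover_ext {M : Rep.{u} k G} {W : Type*} [AddCommGroup W] [Module k W]
    {f g : (bimoduleTensorObj ((indDiag k G).obj M)
      (Rep.trivial k (G × PUnit.{u + 1}) k)).V →ₗ[k] W}
    (h : ∀ x m c, f (pure _ (Rep.trivial k (G × PUnit.{u + 1}) k) (indSingle M x m) c) =
      g (pure _ (Rep.trivial k (G × PUnit.{u + 1}) k) (indSingle M x m) c)) : f = g := by
  refine tensor_ext fun m n ↦ ?_
  induction m using ind_induction with
  | add x y hx hy => simp only [map_add, LinearMap.add_apply, hx, hy]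
  | single x m => exact h x m n

/-- The isomorphism `Ind M ⊗_{kG} k ≅ M`. -/
def recoverIso (M : Rep.{u} k G) : (coinvariantsRight k G).obj ((indDiag k G).obj M) ≅ M :=
  isoMk (LinearEquiv.ofLinearMap (recoverLinear M)
    ((pure _ (Rep.trivial k (G × PUnit.{u + 1}) k)).flip (1 : k) ∘ₗ indSingle M 1)
    (LinearMap.ext fun m ↦ by
      change recoverLinear M (pure _ (Rep.trivial k (G × PUnit.{u + 1}) k) (indSingle M 1 m)
        (1 : k)) = m
      rw [recoverLinear_pure]
      simp)
    (recover_ext fun x m (c : k) ↦ by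
      change pure _ (Rep.trivial k (G × PUnit.{u + 1}) k) (indSingle M 1 (recoverLinear M
        (pure _ (Rep.trivial k (G × PUnit.{u + 1}) k) (indSingle M x m) c))) (1 : k) =
        pure _ (Rep.trivial k (G × PUnit.{u + 1}) k) (indSingle M x m) c
      rw [recoverLinear_pure, ← pure_middle x (indSingle M x m), rho_indSingle, map_smul, map_smul,
        LinearMap.smul_apply, ← map_smul]
      have h : (Rep.trivial k (G × PUnit.{u + 1}) k).ρ (x, 1) c = c • (1 : k) :=
        (mul_one c).symm
      rw [h]
      simp))
    fun g ↦ LinearMap.congr_fun (f := recoverLinear M ∘ₗ (bimoduleTensorObj _ _).ρ (g, 1))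
      (g := M.ρ g ∘ₗ recoverLinear M) (recover_ext fun x m (c : k) ↦ by
        rw [LinearMap.comp_apply, rho_pure, rho_indSingle, LinearMap.comp_apply,
          recoverLinear_pure, recoverLinear_pure, map_smul]
        change c • _ = c • _
        rw [ ← Module.End.mul_apply, ← map_mul]
        simp)

variable (k G) in
/-- Induction followed by `M ↦ M ⊗_{kG} k` is isomorphic to the identity. -/
def recoverNatIso : indDiag k G ⋙ coinvariantsRight k G ≅ 𝟭 _ :=
  NatIso.ofComponents recoverIso fun {M N} f ↦ by
    refine rep_hom_ext (LinearMap.congr_fun (recover_ext fun x m (c : k) ↦ ?_))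
    change recoverLinear N (pure _ (Rep.trivial k (G × PUnit.{u + 1}) k)
      (((indDiag k G).map f).hom.toLinearMap (indSingle M x m)) c) =
      f.hom.toLinearMap (recoverLinear M (pure _ (Rep.trivial k (G × PUnit.{u + 1}) k)
        (indSingle M x m) c))
    rw [indDiag_map_single, recoverLinear_pure, recoverLinear_pure, map_smul]
    congr 1
    exact (Rep.hom_comm_apply f _ _).symm

end Recover

end Ind

/-! ### Duals of bimodules -/

section Dual

variable {k : Type u} [Field k] {G H K : Type u} [Group G] [Group H] [Group K]

/-- The evaluation map from a module to its double dual. -/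
def dualEval (M : Rep.{u} k G) :
    M ⟶ (dualFunctor k G).obj (Opposite.op ((dualFunctor k G).obj (Opposite.op M))) :=
  homMk (Module.Dual.eval k M.V) fun g x ↦ LinearMap.ext fun (f : Module.Dual k M.V) ↦ by
    change f (M.ρ g x) = f (M.ρ g⁻¹⁻¹ x)
    rw [inv_inv]

lemma isIso_of_bijective {M N : Rep.{u} k G} (f : M ⟶ N)
    (h : Function.Bijective f.hom.toLinearMap) : IsIso f :=
  ⟨(isoMk (LinearEquiv.ofBijective f.hom.toLinearMap h) fun g x ↦ Rep.hom_comm_apply f g x).inv,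
    (isoMk (LinearEquiv.ofBijective f.hom.toLinearMap h)
      fun g x ↦ Rep.hom_comm_apply f g x).hom_inv_id,
    (isoMk (LinearEquiv.ofBijective f.hom.toLinearMap h)
      fun g x ↦ Rep.hom_comm_apply f g x).inv_hom_id⟩

lemma isIso_dualEval (M : Rep.{u} k G) [Module.Finite k M.V] : IsIso (dualEval M) :=
  isIso_of_bijective _ (Module.bijective_dual_eval k M.V)

/-- The evaluation map from a bimodule to its double dual. -/
def bimoduleDualEval (M : Rep.{u} k (G × H)) :
    M ⟶ (bimoduleDual k H G).obj (Opposite.op ((bimoduleDual k G H).obj (Opposite.op M))) :=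
  homMk (Module.Dual.eval k M.V) fun g x ↦ LinearMap.ext fun (f : Module.Dual k M.V) ↦ by
    change f (M.ρ g x) = f (M.ρ g⁻¹⁻¹ x)
    rw [inv_inv]

lemma isIso_bimoduleDualEval (M : Rep.{u} k (G × H)) [Module.Finite k M.V] :
    IsIso (bimoduleDualEval M) :=
  isIso_of_bijective _ (Module.bijective_dual_eval k M.V)

/-! ### The dual of a tensor product of bimodules -/

section TensorDual

variable [Fintype H] (M : Rep.{u} k (G × H)) (N : Rep.{u} k (H × K))

/-- The linear form `m ⊗ n ↦ ∑ h, w (m h⁻¹ ⊗ h n)` on `M ⊗_{kH} N` for a linear form `w`. -/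
def traceForm : Module.Dual k (M.V ⊗[k] N.V) →ₗ[k] Module.Dual k (bimoduleTensorObj M N).V where
  toFun w := tensorLift (∑ h : H, ((TensorProduct.mk k M.V N.V).compr₂ w).compl₁₂
      (M.ρ (1, h)) (N.ρ (h, 1))) fun h m n ↦ by
    simp only [LinearMap.sum_apply, LinearMap.compl₁₂_apply, ← Module.End.mul_apply, ← map_mul]
    simp only [Prod.mk_mul_mk, mul_one]
    exact Fintype.sum_equiv (Equiv.mulRight h) _ _ fun x ↦ rfl
  map_add' w w' := tensor_ext fun m n ↦ by
    simp [tensorLift_pure, Finset.sum_add_distrib]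
  map_smul' c w := tensor_ext fun m n ↦ by
    simp [tensorLift_pure, Finset.mul_sum]

lemma traceForm_pure (w : Module.Dual k (M.V ⊗[k] N.V)) (m : M) (n : N) :
    traceForm M N w (pure M N m n) = ∑ h : H, w (M.ρ (1, h) m ⊗ₜ N.ρ (h, 1) n) := by
  change (∑ h : H, ((TensorProduct.mk k M.V N.V).compr₂ w).compl₁₂
      (M.ρ (1, h)) (N.ρ (h, 1))) m n = _
  simp [LinearMap.sum_apply]

/-- The linear map `N^* ⊗_{kH} M^* → (M ⊗_{kH} N)^*`. -/
def dualTensorLinear : (bimoduleTensorObj ((bimoduleDual k H K).obj (Opposite.op N))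
    ((bimoduleDual k G H).obj (Opposite.op M))).V →ₗ[k]
      Module.Dual k (bimoduleTensorObj M N).V :=
  tensorLift (M := (bimoduleDual k H K).obj (Opposite.op N))
    (N := (bimoduleDual k G H).obj (Opposite.op M))
    -- The form μ ⊗ ν on M ⊗_k N need not be constant on orbits of the middle action. Summing over H
    -- makes it descend to M ⊗_{kH} N.
    (((TensorProduct.mk k (Module.Dual k M.V) (Module.Dual k N.V)).compr₂
      (traceForm M N ∘ₗ TensorProduct.dualDistrib k M.V N.V)).flip)
    fun h (ν : Module.Dual k N.V) (μ : Module.Dual k M.V) ↦ by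
    refine tensor_ext fun m n ↦ ?_
    change traceForm M N _ (pure M N m n) = traceForm M N _ (pure M N m n)
    rw [traceForm_pure, traceForm_pure]
    refine Fintype.sum_equiv (Equiv.mulLeft h⁻¹) _ _ fun x ↦ ?_
    change μ (M.ρ (1⁻¹, h⁻¹) (M.ρ (1, x) m)) * ν (N.ρ (h⁻¹, 1⁻¹) (N.ρ (x, 1) n)) =
      μ (M.ρ (1, h⁻¹ * x) m) * ν (N.ρ (h⁻¹ * x, 1) n)
    simp only [← Module.End.mul_apply, ← map_mul]
    simp

lemma dualTensorLinear_pure (ν : Module.Dual k N.V) (μ : Module.Dual k M.V) :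
    dualTensorLinear M N (pure ((bimoduleDual k H K).obj (Opposite.op N))
      ((bimoduleDual k G H).obj (Opposite.op M)) ν μ) =
      traceForm M N (TensorProduct.dualDistrib k M.V N.V (μ ⊗ₜ ν)) := rfl

lemma dualTensorLinear_pure_pure (ν : Module.Dual k N.V) (μ : Module.Dual k M.V) (m : M) (n : N) :
    dualTensorLinear M N (pure ((bimoduleDual k H K).obj (Opposite.op N))
      ((bimoduleDual k G H).obj (Opposite.op M)) ν μ) (pure M N m n) =
      ∑ h : H, μ (M.ρ (1, h) m) * ν (N.ρ (h, 1) n) := by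
  rw [dualTensorLinear_pure, traceForm_pure]
  rfl

/-- The morphism `N^* ⊗_{kH} M^* → (M ⊗_{kH} N)^*`. -/
def dualTensorHom : bimoduleTensorObj ((bimoduleDual k H K).obj (Opposite.op N))
    ((bimoduleDual k G H).obj (Opposite.op M)) ⟶
      (bimoduleDual k G K).obj (Opposite.op (bimoduleTensorObj M N)) :=
  homMk (dualTensorLinear M N) fun g x ↦ by
    change dualTensorLinear M N _ =
      dualTensorLinear M N x ∘ₗ (bimoduleTensorObj M N).ρ (g.2⁻¹, g.1⁻¹)
    induction x using tensor_induction with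
    | add x y hx hy => rw [map_add, map_add, map_add, hx, hy, LinearMap.add_comp]
    | pure ν μ =>
      change Module.Dual k N.V at ν
      change Module.Dual k M.V at μ
      refine tensor_ext fun m n ↦ ?_
      rw [LinearMap.comp_apply, rho_pure]
      refine (dualTensorLinear_pure_pure M N (ν ∘ₗ N.ρ (1⁻¹, g.1⁻¹))
        (μ ∘ₗ M.ρ (g.2⁻¹, 1⁻¹)) m n).trans (Eq.trans (Finset.sum_congr rfl fun h _ ↦ ?_)
          (dualTensorLinear_pure_pure M N ν μ _ _).symm)
      change μ (M.ρ (g.2⁻¹, 1⁻¹) (M.ρ (1, h) m)) * ν (N.ρ (1⁻¹, g.1⁻¹) (N.ρ (h, 1) n)) =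
        μ (M.ρ (1, h) (M.ρ (g.2⁻¹, 1) m)) * ν (N.ρ (h, 1) (N.ρ (1, g.1⁻¹) n))
      simp only [← Module.End.mul_apply, ← map_mul]
      simp

variable {M N}

lemma dualTensorHom_naturality_left {M' : Rep.{u} k (G × H)} (f : M ⟶ M') :
    ((bimoduleTensor k K H G).obj ((bimoduleDual k H K).obj (Opposite.op N))).map
      ((bimoduleDual k G H).map f.op) ≫ dualTensorHom M N =
    dualTensorHom M' N ≫ (bimoduleDual k G K).map (((bimoduleTensor k G H K).map f).app N).op := by
  refine bimoduleTensor_hom_ext fun ν μ ↦ tensor_ext fun m n ↦ ?_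
  change Module.Dual k N.V at ν
  change Module.Dual k M'.V at μ
  refine (dualTensorLinear_pure_pure M N ν (μ ∘ₗ f.hom.toLinearMap) m n).trans
    (Eq.trans (Finset.sum_congr rfl fun h _ ↦ ?_)
    (dualTensorLinear_pure_pure M' N ν μ (f.hom.toLinearMap m) n).symm)
  congr 1
  exact congrArg μ (Rep.hom_comm_apply f _ _)

lemma dualTensorHom_naturality_right {N' : Rep.{u} k (H × K)} (f : N ⟶ N') :
    ((bimoduleTensor k K H G).map ((bimoduleDual k H K).map f.op)).app
      ((bimoduleDual k G H).obj (Opposite.op M)) ≫ dualTensorHom M N =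
    dualTensorHom M N' ≫ (bimoduleDual k G K).map (((bimoduleTensor k G H K).obj M).map f).op := by
  refine bimoduleTensor_hom_ext fun ν μ ↦ tensor_ext fun m n ↦ ?_
  change Module.Dual k N'.V at ν
  change Module.Dual k M.V at μ
  refine (dualTensorLinear_pure_pure M N (ν ∘ₗ f.hom.toLinearMap) μ m n).trans
    (Eq.trans (Finset.sum_congr rfl fun h _ ↦ ?_)
    (dualTensorLinear_pure_pure M N' ν μ m (f.hom.toLinearMap n)).symm)
  congr 1
  exact congrArg ν (Rep.hom_comm_apply f _ _)

variable (M N)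

/-- The linear map `(M ⊗_k N)^* → N^* ⊗_{kH} M^*` that sends `μ ⊗ ν` to `ν ⊗ μ`. -/
def dualTensorQuot [Module.Finite k M.V] [Module.Finite k N.V] :
    Module.Dual k (M.V ⊗[k] N.V) →ₗ[k]
      (bimoduleTensorObj ((bimoduleDual k H K).obj (Opposite.op N))
        ((bimoduleDual k G H).obj (Opposite.op M))).V :=
  TensorProduct.lift (pure ((bimoduleDual k H K).obj (Opposite.op N))
    ((bimoduleDual k G H).obj (Opposite.op M))).flip ∘ₗ
      (TensorProduct.dualDistribEquiv k M.V N.V).symm.toLinearMap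

variable [Module.Finite k M.V] [Module.Finite k N.V]

-- By finite dimensionality every form on M ⊗_k N is a sum of product forms.
omit [Fintype H] in
lemma dualDistrib_induction {P : Module.Dual k (M.V ⊗[k] N.V) → Prop}
    (tmul : ∀ μ ν, P (TensorProduct.dualDistrib k M.V N.V (μ ⊗ₜ ν)))
    (add : ∀ w w', P w → P w' → P (w + w')) (w : Module.Dual k (M.V ⊗[k] N.V)) : P w := by
  obtain ⟨t, rfl⟩ := (TensorProduct.dualDistribEquiv k M.V N.V).surjective w
  induction t with
  | zero => simpa using tmul 0 0
  | tmul μ ν => exact tmul μ ν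
  | add s t hs ht => rw [map_add]; exact add _ _ hs ht

omit [Fintype H] in
lemma dualTensorQuot_dualDistrib (μ : Module.Dual k M.V) (ν : Module.Dual k N.V) :
    dualTensorQuot M N (TensorProduct.dualDistrib k M.V N.V (μ ⊗ₜ ν)) =
      pure ((bimoduleDual k H K).obj (Opposite.op N))
        ((bimoduleDual k G H).obj (Opposite.op M)) ν μ := by
  have h : (TensorProduct.dualDistribEquiv k M.V N.V).symm
      (TensorProduct.dualDistrib k M.V N.V (μ ⊗ₜ ν)) = μ ⊗ₜ ν :=
    (TensorProduct.dualDistribEquiv k M.V N.V).symm_apply_apply _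
  exact congrArg (TensorProduct.lift (pure ((bimoduleDual k H K).obj (Opposite.op N))
    ((bimoduleDual k G H).obj (Opposite.op M))).flip) h

/-- The trace form factors through N^* ⊗_{kH} M^*. As `dualTensorQuot` is surjective, injectivity
and surjectivity of `dualTensorLinear` become statements about trace forms of arbitrary w. -/
lemma dualTensorLinear_quot (w : Module.Dual k (M.V ⊗[k] N.V)) :
    dualTensorLinear M N (dualTensorQuot M N w) = traceForm M N w := by
  induction w using dualDistrib_induction with
  | tmul μ ν => rw [dualTensorQuot_dualDistrib, dualTensorLinear_pure]
  | add w w' h h' => rw [map_add, map_add, map_add, h, h']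

omit [Fintype H] in
lemma dualTensorQuot_surjective : Function.Surjective (dualTensorQuot M N) := fun x ↦ by
  induction x using tensor_induction with
  | pure ν μ => exact ⟨_, dualTensorQuot_dualDistrib M N μ ν⟩
  | add x y hx hy =>
    obtain ⟨a, rfl⟩ := hx
    obtain ⟨b, rfl⟩ := hy
    exact ⟨a + b, map_add _ _ _⟩

-- Precomposing a product form with h acts on both factors, and this is the middle action of h⁻¹ on
-- ν ⊗ μ, which is trivial in the quotient.
omit [Fintype H] in
lemma dualTensorQuot_comp (h : H) (w : Module.Dual k (M.V ⊗[k] N.V)) :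
    dualTensorQuot M N (w ∘ₗ TensorProduct.map (M.ρ (1, h)) (N.ρ (h, 1))) =
      dualTensorQuot M N w := by
  induction w using dualDistrib_induction with
  | tmul μ ν =>
    have e : TensorProduct.dualDistrib k M.V N.V (μ ⊗ₜ ν) ∘ₗ
        TensorProduct.map (M.ρ (1, h)) (N.ρ (h, 1)) =
        TensorProduct.dualDistrib k M.V N.V ((μ ∘ₗ M.ρ (1, h)) ⊗ₜ (ν ∘ₗ N.ρ (h, 1))) :=
      TensorProduct.ext' fun m n ↦ rfl
    rw [e, dualTensorQuot_dualDistrib, dualTensorQuot_dualDistrib]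
    have := pure_middle (M := (bimoduleDual k H K).obj (Opposite.op N))
      (N := (bimoduleDual k G H).obj (Opposite.op M)) h⁻¹ ν μ
    rw [← this]
    congr 1
    · congr 1
      refine LinearMap.ext fun n ↦ ?_
      change _ = ν (N.ρ (h⁻¹⁻¹, 1⁻¹) n)
      simp
    · refine LinearMap.ext fun n ↦ ?_
      change _ = μ (M.ρ (1⁻¹, h⁻¹⁻¹) n)
      simp
  | add w w' e e' => rw [LinearMap.add_comp, map_add, map_add, e, e']

/-- If `N` is projective relative to the trivial subgroup of the left acting group `H`, then
`N^* ⊗_{kH} M^* → (M ⊗_{kH} N)^*` is an isomorphism. -/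
lemma isIso_dualTensorHom (θ : N.V →ₗ[k] N.V)
    (hθ : ∑ h : H, N.ρ (h, 1) ∘ₗ θ ∘ₗ N.ρ (h⁻¹, 1) = LinearMap.id) :
    IsIso (dualTensorHom M N) := by
  refine isIso_of_bijective _ ⟨(injective_iff_map_eq_zero (dualTensorLinear M N)).2 fun x hx ↦ ?_,
    fun w ↦ ?_⟩
  · obtain ⟨w, rfl⟩ := dualTensorQuot_surjective M N x
    rw [dualTensorLinear_quot] at hx
    -- Injectivity: the identity of N is written as ∑ h θ h⁻¹ in the second variable.
    have key : w = ∑ h : H, w ∘ₗ TensorProduct.map LinearMap.id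
        (N.ρ (h, 1) ∘ₗ θ ∘ₗ N.ρ (h⁻¹, 1)) := by
      refine TensorProduct.ext' fun m n ↦ ?_
      rw [LinearMap.sum_apply]
      simp only [LinearMap.comp_apply (f := w) , TensorProduct.map_tmul, LinearMap.id_apply]
      rw [← map_sum, ← TensorProduct.tmul_sum, ← LinearMap.sum_apply, hθ, LinearMap.id_apply]
    rw [key, map_sum]
    have key' : ∑ h : H, w ∘ₗ TensorProduct.map (M.ρ (1, h)) (N.ρ (h, 1) ∘ₗ θ) = 0 := by
      refine TensorProduct.ext' fun m n ↦ ?_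
      have := LinearMap.congr_fun hx (pure M N m (θ n))
      rw [traceForm_pure] at this
      rw [LinearMap.sum_apply]
      exact this
    -- By `dualTensorQuot_comp` each summand of `key` may be translated by its own h. This cancels
    -- h⁻¹ on the right of θ and turns the sum into that of `key'`, which is the vanishing trace
    -- form evaluated at (m, θ n).
    rw [← map_zero (dualTensorQuot M N), ← key', map_sum]
    refine Finset.sum_congr rfl fun h _ ↦ ?_
    rw [← dualTensorQuot_comp M N h]
    congr 1
    refine TensorProduct.ext' fun m n ↦ ?_
    change w (M.ρ (1, h) m ⊗ₜ N.ρ (h, 1) (θ (N.ρ (h⁻¹, 1) (N.ρ (h, 1) n)))) =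
      w (M.ρ (1, h) m ⊗ₜ N.ρ (h, 1) (θ n))
    rw [← Module.End.mul_apply (N.ρ (h⁻¹, 1)), ← map_mul]
    simp
  · change Module.Dual k (bimoduleTensorObj M N).V at w
    -- Surjectivity: the trace of (m, n) ↦ w(m ⊗ θ n) is ∑ w(m h⁻¹ ⊗ θ(h n)) = w(m ⊗ ∑ h⁻¹ θ(h n)) =
    -- w(m ⊗ n).
    let w' : Module.Dual k (M.V ⊗[k] N.V) :=
      TensorProduct.lift ((pure M N).compr₂ w) ∘ₗ TensorProduct.map LinearMap.id θ
    refine ⟨dualTensorQuot M N w', (dualTensorLinear_quot M N w').trans (tensor_ext fun m n ↦ ?_)⟩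
    rw [traceForm_pure]
    change ∑ h : H, w (pure M N (M.ρ (1, h) m) (θ (N.ρ (h, 1) n))) = w (pure M N m n)
    conv_rhs => rw [← LinearMap.id_apply (R := k) n, ← hθ]
    rw [LinearMap.sum_apply, map_sum, map_sum]
    refine Fintype.sum_equiv (Equiv.inv H) _ _ fun h ↦ ?_
    rw [← pure_middle h⁻¹, ← Module.End.mul_apply (M.ρ _), ← map_mul]
    simp

end TensorDual

/-! ### The dual of an induced module -/

section IndDual

attribute [local irreducible] indSingle indLift

variable (M : Rep.{u} k G)

/-- The element of `Ind (M^*)` given by the linear form `f` in the component `x`. -/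
def indDualSingle (x : G) : Module.Dual k M.V →ₗ[k]
    ((indDiag k G).obj ((dualFunctor k G).obj (Opposite.op M))).V :=
  indSingle ((dualFunctor k G).obj (Opposite.op M)) x

lemma rho_indDualSingle (g : G × G) (x : G) (f : Module.Dual k M.V) :
    ((indDiag k G).obj ((dualFunctor k G).obj (Opposite.op M))).ρ g (indDualSingle M x f) =
      indDualSingle M (g.1 * x * g.2⁻¹) (f ∘ₗ M.ρ g.2⁻¹) :=
  rho_indSingle ((dualFunctor k G).obj (Opposite.op M)) g x f

variable {M} in
lemma ind_dual_ext {W : Type*} [AddCommGroup W] [Module k W]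
    {f g : ((indDiag k G).obj ((dualFunctor k G).obj (Opposite.op M))).V →ₗ[k] W}
    (h : ∀ x m, f (indDualSingle M x m) = g (indDualSingle M x m)) : f = g :=
  ind_ext h

open Classical in
/-- `(f in x) ↦ ((m in y) ↦ f (y m) if y = x⁻¹ and 0 otherwise)`. -/
def indDualLinear : ((indDiag k G).obj ((dualFunctor k G).obj (Opposite.op M))).V →ₗ[k]
    Module.Dual k ((indDiag k G).obj M).V :=
  -- The bimodule dual exchanges left and right: (a, b) sends component x to a x b⁻¹, while (b, a)
  -- sends y to b y a⁻¹. The relation y = x⁻¹ is therefore preserved.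
  indLift fun x ↦ (indLift fun y ↦ if y = x⁻¹ then (Module.Dual.eval k M.V) ∘ₗ M.ρ y else 0).flip

open Classical in
lemma indDualLinear_single (x y : G) (f : Module.Dual k M.V) (m : M) :
    indDualLinear M (indDualSingle M x f) (indSingle M y m) =
      if y = x⁻¹ then f (M.ρ y m) else 0 := by
  refine (LinearMap.congr_fun (indLift_single (M := (dualFunctor k G).obj (Opposite.op M)) _ x f)
    (indSingle M y m)).trans ?_
  change indLift (fun y ↦ if y = x⁻¹ then (Module.Dual.eval k M.V) ∘ₗ M.ρ y else 0)
    (indSingle M y m) f = _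
  rw [indLift_single]
  split_ifs <;> rfl

lemma indDualLinear_rho (g : G × G)
    (ξ : ((indDiag k G).obj ((dualFunctor k G).obj (Opposite.op M))).V) :
    indDualLinear M (((indDiag k G).obj ((dualFunctor k G).obj (Opposite.op M))).ρ g ξ) =
      indDualLinear M ξ ∘ₗ ((indDiag k G).obj M).ρ (g.2⁻¹, g.1⁻¹) := by
  revert ξ
  refine LinearMap.congr_fun (f := indDualLinear M ∘ₗ
    ((indDiag k G).obj ((dualFunctor k G).obj (Opposite.op M))).ρ g)
    (g := (((indDiag k G).obj M).ρ (g.2⁻¹, g.1⁻¹)).dualMap ∘ₗ indDualLinear M)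
    (ind_dual_ext fun x f ↦ ind_ext fun y m ↦ ?_)
  classical
  rw [LinearMap.comp_apply, LinearMap.comp_apply, LinearMap.dualMap_apply, rho_indSingle,
    rho_indDualSingle, indDualLinear_single, indDualLinear_single]
  have h : y = (g.1 * x * g.2⁻¹)⁻¹ ↔ g.2⁻¹ * y * g.1⁻¹⁻¹ = x⁻¹ := by
    constructor
    · rintro rfl
      group
    · intro h
      rw [← inv_inj, inv_inv, ← inv_inv x, ← h]
      group
  simp only [h, LinearMap.comp_apply, ← Module.End.mul_apply, ← map_mul]
  simp

variable [Fintype G]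

/-- The inverse of `indDualLinear`. -/
def indDualLinearInv : Module.Dual k ((indDiag k G).obj M).V →ₗ[k]
    ((indDiag k G).obj ((dualFunctor k G).obj (Opposite.op M))).V :=
  ∑ x : G, indDualSingle M x ∘ₗ (indSingle M x⁻¹ ∘ₗ M.ρ x).dualMap

lemma indDualLinearInv_apply (ξ : Module.Dual k ((indDiag k G).obj M).V) :
    indDualLinearInv M ξ = ∑ x : G, indDualSingle M x (ξ ∘ₗ indSingle M x⁻¹ ∘ₗ M.ρ x) := by
  rw [indDualLinearInv, LinearMap.sum_apply]
  rfl

lemma indDualLinear_comp_inv : indDualLinear M ∘ₗ indDualLinearInv M = LinearMap.id := by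
  classical
  refine LinearMap.ext fun ξ ↦ ind_ext fun y m ↦ ?_
  rw [LinearMap.comp_apply, indDualLinearInv_apply, map_sum, LinearMap.sum_apply]
  simp only [indDualLinear_single]
  rw [Finset.sum_eq_single y⁻¹ (fun x _ hx ↦ if_neg fun h ↦ hx (by rw [h, inv_inv]))
    (fun h ↦ absurd (Finset.mem_univ _) h), if_pos (inv_inv y).symm]
  simp only [LinearMap.comp_apply, inv_inv, LinearMap.id_apply]
  rw [← Module.End.mul_apply, ← map_mul]
  simp

lemma indDualLinearInv_comp : indDualLinearInv M ∘ₗ indDualLinear M = LinearMap.id := by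
  classical
  refine ind_dual_ext fun x f ↦ ?_
  rw [LinearMap.comp_apply, indDualLinearInv_apply, LinearMap.id_apply]
  have h (z : G) : indDualLinear M (indDualSingle M x f) ∘ₗ indSingle M z⁻¹ ∘ₗ M.ρ z =
      if z = x then f else 0 := by
    refine LinearMap.ext fun m ↦ ?_
    rw [LinearMap.comp_apply, LinearMap.comp_apply, indDualLinear_single]
    by_cases h : z = x
    · subst h
      rw [if_pos rfl, if_pos rfl, ← Module.End.mul_apply, ← map_mul]
      simp
    · rw [if_neg fun h' ↦ h (inv_injective h'), if_neg h]
      rfl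
  simp only [h]
  rw [Finset.sum_eq_single x (fun z _ hz ↦ by rw [if_neg hz, map_zero])
    (fun h ↦ absurd (Finset.mem_univ _) h), if_pos rfl]

/-- The isomorphism `Ind (M^*) ≅ (Ind M)^*`. -/
def indDualIso : (indDiag k G).obj ((dualFunctor k G).obj (Opposite.op M)) ≅
    (bimoduleDual k G G).obj (Opposite.op ((indDiag k G).obj M)) :=
  isoMk (N := (bimoduleDual k G G).obj (Opposite.op ((indDiag k G).obj M)))
    (LinearEquiv.ofLinearMap (indDualLinear M) (indDualLinearInv M) (indDualLinear_comp_inv M)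
      (indDualLinearInv_comp M)) (indDualLinear_rho M)

variable {M} in
lemma indDualIso_naturality {N : Rep.{u} k G} (f : M ⟶ N) :
    (indDiag k G).map ((dualFunctor k G).map f.op) ≫ (indDualIso M).hom =
      (indDualIso N).hom ≫ (bimoduleDual k G G).map ((indDiag k G).map f).op := by
  classical
  refine rep_hom_ext (LinearMap.congr_fun (ind_dual_ext fun x ν ↦ ind_ext fun y m ↦ ?_))
  have h₁ : ((indDiag k G).map ((dualFunctor k G).map f.op)).hom.toLinearMap
      (indDualSingle N x ν) = indDualSingle M x (ν ∘ₗ f.hom.toLinearMap) :=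
    indDiag_map_single ((dualFunctor k G).map f.op) x ν
  change indDualLinear M (((indDiag k G).map ((dualFunctor k G).map f.op)).hom.toLinearMap
    (indDualSingle N x ν)) (indSingle M y m) =
      indDualLinear N (indDualSingle N x ν)
        (((indDiag k G).map f).hom.toLinearMap (indSingle M y m))
  rw [h₁, indDiag_map_single, indDualLinear_single, indDualLinear_single]
  congr 1
  exact congrArg ν (Rep.hom_comm_apply f _ _)

end IndDual

end Dual

/-! ### Indecomposable modules and direct summands -/

section Indecomposable

variable {k : Type u} [Field k] {G : Type u} [Group G]

lemma rep_isZero_iff (M : Rep.{u} k G) : IsZero M ↔ ∀ x : M, x = 0 := by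
  rw [IsZero.iff_id_eq_zero]
  constructor
  · intro h x
    have := congrArg (fun f : M ⟶ M ↦ f.hom.toLinearMap x) h
    exact this
  · intro h
    exact rep_hom_ext fun x ↦ h _

lemma comp_apply' {M N L : Rep.{u} k G} (f : M ⟶ N) (g : N ⟶ L) (x : M) :
    (f ≫ g).hom.toLinearMap x = g.hom.toLinearMap (f.hom.toLinearMap x) := rfl

lemma add_apply' {M N : Rep.{u} k G} (f g : M ⟶ N) (x : M) :
    (f + g).hom.toLinearMap x = f.hom.toLinearMap x + g.hom.toLinearMap x := rfl

lemma id_apply' {M : Rep.{u} k G} (x : M) : (𝟙 M : M ⟶ M).hom.toLinearMap x = x := rfl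

lemma hom_rho {M N : Rep.{u} k G} (f : M ⟶ N) (g : G) (x : M) :
    f.hom.toLinearMap (M.ρ g x) = N.ρ g (f.hom.toLinearMap x) :=
  Rep.hom_comm_apply f g x

lemma sum_apply' {M N : Rep.{u} k G} {I : Type*} (s : Finset I) (f : I → (M ⟶ N)) (x : M) :
    (∑ i ∈ s, f i).hom.toLinearMap x = ∑ i ∈ s, (f i).hom.toLinearMap x := by
  classical
  induction s using Finset.induction_on with
  | empty => rfl
  | insert i s hi ih => rw [Finset.sum_insert hi, Finset.sum_insert hi, add_apply', ih]

/-- The underlying vector space of a biproduct. -/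
def biprodEquiv {M Y Z : Rep.{u} k G} (e : M ≅ Y ⊞ Z) : M.V ≃ₗ[k] Y.V × Z.V :=
  LinearEquiv.ofLinearMap
    ((e.hom ≫ biprod.fst).hom.toLinearMap.prod (e.hom ≫ biprod.snd).hom.toLinearMap)
    ((biprod.inl ≫ e.inv).hom.toLinearMap.coprod (biprod.inr ≫ e.inv).hom.toLinearMap)
    (LinearMap.ext fun x ↦ by
      change ((e.hom ≫ biprod.fst).hom.toLinearMap ((biprod.inl ≫ e.inv).hom.toLinearMap x.1 +
        (biprod.inr ≫ e.inv).hom.toLinearMap x.2), (e.hom ≫ biprod.snd).hom.toLinearMap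
        ((biprod.inl ≫ e.inv).hom.toLinearMap x.1 +
        (biprod.inr ≫ e.inv).hom.toLinearMap x.2)) = x
      rw [map_add, map_add]
      simp only [← comp_apply', Category.assoc, Iso.inv_hom_id_assoc, biprod.inl_fst,
        biprod.inl_snd, biprod.inr_fst, biprod.inr_snd]
      exact Prod.ext (add_zero x.1) (zero_add x.2))
    (LinearMap.ext fun x ↦ by
      change (biprod.inl ≫ e.inv).hom.toLinearMap ((e.hom ≫ biprod.fst).hom.toLinearMap x) +
        (biprod.inr ≫ e.inv).hom.toLinearMap ((e.hom ≫ biprod.snd).hom.toLinearMap x) = x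
      rw [← comp_apply', ← comp_apply', ← add_apply']
      have : (e.hom ≫ biprod.fst) ≫ biprod.inl ≫ e.inv +
          (e.hom ≫ biprod.snd) ≫ biprod.inr ≫ e.inv = 𝟙 M := by
        rw [← cancel_epi e.inv, ← cancel_mono e.hom]
        simp
      rw [this, id_apply'])

lemma biprodEquiv_rho {M Y Z : Rep.{u} k G} (e : M ≅ Y ⊞ Z) (g : G) (x : M) :
    biprodEquiv e (M.ρ g x) = (Y.ρ g (biprodEquiv e x).1, Z.ρ g (biprodEquiv e x).2) :=
  Prod.ext (hom_rho (e.hom ≫ biprod.fst) g x) (hom_rho (e.hom ≫ biprod.snd) g x)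

lemma nonempty_iso_biprod {M Y Z : Rep.{u} k G} (i : Y ⟶ M) (j : Z ⟶ M)
    (h : Function.Bijective (i.hom.toLinearMap.coprod j.hom.toLinearMap)) :
    Nonempty (M ≅ Y ⊞ Z) := by
  have h' : Function.Bijective (biprod.desc i j).hom.toLinearMap := by
    convert h.comp (biprodEquiv (Iso.refl (Y ⊞ Z))).bijective using 1
    refine funext fun x ↦ ?_
    change _ = i.hom.toLinearMap ((𝟙 _ ≫ biprod.fst : Y ⊞ Z ⟶ Y).hom.toLinearMap x) +
      j.hom.toLinearMap ((𝟙 _ ≫ biprod.snd : Y ⊞ Z ⟶ Z).hom.toLinearMap x)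
    rw [← comp_apply', ← comp_apply', ← add_apply', biprod.desc_eq, Category.id_comp,
      Category.id_comp]
  have := isIso_of_bijective _ h'
  exact ⟨(asIso (biprod.desc i j)).symm⟩

lemma nonempty_iso_biprod_of_isCompl (M : Rep.{u} k G) {W W' : Submodule k M.V}
    (hW : ∀ g, W ≤ W.comap (M.ρ g)) (hW' : ∀ g, W' ≤ W'.comap (M.ρ g)) (h : IsCompl W W') :
    Nonempty (M ≅ Rep.subrepresentation M W hW ⊞ Rep.subrepresentation M W' hW') :=
  nonempty_iso_biprod (Rep.subtype M W hW) (Rep.subtype M W' hW')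
    (Submodule.prodEquivOfIsCompl W W' h).bijective

lemma finite_of_retract {M N : Rep.{u} k G} (r : Retract M N) [Module.Finite k N.V] :
    Module.Finite k M.V :=
  Module.Finite.of_surjective r.r.hom.toLinearMap fun x ↦ ⟨r.i.hom.toLinearMap x, by
    rw [← comp_apply', r.retract, id_apply']⟩

/-- The retract of a module given by a direct summand. -/
def retractLeft {M Y Z : Rep.{u} k G} (e : M ≅ Y ⊞ Z) : Retract Y M where
  i := biprod.inl ≫ e.inv
  r := e.hom ≫ biprod.fst

/-- The retract of a module given by a direct summand. -/
def retractRight {M Y Z : Rep.{u} k G} (e : M ≅ Y ⊞ Z) : Retract Z M where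
  i := biprod.inr ≫ e.inv
  r := e.hom ≫ biprod.snd

/-- A property that is closed under direct sums holds for `M` if it holds for all indecomposable
direct summands of `M`. -/
lemma indecomposable_induction {Q : Rep.{u} k G → Prop} (zero : ∀ M, IsZero M → Q M)
    (sum : ∀ M Y Z, (M ≅ Y ⊞ Z) → Q Y → Q Z → Q M) (M : Rep.{u} k G) [hfin : Module.Finite k M.V]
    (ind : ∀ U, Indecomposable U → Nonempty (Retract U M) → Q U) : Q M := by
  induction h : Module.finrank k M.V using Nat.strong_induction_on generalizing M with
  | _ n ih =>
    by_cases hz : IsZero M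
    · exact zero M hz
    by_cases hM : Indecomposable M
    · exact ind M hM ⟨Retract.refl M⟩
    simp only [Indecomposable, not_and, not_forall, not_or] at hM
    obtain ⟨Y, Z, e, hY, hZ⟩ := hM hz
    have hYf := finite_of_retract (retractLeft e)
    have hZf := finite_of_retract (retractRight e)
    have hd : Module.finrank k M.V = Module.finrank k Y.V + Module.finrank k Z.V := by
      rw [(biprodEquiv e).finrank_eq, Module.finrank_prod]
    have pos (X : Rep.{u} k G) [Module.Finite k X.V] (hX : ¬IsZero X) :
        0 < Module.finrank k X.V := by
      rw [rep_isZero_iff, not_forall] at hX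
      obtain ⟨x, hx⟩ := hX
      have : Nontrivial X.V := ⟨x, 0, hx⟩
      exact Module.finrank_pos
    have hY0 := pos Y hY
    have hZ0 := pos Z hZ
    exact sum M Y Z e
      (ih _ (by omega) Y (fun U hU ⟨r⟩ ↦ ind U hU ⟨r.trans (retractLeft e)⟩) rfl)
      (ih _ (by omega) Z (fun U hU ⟨r⟩ ↦ ind U hU ⟨r.trans (retractRight e)⟩) rfl)

variable {U : Rep.{u} k G} [Module.Finite k U.V]

/-- Fitting's lemma. -/
lemma isNilpotent_or_isUnit (hU : Indecomposable U) (a : U ⟶ U) :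
    IsNilpotent (a.hom.toLinearMap : Module.End k U.V) ∨
      IsUnit (a.hom.toLinearMap : Module.End k U.V) := by
  set f : Module.End k U.V := a.hom.toLinearMap with hf
  -- A positive exponent is chosen so that invertibility of fⁿ implies that of f.
  obtain ⟨n, hn, hn0⟩ := (f.eventually_isCompl_ker_pow_range_pow.and
    (Filter.eventually_gt_atTop 0)).exists
  have hcomm (g : G) : Commute (U.ρ g) (f ^ n) := by
    refine Commute.pow_right (LinearMap.ext fun x ↦ ?_) n
    exact (hom_rho a g x).symm
  have hc (g : G) (x : U) : (f ^ n) (U.ρ g x) = U.ρ g ((f ^ n) x) :=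
    (LinearMap.congr_fun (hcomm g) x).symm
  obtain ⟨e⟩ := nonempty_iso_biprod_of_isCompl U (W := LinearMap.ker (f ^ n))
    (W' := LinearMap.range (f ^ n))
    (fun g x hx ↦ by
      rw [LinearMap.mem_ker] at hx
      rw [Submodule.mem_comap, LinearMap.mem_ker, hc, hx, map_zero])
    (fun g ↦ by
      rintro _ ⟨x, rfl⟩
      exact ⟨U.ρ g x, hc g x⟩) hn
  rcases hU.2 _ _ e with h | h
  · right
    rw [rep_isZero_iff] at h
    have hinj : Function.Injective (f ^ n) := by
      rw [← LinearMap.ker_eq_bot, Submodule.eq_bot_iff]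
      intro x hx
      exact congrArg Subtype.val (h ⟨x, hx⟩)
    have hu : IsUnit (f ^ n) := (Module.End.isUnit_iff _).2
      ⟨hinj, LinearMap.injective_iff_surjective.1 hinj⟩
    exact (isUnit_pow_iff hn0.ne').1 hu
  · left
    rw [rep_isZero_iff] at h
    exact ⟨n, LinearMap.ext fun x ↦ congrArg Subtype.val (h ⟨(f ^ n) x, x, rfl⟩)⟩

omit [Module.Finite k U.V] in
lemma isIso_of_isUnit (a : U ⟶ U) (h : IsUnit (a.hom.toLinearMap : Module.End k U.V)) :
    IsIso a :=
  isIso_of_bijective a ((Module.End.isUnit_iff _).1 h)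

/-- Endomorphism rings of indecomposable modules are local. After normalizing the sum to the
identity, Fitting's lemma makes the first summand invertible or nilpotent, and 1 minus a nilpotent
is invertible. -/
lemma isIso_or_isIso_of_add (hU : Indecomposable U) (a b : U ⟶ U) [IsIso (a + b)] :
    IsIso a ∨ IsIso b := by
  have h : inv (a + b) ≫ a + inv (a + b) ≫ b = 𝟙 U := by
    rw [← Preadditive.comp_add, IsIso.inv_hom_id]
  rcases isNilpotent_or_isUnit hU (inv (a + b) ≫ a) with h' | h'
  · right
    have hu := h'.isUnit_one_sub
    have he : (1 : Module.End k U.V) - (inv (a + b) ≫ a).hom.toLinearMap =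
        (inv (a + b) ≫ b).hom.toLinearMap := by
      rw [sub_eq_iff_eq_add']
      refine LinearMap.ext fun x ↦ ?_
      have := congrArg (fun f : U ⟶ U ↦ f.hom.toLinearMap x) h
      exact this.symm
    have : IsIso (inv (a + b) ≫ b) := isIso_of_isUnit _ (he ▸ hu)
    exact IsIso.of_isIso_comp_left (inv (a + b)) b
  · left
    have : IsIso (inv (a + b) ≫ a) := isIso_of_isUnit _ h'
    exact IsIso.of_isIso_comp_left (inv (a + b)) a

lemma exists_isIso_of_sum (hU : Indecomposable U) {I : Type*} (s : Finset I) (x : I → (U ⟶ U))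
    (h : IsIso (∑ i ∈ s, x i)) : ∃ i ∈ s, IsIso (x i) := by
  classical
  induction s using Finset.induction_on with
  | empty =>
    refine absurd ((IsZero.iff_id_eq_zero U).2 ?_) hU.1
    rw [Finset.sum_empty] at h
    rw [← IsIso.hom_inv_id (0 : U ⟶ U), zero_comp]
  | insert i s hi ih =>
    rw [Finset.sum_insert hi] at h
    rcases isIso_or_isIso_of_add hU (x i) (∑ i ∈ s, x i) with h' | h'
    · exact ⟨i, Finset.mem_insert_self i s, h'⟩
    · obtain ⟨j, hj, hx⟩ := ih h'
      exact ⟨j, Finset.mem_insert_of_mem hj, hx⟩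

/-- By locality some composite f i ≫ g i is invertible, and its inverse corrects g i to a
retraction. This takes the place of the Krull–Schmidt theorem. -/
lemma exists_retract_of_sum (hU : Indecomposable U) {I : Type*} (s : Finset I)
    (A : I → Rep.{u} k G) (f : ∀ i, U ⟶ A i) (g : ∀ i, A i ⟶ U) (h : ∑ i ∈ s, f i ≫ g i = 𝟙 U) :
    ∃ i ∈ s, Nonempty (Retract U (A i)) := by
  obtain ⟨i, hi, hx⟩ := exists_isIso_of_sum hU s (fun i ↦ f i ≫ g i) (by rw [h]; infer_instance)
  exact ⟨i, hi, ⟨⟨f i, g i ≫ inv (f i ≫ g i), by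
    rw [← Category.assoc, IsIso.hom_inv_id]⟩⟩⟩

end Indecomposable

/-! ### Direct summands of permutation modules -/

section PermRetract

variable {k : Type u} [Field k] {G : Type u} [Group G]

/-- The basis `b` is permuted by `G`. -/
def IsPermBasis (N : Rep.{u} k G) {ι : Type*} (b : Module.Basis ι k N.V) : Prop :=
  ∀ g i, ∃ j, N.ρ g (b i) = b j

/-- No element of the basis `b` is fixed by a nontrivial element of `S`. -/
def IsFreeBasis (S : Set G) (N : Rep.{u} k G) {ι : Type*} (b : Module.Basis ι k N.V) : Prop :=
  ∀ s ∈ S, ∀ i, N.ρ s (b i) = b i → s = 1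

/-- `M` is a direct summand of a finitely generated permutation module on which nontrivial
elements of `S` act without fixed points on the permuted basis. -/
def IsPermRetract (S : Set G) (M : Rep.{u} k G) : Prop :=
  ∃ (N : Rep.{u} k G) (ι : Type u) (_ : Finite ι) (b : Module.Basis ι k N.V),
    IsPermBasis N b ∧ IsFreeBasis S N b ∧ Nonempty (Retract M N)

/-- The action of `G` on the index set of a permuted basis. -/
abbrev IsPermBasis.mulAction {N : Rep.{u} k G} {ι : Type*} {b : Module.Basis ι k N.V}
    (hb : IsPermBasis N b) : MulAction G ι where
  smul g i := (hb g i).choose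
  one_smul i := b.injective (by
    refine (hb 1 i).choose_spec.symm.trans ?_
    rw [map_one, Module.End.one_apply])
  mul_smul g h i := b.injective (by
    refine (hb (g * h) i).choose_spec.symm.trans (Eq.trans ?_
      (hb g (hb h i).choose).choose_spec)
    rw [← (hb h i).choose_spec, map_mul, Module.End.mul_apply])

lemma IsPermBasis.rho {N : Rep.{u} k G} {ι : Type*} {b : Module.Basis ι k N.V}
    (hb : IsPermBasis N b) (g : G) (i : ι) :
    letI := hb.mulAction
    N.ρ g (b i) = b (g • i) :=
  (hb g i).choose_spec

variable {S : Set G}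

lemma IsPermRetract.of_retract {M N : Rep.{u} k G} (h : IsPermRetract S N) (r : Retract M N) :
    IsPermRetract S M := by
  obtain ⟨N', ι, hι, b, hb, hS, ⟨r'⟩⟩ := h
  exact ⟨N', ι, hι, b, hb, hS, ⟨r.trans r'⟩⟩

lemma IsPermRetract.of_basis {N : Rep.{u} k G} {ι : Type u} [Finite ι] {b : Module.Basis ι k N.V}
    (hb : IsPermBasis N b) (hS : IsFreeBasis S N b) : IsPermRetract S N :=
  ⟨N, ι, inferInstance, b, hb, hS, ⟨Retract.refl N⟩⟩

lemma IsPermRetract.finite {M : Rep.{u} k G} (h : IsPermRetract S M) : Module.Finite k M.V := by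
  obtain ⟨N, ι, hι, b, -, -, ⟨r⟩⟩ := h
  have := Module.Finite.of_basis b
  exact finite_of_retract r

lemma IsPermRetract.mono {S' : Set G} {M : Rep.{u} k G} (h : IsPermRetract S M) (hS : S' ⊆ S) :
    IsPermRetract S' M := by
  obtain ⟨N, ι, hι, b, hb, hb', r⟩ := h
  exact ⟨N, ι, hι, b, hb, fun s hs ↦ hb' s (hS hs), r⟩

lemma IsPermRetract.of_isZero {M : Rep.{u} k G} (h : IsZero M) : IsPermRetract S M := by
  have : Subsingleton M.V := ⟨fun x y ↦ by
    rw [(rep_isZero_iff M).1 h x, (rep_isZero_iff M).1 h y]⟩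
  exact .of_basis (ι := PEmpty) (b := Module.Basis.empty M.V) (fun _ i ↦ i.elim)
    fun _ _ i ↦ i.elim

lemma IsPermRetract.biprod {Y Z : Rep.{u} k G} (hY : IsPermRetract S Y)
    (hZ : IsPermRetract S Z) : IsPermRetract S (Y ⊞ Z) := by
  obtain ⟨N, ι, hι, b, hb, hS, ⟨r⟩⟩ := hY
  obtain ⟨N', ι', hι', b', hb', hS', ⟨r'⟩⟩ := hZ
  refine IsPermRetract.of_retract (N := N ⊞ N') ?_
    ⟨biprod.map r.i r'.i, biprod.map r.r r'.r, biprod.hom_ext _ _ (by simp) (by simp)⟩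
  have h (g : G) (x : N.V × N'.V) : (N ⊞ N').ρ g ((biprodEquiv (Iso.refl (N ⊞ N'))).symm x) =
      (biprodEquiv (Iso.refl (N ⊞ N'))).symm (N.ρ g x.1, N'.ρ g x.2) := by
    rw [LinearEquiv.eq_symm_apply, biprodEquiv_rho, LinearEquiv.apply_symm_apply]
  refine .of_basis (ι := ι ⊕ ι') (b := (b.prod b').map (biprodEquiv (Iso.refl _)).symm) ?_ ?_
  · rintro g (i | i)
    · obtain ⟨j, hj⟩ := hb g i
      exact ⟨Sum.inl j, by simp [h, hj]⟩
    · obtain ⟨j, hj⟩ := hb' g i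
      exact ⟨Sum.inr j, by simp [h, hj]⟩
  · rintro s hs (i | i) hi
    · refine hS s hs i ?_
      simpa [h] using hi
    · refine hS' s hs i ?_
      simpa [h] using hi

/-- Stated for a resolution of the identity because `sum_totπ_totι` presents the terms of a total
complex in this form. -/
lemma IsPermRetract.of_sum {Z : Rep.{u} k G} {I : Type*} (s : Finset I) (A : I → Rep.{u} k G)
    (hA : ∀ i, IsPermRetract S (A i)) (f : ∀ i, Z ⟶ A i) (g : ∀ i, A i ⟶ Z)
    (h : ∑ i ∈ s, f i ≫ g i = 𝟙 Z) : IsPermRetract S Z := by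
  classical
  have key : ∃ (B : Rep.{u} k G) (f' : Z ⟶ B) (g' : B ⟶ Z), IsPermRetract S B ∧
      f' ≫ g' = ∑ i ∈ s, f i ≫ g i := by
    clear h
    induction s using Finset.induction_on with
    | empty =>
      obtain ⟨B, hB⟩ := HasZeroObject.zero (C := Rep.{u} k G)
      exact ⟨B, 0, 0, .of_isZero hB, by simp⟩
    | insert i s hi ih =>
      obtain ⟨B, f', g', hB, hfg⟩ := ih
      refine ⟨A i ⊞ B, biprod.lift (f i) f', biprod.desc (g i) g', (hA i).biprod hB, ?_⟩
      rw [biprod.lift_desc, hfg, Finset.sum_insert hi]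
  obtain ⟨B, f', g', hB, hfg⟩ := key
  exact hB.of_retract ⟨f', g', hfg.trans h⟩

lemma IsPermRetract.res {H : Type u} [Group H] (φ : H →* G) {T : Set H}
    (hT : ∀ t ∈ T, φ t ∈ S) (hφ : ∀ t, φ t = 1 → t = 1) {M : Rep.{u} k G}
    (h : IsPermRetract S M) : IsPermRetract T ((Rep.resFunctor φ).obj M) := by
  obtain ⟨N, ι, hι, b, hb, hS, ⟨r⟩⟩ := h
  refine IsPermRetract.of_retract (N := (Rep.resFunctor φ).obj N) ?_ (r.map (Rep.resFunctor φ))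
  exact .of_basis (b := b) (fun h i ↦ hb (φ h) i) fun t ht i hi ↦ hφ t (hS (φ t) (hT t ht) i hi)

open MonoidalCategory in
lemma IsPermRetract.tensor {M N : Rep.{u} k G} (hM : IsPermRetract ∅ M)
    (hN : IsPermRetract ∅ N) : IsPermRetract ∅ (M ⊗ N) := by
  obtain ⟨M', ι, hι, b, hb, -, ⟨r⟩⟩ := hM
  obtain ⟨N', ι', hι', b', hb', -, ⟨r'⟩⟩ := hN
  refine IsPermRetract.of_retract (N := M' ⊗ N') ?_ ⟨r.i ⊗ₘ r'.i, r.r ⊗ₘ r'.r, by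
    rw [MonoidalCategory.tensorHom_comp_tensorHom, r.retract, r'.retract,
      MonoidalCategory.id_tensorHom_id]⟩
  refine .of_basis (b := b.tensorProduct b') (fun g i ↦ ?_) fun s hs ↦ hs.elim
  obtain ⟨j, hj⟩ := hb g i.1
  obtain ⟨j', hj'⟩ := hb' g i.2
  refine ⟨(j, j'), ?_⟩
  rw [Module.Basis.tensorProduct_apply', Module.Basis.tensorProduct_apply, rho_tmul, hj, hj']

lemma IsPermRetract.dual {M : Rep.{u} k G} (h : IsPermRetract S M) :
    IsPermRetract S ((dualFunctor k G).obj (Opposite.op M)) := by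
  classical
  obtain ⟨N, ι, hι, b, hb, hS, ⟨r⟩⟩ := h
  refine IsPermRetract.of_retract (N := (dualFunctor k G).obj (Opposite.op N)) ?_
    (r.op.map (dualFunctor k G))
  let := hb.mulAction
  -- The dual basis is permuted by the same action on the index set, so its fixed points are also
  -- the same.
  have key (g : G) (i : ι) : b.dualBasis i ∘ₗ N.ρ g⁻¹ = b.dualBasis (g • i) := by
    refine b.ext fun j ↦ ?_
    rw [LinearMap.comp_apply, hb.rho, Module.Basis.dualBasis_apply_self,
      Module.Basis.dualBasis_apply_self]
    simp only [inv_smul_eq_iff]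
  refine .of_basis (N := (dualFunctor k G).obj (Opposite.op N)) (b := b.dualBasis)
    (fun g i ↦ ⟨g • i, key g i⟩) fun s hs i hi ↦ hS s hs i ?_
  rw [hb.rho]
  exact congrArg b (b.dualBasis.injective ((key s i).symm.trans hi))

variable (G) in
/-- The set of elements `(g, 1)` and `(1, g)` of `G × G`. -/
def axes : Set (G × G) := {x | x.1 = 1 ∨ x.2 = 1}

lemma IsPermRetract.bimoduleDual {M : Rep.{u} k (G × G)} (h : IsPermRetract (axes G) M) :
    IsPermRetract (axes G) ((bimoduleDual k G G).obj (Opposite.op M)) :=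
  h.dual.res (MulEquiv.prodComm : G × G ≃* G × G).toMonoidHom (fun _ ht ↦ ht.symm)
    fun _ ht ↦ (MulEquiv.prodComm : G × G ≃* G × G).injective (ht.trans (map_one _).symm)

/-- A basis of Ind N is indexed by pairs of a component x in G and a basis element of N. Already on
components, (a, 1) and (1, b) act by x ↦ a x and x ↦ x b⁻¹, which is free. Hence no freeness is
asked of M. -/
lemma IsPermRetract.ind [Finite G] {M : Rep.{u} k G} (h : IsPermRetract ∅ M) :
    IsPermRetract (axes G) ((indDiag k G).obj M) := by
  obtain ⟨N, ι, hι, b, hb, -, ⟨r⟩⟩ := h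
  refine IsPermRetract.of_retract (N := (indDiag k G).obj N) ?_ (r.map _)
  let := hb.mulAction
  let c : Module.Basis (Σ _ : G, ι) k ((indDiag k G).obj N).V :=
    (Finsupp.basis fun _ : G ↦ b).map (indDiagEquiv N).symm
  have hc (x : G) (i : ι) : c ⟨x, i⟩ = indSingle N x (b i) := by
    simp [c, indSingle]
  have key (g : G × G) (x : G) (i : ι) : ((indDiag k G).obj N).ρ g (c ⟨x, i⟩) =
      c ⟨g.1 * x * g.2⁻¹, g.2 • i⟩ := by
    rw [hc, hc, rho_indSingle, hb.rho]
  refine .of_basis (b := c) (fun g i ↦ ⟨_, key g i.1 i.2⟩) fun s hs i hi ↦ ?_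
  have h := (c.injective ((key s i.1 i.2).symm.trans hi))
  have h' : s.1 * i.1 * s.2⁻¹ = i.1 := congrArg Sigma.fst h
  rcases hs with hs | hs
  · rw [hs, one_mul, mul_eq_left, inv_eq_one] at h'
    exact Prod.ext hs h'
  · rw [hs, inv_one, mul_one, mul_eq_right] at h'
    exact Prod.ext h' hs

end PermRetract

/-! ### Tensoring with a permutation module -/

section PermTensor

variable {k : Type u} [Field k] {G : Type u} [Group G] (X : Type u) [MulAction G X]

/-- The representation of `G` on `k[X] ⊗ V`, realized on finitely supported functions from
the `G`-set `X` to `V`. -/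
def permTensorRep (V : Rep.{u} k G) : Representation k G (X →₀ V.V) where
  toFun g := Finsupp.lsum k fun x : X ↦ Finsupp.lsingle (g • x) ∘ₗ V.ρ g
  map_one' := by ext; simp
  map_mul' g h := by ext; simp [mul_smul]

lemma permTensorRep_single (V : Rep.{u} k G) (g : G) (x : X) (v : V) :
    permTensorRep X V g (Finsupp.single x v) = Finsupp.single (g • x) (V.ρ g v) := by
  simp [permTensorRep]

/-- The functor `V ↦ k[X] ⊗ V`. -/
def permTensor : Rep.{u} k G ⥤ Rep.{u} k G where
  obj V := Rep.of (permTensorRep X V)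
  map {V W} f := homMk (M := Rep.of (permTensorRep X V)) (N := Rep.of (permTensorRep X W))
    (Finsupp.mapRange.linearMap f.hom.toLinearMap) fun g x ↦ by
      change Finsupp.mapRange.linearMap f.hom.toLinearMap (permTensorRep X V g x) =
        permTensorRep X W g (Finsupp.mapRange.linearMap f.hom.toLinearMap x)
      induction x using Finsupp.induction_linear with
      | zero => simp
      | add x y hx hy => simp only [map_add, hx, hy]
      | single x v =>
        rw [permTensorRep_single]
        simp only [Finsupp.mapRange.linearMap_apply, Finsupp.mapRange_single]
        rw [permTensorRep_single, hom_rho]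
  map_id V := rep_hom_ext fun x ↦ Finsupp.mapRange_id x
  map_comp f g := rep_hom_ext fun x ↦ LinearMap.congr_fun
    (Finsupp.mapRange.linearMap_comp g.hom.toLinearMap f.hom.toLinearMap) x

/-- The element `x ⊗ v` of `k[X] ⊗ V`. -/
def permSingle (V : Rep.{u} k G) (x : X) : V.V →ₗ[k] ((permTensor X).obj V).V :=
  Finsupp.lsingle x

variable {X}

lemma rho_permSingle (V : Rep.{u} k G) (g : G) (x : X) (v : V) :
    ((permTensor X).obj V).ρ g (permSingle X V x v) = permSingle X V (g • x) (V.ρ g v) :=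
  permTensorRep_single X V g x v

lemma permTensor_map_single {V W : Rep.{u} k G} (f : V ⟶ W) (x : X) (v : V) :
    ((permTensor X).map f).hom.toLinearMap (permSingle X V x v) =
      permSingle X W x (f.hom.toLinearMap v) :=
  Finsupp.mapRange_single (hf := map_zero _)

lemma permTensor_ext {V : Rep.{u} k G} {W : Type*} [AddCommGroup W] [Module k W]
    {f g : ((permTensor X).obj V).V →ₗ[k] W}
    (h : ∀ x v, f (permSingle X V x v) = g (permSingle X V x v)) : f = g :=
  Finsupp.lhom_ext h

/-- Linear maps out of `k[X] ⊗ V`. -/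
def permLift {V : Rep.{u} k G} {W : Type*} [AddCommGroup W] [Module k W] (f : X → V.V →ₗ[k] W) :
    ((permTensor X).obj V).V →ₗ[k] W :=
  Finsupp.lsum k f

lemma permLift_single {V : Rep.{u} k G} {W : Type*} [AddCommGroup W] [Module k W]
    (f : X → V.V →ₗ[k] W) (x : X) (v : V) : permLift f (permSingle X V x v) = f x v :=
  Finsupp.lsum_single _ _ _ _

variable (X) in
/-- The map `k[X] ⊗ V → V`, `x ⊗ v ↦ v`. -/
def permCounit (V : Rep.{u} k G) : (permTensor X).obj V ⟶ V :=
  homMk (permLift fun _ ↦ LinearMap.id) fun g ↦ LinearMap.congr_fun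
    (f := permLift (fun _ ↦ LinearMap.id) ∘ₗ ((permTensor X).obj V).ρ g)
    (g := V.ρ g ∘ₗ permLift fun _ ↦ LinearMap.id) (permTensor_ext fun x v ↦ by
      rw [LinearMap.comp_apply, LinearMap.comp_apply, rho_permSingle, permLift_single,
        permLift_single]
      rfl)

lemma permCounit_single (V : Rep.{u} k G) (x : X) (v : V) :
    (permCounit X V).hom.toLinearMap (permSingle X V x v) = v :=
  permLift_single _ x v

lemma permCounit_naturality {V W : Rep.{u} k G} (f : V ⟶ W) :
    (permTensor X).map f ≫ permCounit X W = permCounit X V ≫ f :=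
  rep_hom_ext (LinearMap.congr_fun (permTensor_ext fun x v ↦ by
    rw [comp_apply', comp_apply', permTensor_map_single, permCounit_single, permCounit_single]))

/-- If `|X|` is invertible in `k` then `V` is a direct summand of `k[X] ⊗ V`. -/
lemma nonempty_retract_permTensor [Finite X] (V : Rep.{u} k G) (h : (Nat.card X : k) ≠ 0) :
    Nonempty (Retract V ((permTensor X).obj V)) := by
  cases nonempty_fintype X
  rw [Nat.card_eq_fintype_card] at h
  have hs (v : V) : (∑ x : X, permSingle X V x) v = ∑ x : X, permSingle X V x v :=
    LinearMap.sum_apply _ _ _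
  -- The inclusion is v ↦ ∑ x ⊗ v and the retraction is the counit divided by |X|.
  refine ⟨⟨homMk (∑ x : X, permSingle X V x) fun g v ↦ ?_,
    homMk ((Fintype.card X : k)⁻¹ • (permCounit X V).hom.toLinearMap) fun g v ↦ ?_,
    rep_hom_ext fun v ↦ ?_⟩⟩
  · rw [hs, hs, map_sum]
    simp only [rho_permSingle]
    exact (Fintype.sum_equiv (MulAction.toPerm g) _ _ fun x ↦ rfl).symm
  · rw [LinearMap.smul_apply, hom_rho, LinearMap.smul_apply, map_smul]
  · change (Fintype.card X : k)⁻¹ • (permCounit X V).hom.toLinearMap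
      ((∑ x : X, permSingle X V x) v) = v
    rw [hs, map_sum]
    simp only [permCounit_single]
    rw [Finset.sum_const, Finset.card_univ, ← Nat.cast_smul_eq_nsmul k, smul_smul,
      inv_mul_cancel₀ h, one_smul]

end PermTensor

/-! ### One-sided freeness and tensor products -/

section Free

variable {k : Type u} [Field k] {G : Type u} [Group G]

/-- A direct summand of a permutation module that is free on the left has a projection whose trace
is the identity. -/
lemma IsPermRetract.exists_trace [Fintype G] {M : Rep.{u} k (G × G)}
    (h : IsPermRetract (axes G) M) : ∃ θ : M.V →ₗ[k] M.V,
      ∑ g : G, M.ρ (g, 1) ∘ₗ θ ∘ₗ M.ρ (g⁻¹, 1) = LinearMap.id := by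
  classical
  obtain ⟨N, ι, hι, b, hb, hS, ⟨r⟩⟩ := h
  let := hb.mulAction
  let : MulAction G ι := MulAction.compHom ι (MonoidHom.inl G G)
  have hact (g : G) (i : ι) : N.ρ (g, 1) (b i) = b (g • i) := hb.rho (g, 1) i
  have hfree (g : G) (i : ι) (hg : g • i = i) : g = 1 :=
    congrArg Prod.fst (hS (g, 1) (Or.inr rfl) i (by rw [hact, hg]))
  -- θ projects onto the span of chosen orbit representatives. Each basis element is the translate
  -- of its representative by exactly one group element, by freeness, so the trace of θ is the
  -- identity.
  let rep (i : ι) : ι := (Quotient.mk (MulAction.orbitRel G ι) i).out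
  have hrep (i : ι) : ∃ g : G, g • i = rep i :=
    Quotient.mk_out (s := MulAction.orbitRel G ι) i
  have hrep' (g : G) (i : ι) : rep (g • i) = rep i :=
    congrArg Quotient.out (Quotient.sound (s := MulAction.orbitRel G ι) ⟨g, rfl⟩)
  let θ : N.V →ₗ[k] N.V := b.constr k fun i ↦ if rep i = i then b i else 0
  have hθ (i : ι) : θ (b i) = if rep i = i then b i else 0 := b.constr_basis k _ i
  have key : ∑ g : G, N.ρ (g, 1) ∘ₗ θ ∘ₗ N.ρ (g⁻¹, 1) = LinearMap.id := by
    refine b.ext fun i ↦ ?_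
    obtain ⟨g₀, hg₀⟩ := hrep i
    rw [LinearMap.sum_apply, LinearMap.id_apply, Finset.sum_eq_single g₀⁻¹]
    · rw [LinearMap.comp_apply, LinearMap.comp_apply, inv_inv, hact, hθ, hrep', if_pos hg₀.symm,
        hact, inv_smul_smul]
    · intro g _ hg
      rw [LinearMap.comp_apply, LinearMap.comp_apply, hact, hθ, hrep', if_neg, map_zero]
      intro h
      have := hfree (g * g₀) i (by rw [mul_smul, hg₀, h, smul_inv_smul])
      exact hg (eq_inv_of_mul_eq_one_left this)
    · exact fun h ↦ absurd (Finset.mem_univ _) h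
  -- The retraction and the inclusion are equivariant, so conjugating θ by them preserves the trace
  -- identity.
  refine ⟨r.r.hom.toLinearMap ∘ₗ θ ∘ₗ r.i.hom.toLinearMap, LinearMap.ext fun x ↦ ?_⟩
  have h := congrArg r.r.hom.toLinearMap (LinearMap.congr_fun key (r.i.hom.toLinearMap x))
  rw [LinearMap.sum_apply, map_sum, LinearMap.id_apply, ← comp_apply', r.retract, id_apply'] at h
  rw [LinearMap.sum_apply, LinearMap.id_apply]
  refine Eq.trans (Finset.sum_congr rfl fun g _ ↦ ?_) h
  simp only [LinearMap.comp_apply, hom_rho]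

/-- The coinvariants of a permutation module have a basis indexed by orbits. -/
lemma exists_basis_coinvariants {V : Type*} [AddCommGroup V] [Module k V]
    (ρ : Representation k G V) {κ : Type*} [MulAction G κ] (c : Module.Basis κ k V)
    (hc : ∀ g i, ρ g (c i) = c (g • i)) :
    ∃ B : Module.Basis (MulAction.orbitRel.Quotient G κ) k ρ.Coinvariants,
      ∀ i, B (Quotient.mk _ i) = Representation.Coinvariants.mk ρ (c i) := by
  let f : ρ.Coinvariants →ₗ[k] (MulAction.orbitRel.Quotient G κ →₀ k) :=
    Representation.Coinvariants.lift ρ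
      (c.constr k fun i ↦ Finsupp.single (Quotient.mk _ i) 1) fun g ↦ c.ext fun i ↦ by
        rw [LinearMap.comp_apply, hc, c.constr_basis, c.constr_basis]
        congr 1
        exact Quotient.sound ⟨g, rfl⟩
  have hf (i : κ) : f (Representation.Coinvariants.mk ρ (c i)) =
      Finsupp.single (Quotient.mk _ i) 1 := c.constr_basis k _ i
  let f' : (MulAction.orbitRel.Quotient G κ →₀ k) →ₗ[k] ρ.Coinvariants :=
    Finsupp.lift _ k _ fun q ↦ Representation.Coinvariants.mk ρ (c q.out)
  have hf' (i : κ) : f' (Finsupp.single (Quotient.mk _ i) 1) =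
      Representation.Coinvariants.mk ρ (c i) := by
    obtain ⟨g, hg⟩ : ∃ g : G, g • i =
      (Quotient.mk (MulAction.orbitRel G κ) i).out :=
      Quotient.mk_out (s := MulAction.orbitRel G κ) i
    have : f' (Finsupp.single (Quotient.mk _ i) 1) = Representation.Coinvariants.mk ρ
        (c (Quotient.mk (MulAction.orbitRel G κ) i).out) := by
      simp [f']
    rw [this, ← hg, ← hc, Representation.Coinvariants.mk_self_apply]
  let e : ρ.Coinvariants ≃ₗ[k] (MulAction.orbitRel.Quotient G κ →₀ k) :=
    LinearEquiv.ofLinearMap f f' (Finsupp.lhom_ext' fun q ↦ LinearMap.ext_ring (by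
      induction q using Quotient.inductionOn with
      | h i => exact (congrArg f (hf' i)).trans (hf i)))
      (Representation.Coinvariants.hom_ext (c.ext fun i ↦ (congrArg f' (hf i)).trans (hf' i)))
  refine ⟨.ofRepr e, fun i ↦ ?_⟩
  rw [Module.Basis.coe_ofRepr]
  exact hf' i

/-- A basis of the tensor product consists of the orbits of G on pairs (i, j) under the middle
action. If (a, 1) fixes the orbit of (i, j), some h takes (i, j) to ((a, 1)i, j). Left freeness at j
gives h = 1, and then left freeness at i gives a = 1. The other side is symmetric. -/
lemma IsPermRetract.bimoduleTensor [Finite G] {M N : Rep.{u} k (G × G)}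
    (hM : IsPermRetract (axes G) M) (hN : IsPermRetract (axes G) N) :
    IsPermRetract (axes G) (bimoduleTensorObj M N) := by
  obtain ⟨M', ι, hι, b, hb, hS, ⟨r⟩⟩ := hM
  obtain ⟨N', ι', hι', b', hb', hS', ⟨r'⟩⟩ := hN
  refine IsPermRetract.of_retract (N := bimoduleTensorObj M' N') ?_
    ⟨bimoduleTensorMap r.i r'.i, bimoduleTensorMap r.r r'.r, bimoduleTensor_hom_ext fun m n ↦ by
      have h₁ : r.r.hom.toLinearMap (r.i.hom.toLinearMap m) = m := by
        rw [← comp_apply', r.retract, id_apply']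
      have h₂ : r'.r.hom.toLinearMap (r'.i.hom.toLinearMap n) = n := by
        rw [← comp_apply', r'.retract, id_apply']
      change pure M N (r.r.hom.toLinearMap (r.i.hom.toLinearMap m))
        (r'.r.hom.toLinearMap (r'.i.hom.toLinearMap n)) = pure M N m n
      rw [h₁, h₂]⟩
  let := hb.mulAction
  let := hb'.mulAction
  let : MulAction G ι := MulAction.compHom ι (MonoidHom.inr G G)
  let : MulAction G ι' := MulAction.compHom ι' (MonoidHom.inl G G)
  have hact (g : G) (i : ι) : M'.ρ (1, g) (b i) = b (g • i) := hb.rho (1, g) i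
  have hact' (g : G) (i : ι') : N'.ρ (g, 1) (b' i) = b' (g • i) := hb'.rho (g, 1) i
  obtain ⟨B, hB⟩ := exists_basis_coinvariants (middleAction M' N') (b.tensorProduct b')
    (fun g i ↦ by
      rw [Module.Basis.tensorProduct_apply', Module.Basis.tensorProduct_apply']
      change M'.ρ (1, g) (b i.1) ⊗ₜ N'.ρ (g, 1) (b' i.2) = _
      rw [hact, hact']
      rfl)
  have hB' (i : ι) (j : ι') : B (Quotient.mk _ (i, j)) = pure M' N' (b i) (b' j) := by
    rw [hB, Module.Basis.tensorProduct_apply]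
    rfl
  have key (x : G × G) (i : ι) (j : ι') :
      (bimoduleTensorObj M' N').ρ x (B (Quotient.mk _ (i, j))) =
        B (Quotient.mk _ ((x.1, (1 : G)) • i, ((1 : G), x.2) • j)) := by
    rw [hB', hB', rho_pure, hb.rho, hb'.rho]
  refine .of_basis (N := bimoduleTensorObj M' N') (b := B) (fun g q ↦ ?_) fun s hs q hq ↦ ?_
  · induction q using Quotient.inductionOn with
    | h i => exact ⟨_, key g i.1 i.2⟩
  · induction q using Quotient.inductionOn with
    | h i =>
      obtain ⟨i, j⟩ := i
      obtain ⟨h, hh⟩ := Quotient.exact (B.injective ((key s i j).symm.trans hq))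
      have h₁ : M'.ρ (1, h) (b i) = M'.ρ (s.1, 1) (b i) := by
        rw [hact, hb.rho]
        exact congrArg (fun x ↦ b x.1) hh
      have h₂ : N'.ρ (h, 1) (b' j) = N'.ρ (1, s.2) (b' j) := by
        rw [hact', hb'.rho]
        exact congrArg (fun x ↦ b' x.2) hh
      rcases hs with hs | hs
      · rw [hs, rho_one_one] at h₁
        have h3 := congrArg Prod.snd (hS (1, h) (Or.inl rfl) i h₁)
        change h = 1 at h3
        rw [h3, rho_one_one] at h₂
        exact Prod.ext hs (Prod.ext_iff.1 (hS' (1, s.2) (Or.inl rfl) j h₂.symm)).2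
      · rw [hs, rho_one_one] at h₂
        have h3 := congrArg Prod.fst (hS' (h, 1) (Or.inr rfl) j h₂)
        change h = 1 at h3
        rw [h3, rho_one_one] at h₁
        exact Prod.ext (Prod.ext_iff.1 (hS (s.1, 1) (Or.inr rfl) i h₁.symm)).1 hs

end Free

/-! ### Sylow subgroups and relative projectivity -/

section RelativeProjectivity

variable {k : Type u} [Field k] {G : Type u} [Group G]

/-- The action of a group element as a linear equivalence. -/
def rhoEquiv (M : Rep.{u} k G) (g : G) : M.V ≃ₗ[k] M.V :=
  LinearEquiv.ofLinearMap (M.ρ g) (M.ρ g⁻¹) (by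
    rw [← Module.End.mul_eq_comp, ← map_mul, mul_inv_cancel, map_one]; rfl) (by
    rw [← Module.End.mul_eq_comp, ← map_mul, inv_mul_cancel, map_one]; rfl)

lemma natCard_quotient_sylow_ne_zero {p : ℕ} [Fact p.Prime] [CharP k p] [Finite G]
    (P : Sylow p G) : (Nat.card (G ⧸ (P : Subgroup G)) : k) ≠ 0 := by
  rw [Ne, CharP.cast_eq_zero_iff k p]
  exact P.not_dvd_index

/-- For a Sylow subgroup P the index [G : P] is invertible in k, so M is a summand of k[G/P] ⊗ M. A
P-permuted basis of M, translated by coset representatives, gives a basis of this module permuted by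
G. -/
lemma IsPPermutation.isPermRetract {p : ℕ} [Fact p.Prime] [CharP k p] [Finite G]
    {M : Rep.{u} k G} (h : IsPPermutation p M) : IsPermRetract ∅ M := by
  obtain ⟨hfin, h⟩ := h
  obtain ⟨P⟩ : Nonempty (Sylow p G) := inferInstance
  obtain ⟨ι, b, hb⟩ := h P P.isPGroup'
  have hι : Finite ι := Module.Finite.finite_basis b
  obtain ⟨r⟩ := nonempty_retract_permTensor (X := G ⧸ (P : Subgroup G)) M
    (natCard_quotient_sylow_ne_zero P)
  refine IsPermRetract.of_retract ?_ r
  let c : Module.Basis (Σ _ : G ⧸ (P : Subgroup G), ι) k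
      ((permTensor (G ⧸ (P : Subgroup G))).obj M).V :=
    Finsupp.basis fun x : G ⧸ (P : Subgroup G) ↦ b.map (rhoEquiv M x.out)
  have hc (x : G ⧸ (P : Subgroup G)) (i : ι) : c ⟨x, i⟩ = permSingle _ M x (M.ρ x.out (b i)) := by
    exact congrFun (Finsupp.coe_basis _) (⟨x, i⟩ : Σ _, ι)
  refine .of_basis (b := c) (fun g i ↦ ?_) fun s hs ↦ hs.elim
  obtain ⟨x, i⟩ := i
  -- The element comparing g · (representative of x) with the representative of gx lies in P, and
  -- hence permutes the chosen basis.
  have hx : (g • x).out⁻¹ * (g * x.out) ∈ (P : Subgroup G) := by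
    rw [← QuotientGroup.eq, QuotientGroup.out_eq']
    conv_lhs => rw [← QuotientGroup.out_eq' x]
    rfl
  obtain ⟨j, hj⟩ := hb _ hx i
  refine ⟨⟨g • x, j⟩, ?_⟩
  rw [hc, hc, rho_permSingle, ← hj]
  simp only [← Module.End.mul_apply, ← map_mul]
  simp

/-- A fixed basis element x ⊗ i has x fixed, so freeness of `S` on X suffices and M contributes
nothing but a permuted basis. -/
lemma IsPermRetract.permTensor {S : Set G} {X : Type u} [MulAction G X] [Finite X]
    (hX : ∀ s ∈ S, ∀ x : X, s • x = x → s = 1) {M : Rep.{u} k G} (h : IsPermRetract ∅ M) :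
    IsPermRetract S ((permTensor X).obj M) := by
  obtain ⟨N, ι, hι, b, hb, -, ⟨r⟩⟩ := h
  refine IsPermRetract.of_retract ?_ (r.map (EndotrivialComplexes.permTensor X))
  let := hb.mulAction
  let c : Module.Basis (Σ _ : X, ι) k ((EndotrivialComplexes.permTensor X).obj N).V :=
    Finsupp.basis fun _ : X ↦ b
  have hc (x : X) (i : ι) : c ⟨x, i⟩ = permSingle _ N x (b i) := by
    exact congrFun (Finsupp.coe_basis _) (⟨x, i⟩ : Σ _, ι)
  have key (g : G) (x : X) (i : ι) :
      ((EndotrivialComplexes.permTensor X).obj N).ρ g (c ⟨x, i⟩) = c ⟨g • x, g • i⟩ := by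
    rw [hc, hc, rho_permSingle, hb.rho]
  refine .of_basis (b := c) (fun g i ↦ ⟨_, key g i.1 i.2⟩) fun s hs i hi ↦ ?_
  exact hX s hs i.1 (congrArg Sigma.fst (c.injective ((key s i.1 i.2).symm.trans hi)))

lemma ind_hom_ext {D : Subgroup G} {N : Rep.{u} k D} {M : Rep.{u} k G}
    {f g : Rep.ind D.subtype N ⟶ M}
    (h : ∀ n, f.hom.toLinearMap (Representation.IndV.mk D.subtype N.ρ 1 n) =
      g.hom.toLinearMap (Representation.IndV.mk D.subtype N.ρ 1 n)) : f = g :=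
  (Rep.indResHomEquiv D.subtype N M).injective (rep_hom_ext h)

lemma ind_mk_one_rho {D : Subgroup G} (N : Rep.{u} k D) (d : D) (n : N) :
    Representation.IndV.mk D.subtype N.ρ 1 (N.ρ d n) =
      (Rep.ind D.subtype N).ρ d (Representation.IndV.mk D.subtype N.ρ 1 n) :=
  hom_rho (Rep.indResHomEquiv D.subtype N _ (𝟙 (Rep.ind D.subtype N))) d n

lemma indResHomEquiv_symm_mk {D : Subgroup G} {N : Rep.{u} k D} {M : Rep.{u} k G}
    (f : N ⟶ Rep.res D.subtype M) (g : G) (n : N) :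
    ((Rep.indResHomEquiv D.subtype N M).symm f).hom.toLinearMap
      (Representation.IndV.mk D.subtype N.ρ g n) = M.ρ g⁻¹ (f.hom.toLinearMap n) := by
  simp [Rep.indResHomEquiv]

lemma indResHomEquiv_symm_mk_one {D : Subgroup G} {N : Rep.{u} k D} {M : Rep.{u} k G}
    (f : N ⟶ Rep.res D.subtype M) (n : N) :
    ((Rep.indResHomEquiv D.subtype N M).symm f).hom.toLinearMap
      (Representation.IndV.mk D.subtype N.ρ 1 n) = f.hom.toLinearMap n := by
  rw [indResHomEquiv_symm_mk]
  simp

/-- A relatively `D`-projective module `M` is a direct summand of `k[G/D] ⊗ M`. -/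
lemma IsRelativelyProjective.nonempty_retract {M : Rep.{u} k G} {D : Subgroup G}
    (h : IsRelativelyProjective M D) : Nonempty (Retract M ((permTensor (G ⧸ D)).obj M)) := by
  obtain ⟨N, -, ⟨r⟩⟩ := h
  let I := Rep.ind D.subtype N
  -- For the induced module I, Frobenius reciprocity extends n ↦ D ⊗ n to a section of the counit
  -- k[G/D] ⊗ I → I. Naturality of the counit passes the splitting to the summand M.
  let δ : N ⟶ Rep.res D.subtype ((permTensor (G ⧸ D)).obj I) :=
    homMk (permSingle (G ⧸ D) I (1 : G) ∘ₗ Representation.IndV.mk D.subtype N.ρ 1) fun d n ↦ by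
      change permSingle (G ⧸ D) I (1 : G) (Representation.IndV.mk D.subtype N.ρ 1 (N.ρ d n)) =
        ((permTensor (G ⧸ D)).obj I).ρ d (permSingle (G ⧸ D) I (1 : G)
          (Representation.IndV.mk D.subtype N.ρ 1 n))
      rw [rho_permSingle, ind_mk_one_rho]
      congr 1
      refine congrArg (permSingle (G ⧸ D) I) (QuotientGroup.eq.2 ?_)
      simp
  let δ' : I ⟶ (permTensor (G ⧸ D)).obj I := (Rep.indResHomEquiv D.subtype N _).symm δ
  have hδ' : δ' ≫ permCounit (G ⧸ D) I = 𝟙 I := ind_hom_ext fun n ↦ by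
    rw [comp_apply', indResHomEquiv_symm_mk_one]
    exact permCounit_single I _ _
  refine ⟨⟨r.i ≫ δ' ≫ (permTensor (G ⧸ D)).map r.r, permCounit (G ⧸ D) M, ?_⟩⟩
  rw [Category.assoc, Category.assoc, permCounit_naturality, reassoc_of% hδ', r.retract]

end RelativeProjectivity

/-! ### Transitive permutation modules and vertices -/

section Vertex

variable {k : Type u} [Field k] {G : Type u} [Group G]

/-- The permutation module `k[X]`. -/
abbrev permModule (k : Type u) [Field k] {G : Type u} [Group G] (X : Type u) [MulAction G X] :
    Rep.{u} k G :=
  (permTensor X).obj (Rep.trivial k G k)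

/-- The basis element of `k[X]` given by `x`. -/
def permPoint (k : Type u) [Field k] (G : Type u) [Group G] {X : Type u} [MulAction G X] (x : X) :
    (permModule (G := G) k X).V :=
  permSingle X (Rep.trivial k G k) x (1 : k)

section

variable {X : Type u} [MulAction G X]

lemma rho_permPoint (g : G) (x : X) :
    (permModule k X).ρ g (permPoint k G x) = permPoint k G (g • x) :=
  rho_permSingle (Rep.trivial k G k) g x (1 : k)

lemma permModule_ext {W : Type*} [AddCommGroup W] [Module k W]
    {f g : (permModule (G := G) k X).V →ₗ[k] W}
    (h : ∀ x, f (permPoint k G x) = g (permPoint k G x)) : f = g :=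
  permTensor_ext fun x ↦ LinearMap.congr_fun (LinearMap.ext_ring (h x) :
    f ∘ₗ permSingle X (Rep.trivial k G k) x = g ∘ₗ permSingle X (Rep.trivial k G k) x)

variable (k G X) in
/-- The basis of `k[X]`. -/
def permModuleBasis : Module.Basis X k (permModule (G := G) k X).V :=
  .ofRepr (LinearEquiv.refl k (X →₀ k))

lemma permModuleBasis_apply (x : X) : permModuleBasis k G X x = permPoint k G x := rfl

/-- The morphism from `k[X]` given by an equivariant map from `X`. -/
def permModuleLift {M : Rep.{u} k G} (f : X → M.V) (hf : ∀ g x, f (g • x) = M.ρ g (f x)) :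
    permModule k X ⟶ M :=
  homMk ((permModuleBasis k G X).constr k f) fun g ↦ LinearMap.congr_fun
    (f := (permModuleBasis k G X).constr k f ∘ₗ (permModule k X).ρ g)
    (g := M.ρ g ∘ₗ (permModuleBasis k G X).constr k f) (permModule_ext fun x ↦ by
      rw [LinearMap.comp_apply, rho_permPoint, LinearMap.comp_apply, ← permModuleBasis_apply,
        ← permModuleBasis_apply, Module.Basis.constr_basis, Module.Basis.constr_basis, hf])

lemma permModuleLift_point {M : Rep.{u} k G} (f : X → M.V) (hf) (x : X) :
    (permModuleLift f hf).hom.toLinearMap (permPoint k G x) = f x :=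
  (permModuleBasis k G X).constr_basis k f x

/-- The module `k[X]` of a transitive `G`-set `X` is projective relative to point stabilizers. -/
lemma isRelativelyProjective_permModule [MulAction.IsPretransitive G X] (x₀ : X) :
    IsRelativelyProjective (permModule k X) (MulAction.stabilizer G x₀) := by
  let E := MulAction.stabilizer G x₀
  let T := Rep.trivial k E k
  -- With trivial coefficients, generators of the induced module depend only on the coset E h. This
  -- makes the map x ↦ (t x)⁻¹ ⊗ 1 equivariant for any choice of elements t x carrying x₀ to x.
  have hinv (h : G) (e : E) : Representation.IndV.mk E.subtype T.ρ (e * h) (1 : k) =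
      Representation.IndV.mk E.subtype T.ρ h (1 : k) := by
    have h1 : Representation.IndV.mk E.subtype T.ρ h (1 : k) =
      (Rep.ind E.subtype T).ρ h⁻¹ (Representation.IndV.mk E.subtype T.ρ 1 (1 : k)) := by
      refine Eq.trans ?_ (Representation.ind_mk E.subtype T.ρ h⁻¹ 1 (1 : k)).symm
      simp
    have h2 : Representation.IndV.mk E.subtype T.ρ (e * h) (1 : k) =
      (Rep.ind E.subtype T).ρ (e * h)⁻¹ (Representation.IndV.mk E.subtype T.ρ 1 (1 : k)) := by
      refine Eq.trans ?_ (Representation.ind_mk E.subtype T.ρ (e * h)⁻¹ 1 (1 : k)).symm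
      simp
    rw [h1, h2, mul_inv_rev, map_mul, Module.End.mul_apply]
    congr 1
    exact (ind_mk_one_rho T e⁻¹ (1 : k)).symm
  choose t ht using fun x : X ↦ MulAction.exists_smul_eq G x₀ x
  let α : permModule k X ⟶ Rep.ind E.subtype T :=
    permModuleLift (fun x ↦ Representation.IndV.mk E.subtype T.ρ (t x)⁻¹ (1 : k)) fun g x ↦ by
      refine Eq.trans ?_ (Representation.ind_mk E.subtype T.ρ g (t x)⁻¹ (1 : k)).symm
      have he : (t (g • x))⁻¹ * (g * t x) ∈ E := by
        change _ • x₀ = x₀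
        rw [mul_smul, mul_smul, ht, inv_smul_eq_iff, ht]
      rw [← hinv ((t x)⁻¹ * g⁻¹) ⟨_, he⟩]
      congr 2
      group
  let β₀ : T ⟶ Rep.res E.subtype (permModule k X) :=
    homMk (LinearMap.toSpanSingleton k _ (permPoint k G x₀)) fun e (c : k) ↦ by
      change c • permPoint k G x₀ = (permModule (G := G) k X).ρ e (c • permPoint k G x₀)
      rw [map_smul, rho_permPoint]
      congr 2
      exact e.2.symm
  let β := (Rep.indResHomEquiv E.subtype T _).symm β₀
  refine ⟨T, inferInstanceAs (Module.Finite k k), ⟨⟨α, β, rep_hom_ext (LinearMap.congr_fun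
    (permModule_ext fun x ↦ ?_))⟩⟩⟩
  rw [comp_apply', permModuleLift_point, indResHomEquiv_symm_mk]
  change (permModule k X).ρ _ ((1 : k) • permPoint k G x₀) = permPoint k G x
  rw [one_smul, inv_inv, rho_permPoint, ht]

end

lemma IsRelativelyProjective.of_retract {M N : Rep.{u} k G} {D : Subgroup G}
    (h : IsRelativelyProjective N D) (r : Retract M N) : IsRelativelyProjective M D := by
  obtain ⟨L, hL, ⟨r'⟩⟩ := h
  exact ⟨L, hL, ⟨r.trans r'⟩⟩

/-- An indecomposable direct summand of a permutation module is a direct summand of a transitive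
permutation module. -/
lemma exists_retract_orbit {U N : Rep.{u} k G} (hU : Indecomposable U) (r : Retract U N)
    {ι : Type u} [Finite ι] [MulAction G ι] (b : Module.Basis ι k N.V)
    (hb : ∀ g i, N.ρ g (b i) = b (g • i)) :
    ∃ i : ι, Nonempty (Retract U (permModule k (MulAction.orbit G i))) := by
  classical
  have := Module.Finite.of_basis b
  have := finite_of_retract r
  let Q := MulAction.orbitRel.Quotient G ι
  have : Finite Q := inferInstanceAs (Finite (Quotient _))
  have := Fintype.ofFinite Q
  let X (q : Q) := MulAction.orbit G (Quotient.out q)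
  let β (q : Q) : permModule k (X q) ⟶ N := permModuleLift (fun x ↦ b x) fun g x ↦ (hb g x).symm
  have hβ (q : Q) (x : X q) : (β q).hom.toLinearMap (permPoint k G x) = b x :=
    permModuleLift_point _ _ x
  let α₀ (q : Q) : N.V →ₗ[k] (permModule (G := G) k (X q)).V :=
    b.constr k fun i ↦ if h : i ∈ X q then permPoint k G ⟨i, h⟩ else 0
  have hα₀ (q : Q) (i : ι) : α₀ q (b i) = if h : i ∈ X q then permPoint k G ⟨i, h⟩ else 0 :=
    b.constr_basis k _ i
  let α (q : Q) : N ⟶ permModule k (X q) := homMk (α₀ q) fun g ↦ LinearMap.congr_fun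
    (f := α₀ q ∘ₗ N.ρ g) (g := (permModule k (X q)).ρ g ∘ₗ α₀ q) (b.ext fun i ↦ by
      rw [LinearMap.comp_apply, LinearMap.comp_apply, hb, hα₀, hα₀]
      by_cases h : i ∈ X q
      · have h' : g • i ∈ X q := MulAction.mem_orbit_of_mem_orbit g h
        rw [dif_pos h, dif_pos h', rho_permPoint]
        rfl
      · have h' : g • i ∉ X q := fun h' ↦ h (by
          simpa using MulAction.mem_orbit_of_mem_orbit g⁻¹ h')
        rw [dif_neg h, dif_neg h', map_zero])
  have key : ∑ q, α q ≫ β q = 𝟙 N := rep_hom_ext (LinearMap.congr_fun (b.ext fun i ↦ by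
    rw [sum_apply', id_apply', Finset.sum_eq_single (Quotient.mk _ i : Q)]
    · have h : i ∈ X (Quotient.mk _ i : Q) :=
        Setoid.symm' (MulAction.orbitRel G ι) (Quotient.mk_out (s := MulAction.orbitRel G ι) i)
      rw [comp_apply']
      change (β _).hom.toLinearMap (α₀ _ (b i)) = _
      rw [hα₀, dif_pos h, hβ]
    · intro q _ hq
      have h : i ∉ X q := fun h ↦ hq (by
        rw [← Quotient.out_eq q]
        exact Quotient.sound (s := MulAction.orbitRel G ι)
          (Setoid.symm' (MulAction.orbitRel G ι) h))
      rw [comp_apply']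
      change (β _).hom.toLinearMap (α₀ _ (b i)) = _
      rw [hα₀, dif_neg h, map_zero]
    · exact fun h ↦ absurd (Finset.mem_univ _) h))
  obtain ⟨q, -, hq⟩ := exists_retract_of_sum hU Finset.univ (fun q ↦ permModule k (X q))
    (fun q ↦ r.i ≫ α q) (fun q ↦ β q ≫ r.r) (by
      have h := congrArg (fun f ↦ r.i ≫ f ≫ r.r) key
      simp only [Category.id_comp, r.retract] at h
      rw [← h, Preadditive.sum_comp, Preadditive.comp_sum]
      simp only [Category.assoc])
  exact ⟨q.out, hq⟩

/-- A minimal subgroup among those for which a module is relatively projective exists below any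
subgroup with this property. -/
lemma exists_isVertex_le [Finite G] {U : Rep.{u} k G} {E : Subgroup G}
    (h : IsRelativelyProjective U E) : ∃ D ≤ E, IsVertex U D :=
  exists_minimal_le_of_wellFoundedLT (IsRelativelyProjective U) E h

variable {p : ℕ}

/-- A `p`-subgroup of `G × G` that meets both factors trivially is twisted diagonal. -/
lemma isTwistedDiagonal_of_free {D : Subgroup (G × G)} (hp : IsPGroup p D)
    (hD : ∀ x ∈ D, x ∈ axes G → x = 1) : IsTwistedDiagonal p D := by
  let f : D →* G := (MonoidHom.fst G G).comp D.subtype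
  let s : D →* G := (MonoidHom.snd G G).comp D.subtype
  have hf : Function.Injective f := (injective_iff_map_eq_one f).2 fun x hx ↦
    Subtype.ext (hD x x.2 (Or.inl hx))
  have hs : Function.Injective s := (injective_iff_map_eq_one s).2 fun x hx ↦
    Subtype.ext (hD x x.2 (Or.inr hx))
  let ef : D ≃* f.range := f.ofInjective hf
  let es : D ≃* s.range := s.ofInjective hs
  -- Both projections are injective on D, and φ is the first one composed with the inverse of the
  -- second.
  refine ⟨f.range, s.range, es.symm.trans ef, hp.of_equiv ef, hp.of_equiv es, ?_⟩
  have key (d : D) : (((es.symm.trans ef) (es d) : G), ((es d : s.range) : G)) = (d : G × G) := by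
    rw [MulEquiv.trans_apply, MulEquiv.symm_apply_apply]
    rfl
  ext x
  constructor
  · exact fun hx ↦ ⟨es ⟨x, hx⟩, key ⟨x, hx⟩⟩
  · rintro ⟨g, rfl⟩
    obtain ⟨d, rfl⟩ := es.surjective g
    change (((es.symm.trans ef) (es d) : G), ((es d : s.range) : G)) ∈ D
    rw [key d]
    exact d.2

lemma mem_axes_conj {x y : G × G} (h : x ∈ axes G) : y⁻¹ * x * y ∈ axes G := by
  rcases h with h | h
  · exact Or.inl (by simp [h])
  · exact Or.inr (by simp [h])

/-- Indecomposable direct summands of permutation bimodules that are free on both sides have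
twisted diagonal vertices. -/
lemma IsPermRetract.exists_isVertex [Fact p.Prime] [CharP k p] [Finite G] {M U : Rep.{u} k (G × G)}
    (hM : IsPermRetract (axes G) M) (hU : Indecomposable U) (r : Retract U M) :
    ∃ D, IsVertex U D ∧ IsTwistedDiagonal p D := by
  obtain ⟨N, ι, hι, b, hb, hS, ⟨r'⟩⟩ := hM
  obtain ⟨P⟩ : Nonempty (Sylow p (G × G)) := inferInstance
  let X := (G × G) ⧸ (P : Subgroup (G × G))
  -- U is a summand of k[X] ⊗ N with basis X × ι. Stabilizers of points of X are conjugates of P,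
  -- while those of points of ι meet the axes trivially, so stabilizers of pairs have both
  -- properties.
  obtain ⟨r₀⟩ := nonempty_retract_permTensor (X := X) U (natCard_quotient_sylow_ne_zero P)
  let := hb.mulAction
  let c : Module.Basis (Σ _ : X, ι) k ((EndotrivialComplexes.permTensor X).obj N).V :=
    Finsupp.basis fun _ : X ↦ b
  have hc (x : X) (i : ι) : c ⟨x, i⟩ = permSingle _ N x (b i) :=
    congrFun (Finsupp.coe_basis _) (⟨x, i⟩ : Σ _, ι)
  let c' : Module.Basis (X × ι) k ((EndotrivialComplexes.permTensor X).obj N).V :=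
    c.reindex (Equiv.sigmaEquivProd X ι)
  have hc' (x : X) (i : ι) : c' (x, i) = permSingle _ N x (b i) := by
    rw [← hc, Module.Basis.reindex_apply]
    rfl
  obtain ⟨i, ⟨r₁⟩⟩ := exists_retract_orbit hU
    (r₀.trans ((r.trans r').map (EndotrivialComplexes.permTensor X))) c' (fun g i ↦ by
      obtain ⟨x, i⟩ := i
      rw [hc', rho_permSingle, hb.rho]
      exact (hc' _ _).symm)
  have hE := (isRelativelyProjective_permModule (k := k) (G := G × G)
    (⟨i, MulAction.mem_orbit_self i⟩ : MulAction.orbit (G × G) i)).of_retract r₁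
  -- Choosing a vertex inside a point stabilizer makes it inherit both properties.
  obtain ⟨D, hDE, hD⟩ := exists_isVertex_le hE
  have hstab (d) (hd : d ∈ D) : d • i = i := congrArg Subtype.val (hDE hd)
  refine ⟨D, hD, isTwistedDiagonal_of_free (fun d ↦ ?_) fun d hd hd' ↦ ?_⟩
  · have h : (d : G × G) • i.1 = i.1 := congrArg Prod.fst (hstab d d.2)
    have hmem : i.1.out⁻¹ * (d * i.1.out) ∈ (P : Subgroup (G × G)) := by
      rw [← QuotientGroup.eq, QuotientGroup.out_eq']
      conv_lhs => rw [← h, ← QuotientGroup.out_eq' i.1]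
      rfl
    obtain ⟨n, hn⟩ := P.isPGroup' ⟨_, hmem⟩
    refine ⟨n, Subtype.ext ?_⟩
    have hn' : (i.1.out⁻¹ * (d * i.1.out)) ^ p ^ n = 1 := congrArg Subtype.val hn
    have h2 : i.1.out⁻¹ * (d * i.1.out) = i.1.out⁻¹ * d * i.1.out⁻¹⁻¹ := by group
    rw [h2, conj_pow, conj_eq_one_iff] at hn'
    exact hn'
  · refine hS d hd' i.2 ?_
    rw [hb.rho]
    exact congrArg (fun z ↦ b z.2) (hstab d hd)

/-- A `p`-permutation bimodule whose indecomposable summands have twisted diagonal vertices is a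
direct summand of a permutation bimodule that is free on both sides. -/
lemma isPermRetract_axes [Fact p.Prime] [CharP k p] [Finite G] {M : Rep.{u} k (G × G)}
    (hM : IsPPermutation p M) (h : ∀ U, Indecomposable U → Nonempty (Retract U M) →
      ∃ D, IsVertex U D ∧ IsTwistedDiagonal p D) : IsPermRetract (axes G) M := by
  have hfin := hM.1
  refine indecomposable_induction (fun M hM ↦ .of_isZero hM)
    (fun M Y Z e hY hZ ↦ (hY.biprod hZ).of_retract ⟨e.hom, e.inv, e.hom_inv_id⟩) M
    fun U hU ⟨r⟩ ↦ ?_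
  obtain ⟨D, hD, P, Q, φ, -, -, hDφ⟩ := h U hU ⟨r⟩
  -- U is a summand of k[(G × G)/D] ⊗ U. An axis element fixing a coset has a conjugate in D; the
  -- axes are stable under conjugation and meet the twisted diagonal D only in 1, so the action of
  -- the axes on the cosets is free.
  obtain ⟨r'⟩ := hD.1.nonempty_retract
  refine IsPermRetract.of_retract (IsPermRetract.permTensor (fun s hs x hx ↦ ?_)
    (hM.isPermRetract.of_retract r)) r'
  have hmem : x.out⁻¹ * (s * x.out) ∈ D := by
    rw [← QuotientGroup.eq, QuotientGroup.out_eq']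
    conv_lhs => rw [← hx, ← QuotientGroup.out_eq' x]
    rfl
  rw [← mul_assoc] at hmem
  have hs' : x.out⁻¹ * s * x.out ∈ axes G := mem_axes_conj hs
  have h1 : x.out⁻¹ * s * x.out = 1 := by
    rw [← SetLike.mem_coe, hDφ] at hmem
    obtain ⟨q, hq⟩ := hmem
    rw [← hq] at hs' ⊢
    rcases hs' with h | h
    · have h2 : φ q = 1 := Subtype.ext h
      have h3 : q = 1 := (map_eq_one_iff φ φ.injective).1 h2
      rw [h3]
      change ((φ 1 : G), ((1 : Q) : G)) = 1
      rw [map_one]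
      rfl
    · have h3 : q = 1 := Subtype.ext h
      rw [h3]
      change ((φ 1 : G), ((1 : Q) : G)) = 1
      rw [map_one]
      rfl
  have h2 : s = x.out * (x.out⁻¹ * s * x.out) * x.out⁻¹ := by group
  rw [h2, h1]
  simp

end Vertex

/-! ### p-groups in characteristic p -/

section PGroup

variable {k : Type u} [Field k] {G : Type u} [Group G] {p : ℕ} [Fact p.Prime] [CharP k p]

/-- A nonzero representation of a `p`-group in characteristic `p` has a nonzero fixed vector. -/
lemma exists_fixed_vector [Finite G] (hG : IsPGroup p G) (V : Rep.{u} k G) {v : V} (hv : v ≠ 0) :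
    ∃ w : V, w ≠ 0 ∧ ∀ g, V.ρ g w = w := by
  classical
  cases nonempty_fintype G
  -- V may be infinite, so fixed points are counted in the 𝔽_p-span of the orbit of v, which is
  -- finite and stable under G.
  let f : (G → ZMod p) →+ V.V :=
    { toFun := fun a ↦ ∑ g : G, (ZMod.castHom dvd_rfl k (a g)) • V.ρ g v
      map_zero' := by simp
      map_add' := fun a b ↦ by simp [add_smul, Finset.sum_add_distrib] }
  have hf (a : G → ZMod p) : f a = ∑ g : G, (ZMod.castHom dvd_rfl k (a g)) • V.ρ g v := rfl
  have hA (g : G) (a : G → ZMod p) : V.ρ g (f a) = f fun x ↦ a (g⁻¹ * x) := by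
    rw [hf, hf, map_sum]
    refine Fintype.sum_equiv (Equiv.mulLeft g) _ _ fun x ↦ ?_
    rw [map_smul, ← Module.End.mul_apply, ← map_mul]
    simp
  have : Finite f.range := Set.finite_range f
  let : MulAction G f.range :=
    { smul := fun g a ↦ ⟨V.ρ g a, by
        obtain ⟨_, x, rfl⟩ := a
        exact ⟨_, (hA g x).symm⟩⟩
      one_smul := fun a ↦ Subtype.ext (by
        change V.ρ 1 a = a
        rw [map_one, Module.End.one_apply])
      mul_smul := fun g h a ↦ Subtype.ext (by
        change V.ρ (g * h) a = V.ρ g (V.ρ h a)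
        rw [map_mul, Module.End.mul_apply]) }
  have hvf : v ∈ f.range := ⟨Pi.single 1 1, by
    rw [hf, Finset.sum_eq_single 1]
    · simp
    · intro g _ hg
      rw [Pi.single_eq_of_ne hg, map_zero, zero_smul]
    · exact fun h ↦ absurd (Finset.mem_univ _) h⟩
  have hp : p ∣ Nat.card f.range := by
    have h : addOrderOf (⟨v, hvf⟩ : f.range) = p := addOrderOf_eq_prime
      (Subtype.ext (by
        change p • v = 0
        rw [← Nat.cast_smul_eq_nsmul k, CharP.cast_eq_zero, zero_smul]))
      fun h ↦ hv (congrArg Subtype.val h)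
    exact h.symm.dvd.trans (addOrderOf_dvd_natCard _)
  -- This set has order divisible by p since v has additive order p. The fixed point 0 therefore
  -- cannot be the only one.
  obtain ⟨w, hw, hw0⟩ := hG.exists_fixed_point_of_prime_dvd_card_of_fixed_point f.range hp
    (a := 0) fun g ↦ Subtype.ext (map_zero (V.ρ g))
  exact ⟨w, fun h ↦ hw0 (Subtype.ext h.symm), fun g ↦ congrArg Subtype.val (hw g)⟩

/-- The fixed vectors of a transitive permutation module are multiples of each other. -/
lemma smul_eq_smul_of_fixed {X : Type u} [MulAction G X] [MulAction.IsPretransitive G X]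
    {v w : permModule (G := G) k X} (hv : ∀ g, (permModule k X).ρ g v = v)
    (hw : ∀ g, (permModule k X).ρ g w = w) (hw0 : w ≠ 0) : ∃ c : k, v = c • w := by
  let b := permModuleBasis k G X
  have key (u : permModule (G := G) k X) (hu : ∀ g, (permModule k X).ρ g u = u) (x y : X) :
      b.repr u x = b.repr u y := by
    obtain ⟨g, rfl⟩ := MulAction.exists_smul_eq G x y
    have h : b.coord (g • x) ∘ₗ (permModule k X).ρ g = b.coord x := b.ext fun z ↦ by
      classical
      rw [LinearMap.comp_apply, permModuleBasis_apply, rho_permPoint, ← permModuleBasis_apply,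
        ← permModuleBasis_apply, Module.Basis.coord_apply, Module.Basis.coord_apply,
        Module.Basis.repr_self, Module.Basis.repr_self, Finsupp.single_apply, Finsupp.single_apply]
      simp
    have h' := LinearMap.congr_fun h u
    rw [LinearMap.comp_apply, hu] at h'
    exact h'.symm
  obtain ⟨x, hx⟩ : ∃ x, b.repr w x ≠ 0 := by
    by_contra! h
    exact hw0 (b.ext_elem fun x ↦ by rw [h x, map_zero, Finsupp.zero_apply])
  refine ⟨b.repr v x / b.repr w x, b.ext_elem fun y ↦ ?_⟩
  rw [map_smul, Finsupp.smul_apply, smul_eq_mul, key v hv y x, key w hw y x, div_mul_cancel₀ _ hx]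

/-- For a `p`-group in characteristic `p`, a nonzero direct summand of a transitive permutation
module is the whole module. -/
lemma bijective_of_retract_permModule [Finite G] (hG : IsPGroup p G) {X : Type u} [MulAction G X]
    [MulAction.IsPretransitive G X] {U : Rep.{u} k G} (hU : ¬IsZero U)
    (r : Retract U (permModule k X)) : Function.Bijective r.r.hom.toLinearMap := by
  have hr (u : U) : r.r.hom.toLinearMap (r.i.hom.toLinearMap u) = u := by
    rw [← comp_apply', r.retract, id_apply']
  refine ⟨?_, fun u ↦ ⟨_, hr u⟩⟩
  rw [rep_isZero_iff, not_forall] at hU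
  obtain ⟨u, hu⟩ := hU
  obtain ⟨u', hu', hfix⟩ := exists_fixed_vector hG U hu
  rw [injective_iff_map_eq_zero]
  by_contra! h
  obtain ⟨t, ht, ht0⟩ := h
  let K := Rep.subrepresentation (permModule k X) (LinearMap.ker r.r.hom.toLinearMap)
    fun g x hx ↦ by
      rw [LinearMap.mem_ker] at hx
      rw [Submodule.mem_comap, LinearMap.mem_ker, hom_rho, hx, map_zero]
  obtain ⟨w, hw0, hw⟩ := exists_fixed_vector hG K (v := ⟨t, ht⟩)
    fun h ↦ ht0 (congrArg Subtype.val h)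
  -- A nonzero kernel would contain a nonzero fixed vector w. The image of the nonzero fixed vector
  -- u' is a multiple of w, hence is killed by the retraction, contradicting u' ≠ 0.
  obtain ⟨c, hc⟩ := smul_eq_smul_of_fixed (v := r.i.hom.toLinearMap u') (w := w.1)
    (fun g ↦ by rw [← hom_rho, hfix]) (fun g ↦ congrArg Subtype.val (hw g))
    fun h ↦ hw0 (Subtype.ext h)
  refine hu' ?_
  rw [← hr u', hc, map_smul, LinearMap.mem_ker.1 w.2, smul_zero]

/-- Direct summands of permutation modules for `p`-groups are permutation modules. -/
lemma IsPermRetract.exists_basis [Finite G] (hG : IsPGroup p G) {S : Set G} {M : Rep.{u} k G}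
    (h : IsPermRetract S M) : ∃ (ι : Type u) (b : Module.Basis ι k M.V), IsPermBasis M b := by
  have := h.finite
  refine indecomposable_induction
    (Q := fun M ↦ ∃ (ι : Type u) (b : Module.Basis ι k M.V), IsPermBasis M b)
    (fun M hM ↦ ?_) (fun M Y Z e hY hZ ↦ ?_) M fun U hU ⟨r⟩ ↦ ?_
  · have : Subsingleton M.V := ⟨fun x y ↦ by
      rw [(rep_isZero_iff M).1 hM x, (rep_isZero_iff M).1 hM y]⟩
    exact ⟨PEmpty, Module.Basis.empty M.V, fun _ i ↦ i.elim⟩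
  · obtain ⟨ι, b, hb⟩ := hY
    obtain ⟨ι', b', hb'⟩ := hZ
    have h (g : G) (x : Y.V × Z.V) : M.ρ g ((biprodEquiv e).symm x) =
        (biprodEquiv e).symm (Y.ρ g x.1, Z.ρ g x.2) := by
      rw [LinearEquiv.eq_symm_apply, biprodEquiv_rho, LinearEquiv.apply_symm_apply]
    refine ⟨ι ⊕ ι', (b.prod b').map (biprodEquiv e).symm, ?_⟩
    rintro g (i | i)
    · obtain ⟨j, hj⟩ := hb g i
      exact ⟨Sum.inl j, by simp [h, hj]⟩
    · obtain ⟨j, hj⟩ := hb' g i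
      exact ⟨Sum.inr j, by simp [h, hj]⟩
  · obtain ⟨N, ι, hι, b, hb, -, ⟨r'⟩⟩ := h
    let := hb.mulAction
    obtain ⟨i, ⟨r₁⟩⟩ := exists_retract_orbit hU (r.trans r') b hb.rho
    have hbij := bijective_of_retract_permModule hG hU.1 r₁
    refine ⟨_, (permModuleBasis k G (MulAction.orbit G i)).map
      (LinearEquiv.ofBijective r₁.r.hom.toLinearMap hbij), fun g x ↦ ⟨g • x, ?_⟩⟩
    rw [Module.Basis.map_apply, Module.Basis.map_apply, LinearEquiv.ofBijective_apply,
      LinearEquiv.ofBijective_apply, ← hom_rho, permModuleBasis_apply, rho_permPoint]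
    rfl

/-- Direct summands of permutation modules are `p`-permutation modules. -/
lemma IsPermRetract.isPPermutation [Finite G] {S : Set G} {M : Rep.{u} k G}
    (h : IsPermRetract S M) : IsPPermutation p M := by
  refine ⟨h.finite, fun P hP ↦ ?_⟩
  obtain ⟨ι, b, hb⟩ := ((h.mono (Set.empty_subset S)).res P.subtype (T := ∅) (fun _ ht ↦ ht.elim)
    fun t ht ↦ Subtype.ext ht).exists_basis hP
  exact ⟨ι, b, fun g hg i ↦ hb ⟨g, hg⟩ i⟩

end PGroup

open Opposite

/-! ### The semigroup of homotopy classes of bimodule complexes -/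

section Classes

variable (k : Type u) [Field k] (G : Type u) [Group G]

/-- Bounded complexes of bimodules up to homotopy equivalence. -/
abbrev bimoduleClassSetoid :
    Setoid {K : ChainComplex (Rep.{u} k (G × G)) ℤ // IsBounded K} where
  r K L := HEquiv K.1 L.1
  iseqv := HEquiv.equivalence.comap Subtype.val

/-- The set of homotopy classes of bounded complexes of bimodules. -/
def BimoduleClass : Type (u + 1) := Quotient (bimoduleClassSetoid k G)

variable {k G}

/-- The homotopy class of a bounded complex of bimodules. -/
def bimoduleClass (K : ChainComplex (Rep.{u} k (G × G)) ℤ) (hK : IsBounded K) :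
    BimoduleClass k G :=
  Quotient.mk (bimoduleClassSetoid k G) ⟨K, hK⟩

lemma bimoduleClass_eq_iff {K L : ChainComplex (Rep.{u} k (G × G)) ℤ} {hK : IsBounded K}
    {hL : IsBounded L} : bimoduleClass K hK = bimoduleClass L hL ↔ HEquiv K L :=
  Quotient.eq (r := bimoduleClassSetoid k G)

lemma bimoduleClass_eq_of_iso {K L : ChainComplex (Rep.{u} k (G × G)) ℤ} {hK : IsBounded K}
    {hL : IsBounded L} (h : Nonempty (K ≅ L)) : bimoduleClass K hK = bimoduleClass L hL :=
  bimoduleClass_eq_iff.2 (HEquiv.of_iso h)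

/-- A common target for the two groups to be constructed. A left unit is enough here, because left
unit and left inverse laws already characterize groups. -/
instance : Semigroup (BimoduleClass k G) where
  mul := Quotient.map₂ (fun K L ↦ ⟨tot (bimoduleTensor k G G G) K.1 L.1, isBounded_tot K.2 L.2⟩)
    fun _ _ h _ _ h' ↦ HEquiv.tot _ h h'
  mul_assoc x y z := by
    induction x using Quotient.inductionOn with | h K =>
    induction y using Quotient.inductionOn with | h L =>
    induction z using Quotient.inductionOn with | h M =>
    exact bimoduleClass_eq_of_iso (nonempty_tot_assoc_iso _ _ _ _ (assocNatIso k G G G G)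
      M.1 K.2 L.2)

instance : One (BimoduleClass k G) where
  one := bimoduleClass (inDegreeZero (regularBimodule k G)) (isBounded_inDegreeZero _)

lemma bimoduleClass_one_mul (x : BimoduleClass k G) : 1 * x = x := by
  induction x using Quotient.inductionOn with | h K =>
  exact bimoduleClass_eq_of_iso (nonempty_tot_unit_iso _ (unitNatIso k G G) K.1)

end Classes

/-! ### Classes of induced complexes -/

section InducedClasses

variable {k : Type u} [Field k] {G : Type u} [Group G]

/-- The homotopy class of the induced complex. -/
def indClass (K : ChainComplex (Rep.{u} k G) ℤ) (hK : IsBounded K) : BimoduleClass k G :=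
  bimoduleClass (((indDiag k G).mapHomologicalComplex _).obj K) (hK.map _)

/-- Applying - ⊗_{kG} k to a homotopy equivalence of induced complexes recovers one between the
original complexes. This is the source of injectivity in the theorem. -/
lemma indClass_eq_iff {K L : ChainComplex (Rep.{u} k G) ℤ} {hK : IsBounded K}
    {hL : IsBounded L} : indClass K hK = indClass L hL ↔ HEquiv K L := by
  refine bimoduleClass_eq_iff.trans ⟨fun h ↦ ?_, fun h ↦ h.map _⟩
  have e (M : ChainComplex (Rep.{u} k G) ℤ) : Nonempty (
      ((coinvariantsRight k G).mapHomologicalComplex _).obj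
      (((indDiag k G).mapHomologicalComplex _).obj M) ≅ M) :=
    ⟨(NatIso.mapHomologicalComplex (recoverNatIso k G) (ComplexShape.down ℤ)).app M⟩
  exact (HEquiv.of_iso (e K)).symm.trans ((h.map (coinvariantsRight k G)).trans
    (HEquiv.of_iso (e L)))

lemma indClass_eq_of_iso {K L : ChainComplex (Rep.{u} k G) ℤ} {hK : IsBounded K}
    {hL : IsBounded L} (h : Nonempty (K ≅ L)) : indClass K hK = indClass L hL :=
  indClass_eq_iff.2 (HEquiv.of_iso h)

open MonoidalCategory in
lemma nonempty_indDiag_tot_iso (K L : ChainComplex (Rep.{u} k G) ℤ) (hK : IsBounded K) :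
    Nonempty (tot (bimoduleTensor k G G G) (((indDiag k G).mapHomologicalComplex _).obj K)
      (((indDiag k G).mapHomologicalComplex _).obj L) ≅
        ((indDiag k G).mapHomologicalComplex _).obj (tot (curriedTensor (Rep.{u} k G)) K L)) :=
  nonempty_tot_map_iso (K := K) (L := L) (curriedTensor (Rep.{u} k G))
    (bimoduleTensor k G G G) (indDiag k G) (indDiag k G) (indDiag k G)
    (fun X Y ↦ indTensorIso X Y)
    (fun f _ ↦ indTensorIso_naturality_left f)
    (fun _ _ _ g ↦ indTensorIso_naturality_right g) hK

open MonoidalCategory in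
lemma indClass_mul (K L : ChainComplex (Rep.{u} k G) ℤ) (hK : IsBounded K) (hL : IsBounded L) :
    indClass K hK * indClass L hL =
      indClass (tot (curriedTensor (Rep.{u} k G)) K L) (isBounded_tot hK hL) :=
  bimoduleClass_eq_of_iso (nonempty_indDiag_tot_iso K L hK)

/-- Bimodule tensor products do not commute in general, but those of induced complexes come from
⊗_k, which is symmetric. -/
lemma indClass_mul_comm (K L : ChainComplex (Rep.{u} k G) ℤ) (hK : IsBounded K)
    (hL : IsBounded L) : indClass K hK * indClass L hL = indClass L hL * indClass K hK := by
  rw [indClass_mul, indClass_mul]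
  exact indClass_eq_of_iso (nonempty_tot_flip_iso _ _ (fun X Y ↦ β_ X Y)
    (fun f Y ↦ BraidedCategory.braiding_naturality_left f Y)
    (fun X _ _ g ↦ BraidedCategory.braiding_naturality_right X g) hK)

lemma indClass_trivial : indClass (inDegreeZero (Rep.trivial k G k)) (isBounded_inDegreeZero _) =
    1 :=
  bimoduleClass_eq_of_iso
    ⟨(HomologicalComplex.singleMapHomologicalComplex (indDiag k G) (ComplexShape.down ℤ) 0).app _ ≪≫
      (HomologicalComplex.single _ _ 0).mapIso (indTrivialIso k G)⟩

/-- The dual of the trivial module is trivial. -/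
def dualTrivialIso : (dualFunctor k G).obj (op (Rep.trivial k G k)) ≅ Rep.trivial k G k :=
  (isoMk (M := Rep.trivial k G k) (N := (dualFunctor k G).obj (op (Rep.trivial k G k)))
    (LinearMap.ringLmapEquivSelf k k k).symm fun _ _ ↦ rfl).symm

lemma indClass_dual_trivial : indClass (dualComplex (dualFunctor k G)
    (inDegreeZero (Rep.trivial k G k))) ((isBounded_inDegreeZero _).dual _) = 1 := by
  rw [← indClass_trivial]
  obtain ⟨e⟩ := nonempty_dualComplex_single_iso (dualFunctor k G) (Rep.trivial k G k)
  exact indClass_eq_of_iso ⟨e ≪≫ (HomologicalComplex.single _ _ 0).mapIso dualTrivialIso⟩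

lemma indClass_dual_dual (K : ChainComplex (Rep.{u} k G) ℤ) (hK : IsBounded K)
    (hfin : ∀ n, Module.Finite k (K.X n).V) :
    indClass (dualComplex (dualFunctor k G) (dualComplex (dualFunctor k G) K)) ((hK.dual _).dual _) =
      indClass K hK := by
  obtain ⟨e⟩ := nonempty_dualComplex_dualComplex_iso (dualFunctor k G) (dualFunctor k G) dualEval
    (fun f ↦ rfl) K fun n ↦ isIso_dualEval (K.X n)
  exact indClass_eq_of_iso ⟨e.symm⟩

lemma bimoduleClass_dual_dual (K : ChainComplex (Rep.{u} k (G × G)) ℤ) (hK : IsBounded K)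
    (hfin : ∀ n, Module.Finite k (K.X n).V) :
    bimoduleClass (dualComplex (bimoduleDual k G G) (dualComplex (bimoduleDual k G G) K))
      ((hK.dual _).dual _) = bimoduleClass K hK := by
  obtain ⟨e⟩ := nonempty_dualComplex_dualComplex_iso (bimoduleDual k G G) (bimoduleDual k G G)
    bimoduleDualEval (fun f ↦ rfl) K fun n ↦ isIso_bimoduleDualEval (K.X n)
  exact bimoduleClass_eq_of_iso ⟨e.symm⟩

variable [Finite G]

/-- Induction commutes with duals. -/
lemma indClass_dual (K : ChainComplex (Rep.{u} k G) ℤ) (hK : IsBounded K) :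
    indClass (dualComplex (dualFunctor k G) K) (hK.dual _) =
      bimoduleClass (dualComplex (bimoduleDual k G G)
        (((indDiag k G).mapHomologicalComplex _).obj K)) ((hK.map _).dual _) := by
  cases nonempty_fintype G
  exact bimoduleClass_eq_of_iso (nonempty_map_dualComplex_iso (dualFunctor k G)
    (bimoduleDual k G G) (indDiag k G) (indDiag k G) (fun X ↦ indDualIso X)
    (fun f ↦ indDualIso_naturality f) K)

/-- The dual of a tensor product of complexes of bimodules. -/
lemma bimoduleClass_dual_mul (K L : ChainComplex (Rep.{u} k (G × G)) ℤ) (hK : IsBounded K)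
    (hL : IsBounded L) (hK' : ∀ n, Module.Finite k (K.X n).V)
    (hL' : ∀ n, IsPermRetract (axes G) (L.X n)) :
    bimoduleClass (dualComplex (bimoduleDual k G G) (tot (bimoduleTensor k G G G) K L))
      ((isBounded_tot hK hL).dual _) =
      bimoduleClass (dualComplex (bimoduleDual k G G) L) (hL.dual _) *
        bimoduleClass (dualComplex (bimoduleDual k G G) K) (hK.dual _) := by
  cases nonempty_fintype G
  obtain ⟨e⟩ := nonempty_tot_dual_iso (K := K) (L := L) (bimoduleTensor k G G G)
    (bimoduleTensor k G G G)
    (bimoduleDual k G G) (bimoduleDual k G G) (bimoduleDual k G G) dualTensorHom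
    (fun f Y ↦ dualTensorHom_naturality_left f) (fun X _ _ g ↦ dualTensorHom_naturality_right g)
    (fun i j ↦ by
      have := hK' i
      have := (hL' j).finite
      -- Freeness on the left provides the trace identity under which duals and tensor products of
      -- the terms are compatible.
      obtain ⟨θ, hθ⟩ := (hL' j).exists_trace
      exact isIso_dualTensorHom _ _ θ hθ) hL
  exact bimoduleClass_eq_of_iso ⟨e.symm⟩

end InducedClasses

open Opposite MonoidalCategory

lemma isPermRetract_tot {C₁ C₂ : Type*} [Category C₁] [Category C₂] [Preadditive C₁]
    [Preadditive C₂] {k : Type u} [Field k] {G : Type u} [Group G] {S : Set G}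
    (T : C₁ ⥤ C₂ ⥤ Rep.{u} k G) [T.Additive] [∀ X, (T.obj X).Additive]
    {K : ChainComplex C₁ ℤ} {L : ChainComplex C₂ ℤ}
    [HomologicalComplex.HasMapBifunctor K L T (ComplexShape.down ℤ)] (hK : IsBounded K)
    (h : ∀ i j, IsPermRetract S ((T.obj (K.X i)).obj (L.X j))) (n : ℤ) :
    IsPermRetract S ((tot T K L).X n) := by
  obtain ⟨a, b, hab⟩ := hK
  exact .of_sum (Finset.Icc a b) _ (fun i ↦ h i (n - i)) _ _ (sum_totπ_totι T K L hab n)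

variable {p : ℕ} [Fact p.Prime] {k : Type u} [Field k] [CharP k p] {G : Type u} [Group G] [Finite G]

/-! ### Endotrivial complexes -/

lemma PPermComplex.isPermRetract (C : PPermComplex p k G) (n : ℤ) :
    IsPermRetract ∅ (C.complex.X n) :=
  (C.isPPermutation n).isPermRetract

/-- The homotopy class of `Ind C`. -/
def PPermComplex.indClass (C : PPermComplex p k G) : BimoduleClass k G :=
  EndotrivialComplexes.indClass C.complex C.bounded

/-- The complex `C ⊗_k D`. -/
def PPermComplex.tensor (C D : PPermComplex p k G) : PPermComplex p k G where
  complex := HomologicalComplex.tensorObj C.complex D.complex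
  bounded := isBounded_tot C.bounded D.bounded
  isPPermutation n := (isPermRetract_tot (curriedTensor (Rep.{u} k G)) C.bounded
    (fun i j ↦ (C.isPermRetract i).tensor (D.isPermRetract j)) n).isPPermutation

/-- The dual complex `C^*`. -/
def PPermComplex.dual (C : PPermComplex p k G) : PPermComplex p k G where
  complex := dualComplex (dualFunctor k G) C.complex
  bounded := IsBounded.dual _ C.bounded
  isPPermutation n := (C.isPermRetract (-n)).dual.isPPermutation

variable (p k G) in
/-- The complex `k[0]`. -/
def PPermComplex.unit : PPermComplex p k G where
  complex := inDegreeZero (Rep.trivial k G k)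
  bounded := isBounded_inDegreeZero _
  isPPermutation n := by
    have h : IsPermRetract ∅ (Rep.trivial k G k) :=
      .of_basis (ι := PUnit) (b := Module.Basis.singleton PUnit k) (fun _ i ↦ ⟨i, rfl⟩)
        fun _ hs ↦ hs.elim
    refine IsPermRetract.isPPermutation (S := ∅) ?_
    by_cases hn : n = 0
    · subst hn
      exact h.of_retract (Retract.ofIso (HomologicalComplex.singleObjXSelf _ _ _))
    · exact .of_isZero (HomologicalComplex.isZero_single_obj_X _ _ _ _ hn)

lemma PPermComplex.indClass_tensor (C D : PPermComplex p k G) :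
    (C.tensor D).indClass = C.indClass * D.indClass :=
  (indClass_mul _ _ C.bounded D.bounded).symm

omit [Fact p.Prime] [CharP k p] [Finite G] in
lemma PPermComplex.indClass_mul_comm (C D : PPermComplex p k G) :
    C.indClass * D.indClass = D.indClass * C.indClass :=
  EndotrivialComplexes.indClass_mul_comm _ _ _ _

/-- Induction detects homotopy equivalence, so C^* ⊗ C may be compared with k[0] after inducing
both. -/
lemma isEndotrivial_iff (C : PPermComplex p k G) :
    IsEndotrivial C ↔ C.dual.indClass * C.indClass = 1 := by
  rw [← PPermComplex.indClass_tensor, ← indClass_trivial]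
  exact indClass_eq_iff.symm

lemma PPermComplex.indClass_dual (C : PPermComplex p k G) :
    C.dual.indClass = bimoduleClass (dualComplex (bimoduleDual k G G) C.indDiag.complex)
      (IsBounded.dual _ C.indDiag.bounded) :=
  EndotrivialComplexes.indClass_dual C.complex C.bounded

lemma PPermComplex.indClass_dual_dual (C : PPermComplex p k G) :
    C.dual.dual.indClass = C.indClass :=
  EndotrivialComplexes.indClass_dual_dual C.complex C.bounded fun n ↦ (C.isPPermutation n).1

lemma PPermComplex.isPermRetract_indDiag (C : PPermComplex p k G) (n : ℤ) :
    IsPermRetract (axes G) (C.indDiag.complex.X n) :=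
  (C.isPermRetract n).ind

/-- Derived from the bimodule statement, which splendid complexes need as well; induced terms
satisfy its freeness hypothesis automatically. -/
lemma PPermComplex.indClass_dual_tensor (C D : PPermComplex p k G) :
    (C.tensor D).dual.indClass = D.dual.indClass * C.dual.indClass := by
  rw [C.indClass_dual, D.indClass_dual, ← bimoduleClass_dual_mul _ _ C.indDiag.bounded
    D.indDiag.bounded (fun n ↦ (C.isPermRetract_indDiag n).finite) D.isPermRetract_indDiag,
    PPermComplex.indClass_dual]
  obtain ⟨e⟩ := nonempty_indDiag_tot_iso C.complex D.complex C.bounded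
  exact bimoduleClass_eq_of_iso (nonempty_dualComplex_iso _ ⟨e.symm⟩)

lemma isEndotrivial_tensor {C D : PPermComplex p k G} (hC : IsEndotrivial C)
    (hD : IsEndotrivial D) : IsEndotrivial (C.tensor D) := by
  rw [isEndotrivial_iff] at hC hD ⊢
  rw [C.indClass_dual_tensor, C.indClass_tensor, mul_assoc, ← mul_assoc C.dual.indClass, hC,
    bimoduleClass_one_mul, hD]

lemma isEndotrivial_dual {C : PPermComplex p k G} (hC : IsEndotrivial C) :
    IsEndotrivial C.dual := by
  rw [isEndotrivial_iff] at hC ⊢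
  rw [C.indClass_dual_dual, C.indClass_mul_comm, hC]

lemma indClass_unit : (PPermComplex.unit p k G).indClass = 1 :=
  indClass_trivial

lemma isEndotrivial_unit : IsEndotrivial (PPermComplex.unit p k G) := by
  rw [isEndotrivial_iff, PPermComplex.indClass_mul_comm, indClass_unit, bimoduleClass_one_mul]
  exact indClass_dual_trivial

/-- The class of `Ind C` as a function of the class of `C`. -/
def EndotrivialClass.indClass : EndotrivialClass p k G → BimoduleClass k G :=
  Quotient.lift (fun C ↦ C.1.indClass) fun _ _ h ↦ indClass_eq_iff.2 h

omit [Fact p.Prime] [CharP k p] [Finite G] in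
lemma EndotrivialClass.indClass_injective :
    Function.Injective (EndotrivialClass.indClass (p := p) (k := k) (G := G)) := by
  intro x y
  induction x using Quotient.inductionOn with | h C =>
  induction y using Quotient.inductionOn with | h D =>
  exact fun h ↦ Quotient.sound
    ((indClass_eq_iff (hK := C.1.bounded) (hL := D.1.bounded)).1 h)

lemma Endotrivial.indClass_dual_mul (C : Endotrivial p k G) :
    C.1.dual.indClass * C.1.indClass = 1 :=
  (isEndotrivial_iff C.1).1 C.2

/-- The tensor product of endotrivial complexes. -/
def Endotrivial.tensor (C D : Endotrivial p k G) : Endotrivial p k G :=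
  ⟨C.1.tensor D.1, isEndotrivial_tensor C.2 D.2⟩

variable (p k G) in
/-- The abelian group `E_k(G)`. -/
@[reducible] def endotrivialCommGroup : CommGroup (EndotrivialClass p k G) :=
  let _ : Mul (EndotrivialClass p k G) := ⟨Quotient.map₂ Endotrivial.tensor
    fun C C' (h : HEquiv _ _) D D' (h' : HEquiv _ _) ↦ HEquiv.tot _ h h'⟩
  -- The inverse is formed from a chosen representative, so compatibility of duals with homotopy
  -- equivalence need not be checked.
  let _ : Inv (EndotrivialClass p k G) :=
    ⟨fun x ↦ Endotrivial.cls ⟨x.out.1.dual, isEndotrivial_dual x.out.2⟩⟩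
  let _ : One (EndotrivialClass p k G) := ⟨Endotrivial.cls ⟨.unit p k G, isEndotrivial_unit⟩⟩
  have mul (x y : EndotrivialClass p k G) : (x * y).indClass = x.indClass * y.indClass := by
    induction x using Quotient.inductionOn with | h C =>
    induction y using Quotient.inductionOn with | h D =>
    exact C.1.indClass_tensor D.1
  have one : (1 : EndotrivialClass p k G).indClass = 1 := indClass_unit
  let _ : Group (EndotrivialClass p k G) := Group.ofLeftAxioms
    (fun x y z ↦ EndotrivialClass.indClass_injective (by simp only [mul, mul_assoc]))
    (fun x ↦ EndotrivialClass.indClass_injective (by rw [mul, one, bimoduleClass_one_mul]))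
    (fun x ↦ EndotrivialClass.indClass_injective (by
      rw [mul, one]
      conv_lhs => enter [2]; rw [← Quotient.out_eq x]
      exact x.out.indClass_dual_mul))
  { mul_comm := fun x y ↦ EndotrivialClass.indClass_injective (by
      rw [mul, mul]
      induction x using Quotient.inductionOn with | h C =>
      induction y using Quotient.inductionOn with | h D =>
      exact C.1.indClass_mul_comm D.1) }

/-! ### Splendid Rickard autoequivalences -/

/-- The homotopy class of a complex of `p`-permutation bimodules. -/
def PPermComplex.bimoduleClass (Γ : PPermComplex p k (G × G)) : BimoduleClass k G :=
  EndotrivialComplexes.bimoduleClass Γ.complex Γ.bounded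

/-- The homotopy class of the dual of a complex of `p`-permutation bimodules. -/
def PPermComplex.dualBimoduleClass (Γ : PPermComplex p k (G × G)) : BimoduleClass k G :=
  EndotrivialComplexes.bimoduleClass (dualComplex (bimoduleDual k G G) Γ.complex)
    (IsBounded.dual _ Γ.bounded)

/-- Trades the vertex condition, which is hard to follow through tensor products and duals, for
freeness of both sides on a permutation basis, and the homotopy equivalences for equations in the
semigroup. -/
lemma isSplendidRickard_iff (Γ : PPermComplex p k (G × G)) :
    IsSplendidRickard Γ ↔ (∀ n, IsPermRetract (axes G) (Γ.complex.X n)) ∧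
      Γ.bimoduleClass * Γ.dualBimoduleClass = 1 ∧ Γ.dualBimoduleClass * Γ.bimoduleClass = 1 := by
  constructor
  · intro h
    exact ⟨fun n ↦ isPermRetract_axes (Γ.isPPermutation n) (h.vertex n),
      bimoduleClass_eq_iff.2 h.tensor_dual, bimoduleClass_eq_iff.2 h.dual_tensor⟩
  · rintro ⟨h₁, h₂, h₃⟩
    exact ⟨bimoduleClass_eq_iff.1 h₂, bimoduleClass_eq_iff.1 h₃,
      fun n U hU ⟨r⟩ ↦ (h₁ n).exists_isVertex hU r⟩

/-- The complex `Γ ⊗_{kG} Γ'`. -/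
def SplendidAuto.tensorComplex (Γ Γ' : SplendidAuto p k G) : PPermComplex p k (G × G) where
  complex := bimoduleTensorComplex Γ.1.complex Γ'.1.complex
  bounded := isBounded_tot Γ.1.bounded Γ'.1.bounded
  isPPermutation n := (isPermRetract_tot (bimoduleTensor k G G G) Γ.1.bounded (fun i j ↦
    (((isSplendidRickard_iff Γ.1).1 Γ.2).1 i).bimoduleTensor
      (((isSplendidRickard_iff Γ'.1).1 Γ'.2).1 j)) n).isPPermutation

lemma SplendidAuto.tensorComplex_dualBimoduleClass (Γ Γ' : SplendidAuto p k G) :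
    (Γ.tensorComplex Γ').dualBimoduleClass = Γ'.1.dualBimoduleClass * Γ.1.dualBimoduleClass :=
  bimoduleClass_dual_mul _ _ Γ.1.bounded Γ'.1.bounded (fun n ↦ (Γ.1.isPPermutation n).1)
    ((isSplendidRickard_iff Γ'.1).1 Γ'.2).1

lemma SplendidAuto.isSplendidRickard_tensorComplex (Γ Γ' : SplendidAuto p k G) :
    IsSplendidRickard (Γ.tensorComplex Γ') := by
  obtain ⟨h₁, h₂, h₃⟩ := (isSplendidRickard_iff Γ.1).1 Γ.2
  obtain ⟨h₁', h₂', h₃'⟩ := (isSplendidRickard_iff Γ'.1).1 Γ'.2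
  refine (isSplendidRickard_iff _).2 ⟨fun n ↦ isPermRetract_tot (bimoduleTensor k G G G)
    Γ.1.bounded (fun i j ↦ (h₁ i).bimoduleTensor (h₁' j)) n, ?_, ?_⟩
  · rw [Γ.tensorComplex_dualBimoduleClass Γ']
    change Γ.1.bimoduleClass * Γ'.1.bimoduleClass * _ = 1
    rw [mul_assoc, ← mul_assoc Γ'.1.bimoduleClass, h₂', bimoduleClass_one_mul, h₂]
  · rw [Γ.tensorComplex_dualBimoduleClass Γ']
    change _ * (Γ.1.bimoduleClass * Γ'.1.bimoduleClass) = 1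
    rw [mul_assoc, ← mul_assoc Γ.1.dualBimoduleClass, h₃, bimoduleClass_one_mul, h₃']

/-- The tensor product of splendid Rickard autoequivalences. -/
def SplendidAuto.tensor (Γ Γ' : SplendidAuto p k G) : SplendidAuto p k G :=
  ⟨Γ.tensorComplex Γ', Γ.isSplendidRickard_tensorComplex Γ'⟩

/-- The dual complex `Γ^*`. -/
def SplendidAuto.dualComplex (Γ : SplendidAuto p k G) : PPermComplex p k (G × G) where
  complex := EndotrivialComplexes.dualComplex (bimoduleDual k G G) Γ.1.complex
  bounded := IsBounded.dual _ Γ.1.bounded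
  isPPermutation n := (((isSplendidRickard_iff Γ.1).1 Γ.2).1 (-n)).bimoduleDual.isPPermutation

/-- The dual of a splendid Rickard autoequivalence. -/
def SplendidAuto.dual (Γ : SplendidAuto p k G) : SplendidAuto p k G :=
  ⟨Γ.dualComplex, by
    obtain ⟨h₁, h₂, h₃⟩ := (isSplendidRickard_iff Γ.1).1 Γ.2
    have h : Γ.dualComplex.dualBimoduleClass = Γ.1.bimoduleClass :=
      bimoduleClass_dual_dual _ Γ.1.bounded fun n ↦ (Γ.1.isPPermutation n).1
    refine (isSplendidRickard_iff _).2 ⟨fun n ↦ (h₁ (-n)).bimoduleDual, ?_, ?_⟩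
    · rw [h]
      exact h₃
    · rw [h]
      exact h₂⟩

/-- `Ind C` is a splendid Rickard autoequivalence if `C` is endotrivial. -/
lemma isSplendidRickard_indDiag {C : PPermComplex p k G} (hC : IsEndotrivial C) :
    IsSplendidRickard C.indDiag := by
  rw [isEndotrivial_iff] at hC
  have h : C.indDiag.dualBimoduleClass = C.dual.indClass := C.indClass_dual.symm
  refine (isSplendidRickard_iff _).2 ⟨C.isPermRetract_indDiag, ?_, ?_⟩
  · rw [h]
    -- Endotriviality gives only one of the two orders. The other one follows by commutativity of
    -- classes of induced complexes.
    exact (C.indClass_mul_comm C.dual).trans hC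
  · rw [h]
    exact hC

/-- `Ind C` as a splendid Rickard autoequivalence. -/
def Endotrivial.ind (C : Endotrivial p k G) : SplendidAuto p k G :=
  ⟨C.1.indDiag, isSplendidRickard_indDiag C.2⟩

/-- The class in `BimoduleClass k G` of an element of `S_k(kG)`. -/
def SplendidAutoClass.bimoduleClass : SplendidAutoClass p k G → BimoduleClass k G :=
  Quotient.lift (fun Γ ↦ Γ.1.bimoduleClass) fun _ _ h ↦ bimoduleClass_eq_iff.2 h

omit [Fact p.Prime] [CharP k p] [Finite G] in
lemma SplendidAutoClass.bimoduleClass_injective :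
    Function.Injective (SplendidAutoClass.bimoduleClass (p := p) (k := k) (G := G)) := by
  intro x y
  induction x using Quotient.inductionOn with | h Γ =>
  induction y using Quotient.inductionOn with | h Γ' =>
  exact fun h ↦ Quotient.sound (bimoduleClass_eq_iff.1 h)

variable (p k G) in
/-- The group `S_k(kG)`. -/
@[reducible] def splendidAutoGroup : Group (SplendidAutoClass p k G) :=
  let _ : Mul (SplendidAutoClass p k G) := ⟨Quotient.map₂ SplendidAuto.tensor
    fun Γ Θ (h : HEquiv _ _) Γ' Θ' (h' : HEquiv _ _) ↦ HEquiv.tot _ h h'⟩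
  let _ : Inv (SplendidAutoClass p k G) := ⟨fun x ↦ x.out.dual.cls⟩
  let _ : One (SplendidAutoClass p k G) :=
    -- Ind k[0] serves as the unit: it is already known to be splendid, and its class equals that of
    -- kG[0].
    ⟨(Endotrivial.ind ⟨.unit p k G, isEndotrivial_unit⟩).cls⟩
  have mul (x y : SplendidAutoClass p k G) :
      (x * y).bimoduleClass = x.bimoduleClass * y.bimoduleClass := by
    induction x using Quotient.inductionOn with | h C =>
    induction y using Quotient.inductionOn with | h D =>
    rfl
  have one : (1 : SplendidAutoClass p k G).bimoduleClass = 1 := indClass_unit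
  Group.ofLeftAxioms
    (fun x y z ↦ SplendidAutoClass.bimoduleClass_injective (by simp only [mul, mul_assoc]))
    (fun x ↦ SplendidAutoClass.bimoduleClass_injective (by rw [mul, one, bimoduleClass_one_mul]))
    (fun x ↦ SplendidAutoClass.bimoduleClass_injective (by
      rw [mul, one]
      conv_lhs => enter [2]; rw [← Quotient.out_eq x]
      exact ((isSplendidRickard_iff _).1 x.out.2).2.2))

/-! ### Lefschetz invariants -/

omit [Fact p.Prime] [CharP k p] in
-- Finiteness of the support lets the homomorphism pass through the alternating sum, leaving an
-- identity of classes in each degree.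
lemma lefschetz_indDiag (C : PPermComplex p k G) :
    lefschetz C.indDiag = indTrivialSource p k G (lefschetz C) := by
  rw [lefschetz, lefschetz, AddMonoidHom.map_finsum _ (lefschetz_support_finite C)]
  refine finsum_congr fun n ↦ ?_
  rw [map_zsmul, indTrivialSource_cls]
  rfl

end EndotrivialComplexes

end

theorem mainTheorem3 (p : ℕ) [Fact p.Prime] (k : Type u) [Field k] [CharP k p]
    (G : Type u) [Group G] [Finite G] :
    (∀ C : EndotrivialComplexes.PPermComplex p k G, EndotrivialComplexes.IsEndotrivial C →
      EndotrivialComplexes.IsSplendidRickard C.indDiag ∧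
      EndotrivialComplexes.lefschetz C.indDiag =
        EndotrivialComplexes.indTrivialSource p k G (EndotrivialComplexes.lefschetz C)) ∧
    -- the abelian group `E_k(G)`, with `[C] * [D] = [C ⊗_k D]`, and the group `S_k(kG)`,
    -- with `[Γ] * [Γ'] = [Γ ⊗_{kG} Γ']`
    ∃ (_ : CommGroup (EndotrivialComplexes.EndotrivialClass p k G))
      (_ : Group (EndotrivialComplexes.SplendidAutoClass p k G)),
      (∀ C D : EndotrivialComplexes.Endotrivial p k G,
        ∃ E : EndotrivialComplexes.Endotrivial p k G,
          E.1.complex = HomologicalComplex.tensorObj C.1.complex D.1.complex ∧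
          C.cls * D.cls = E.cls) ∧
      (∀ Γ Γ' : EndotrivialComplexes.SplendidAuto p k G,
        ∃ Θ : EndotrivialComplexes.SplendidAuto p k G,
          Θ.1.complex =
            EndotrivialComplexes.bimoduleTensorComplex Γ.1.complex Γ'.1.complex ∧
          Γ.cls * Γ'.cls = Θ.cls) ∧
      -- the injective homomorphism `[C] ↦ [Ind_{ΔG}^{G × G} C]`
      ∃ f : EndotrivialComplexes.EndotrivialClass p k G →*
          EndotrivialComplexes.SplendidAutoClass p k G,
        Function.Injective f ∧
        ∀ C : EndotrivialComplexes.Endotrivial p k G,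
          ∃ Γ : EndotrivialComplexes.SplendidAuto p k G, Γ.1 = C.1.indDiag ∧ f C.cls = Γ.cls := by
  refine ⟨fun C hC ↦ ⟨EndotrivialComplexes.isSplendidRickard_indDiag hC,
    EndotrivialComplexes.lefschetz_indDiag C⟩,
    EndotrivialComplexes.endotrivialCommGroup p k G, EndotrivialComplexes.splendidAutoGroup p k G,
    fun C D ↦ ⟨C.tensor D, rfl, rfl⟩, fun Γ Γ' ↦ ⟨Γ.tensor Γ', rfl, rfl⟩, ?_⟩
  let _ := EndotrivialComplexes.endotrivialCommGroup p k G
  let _ := EndotrivialComplexes.splendidAutoGroup p k G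
  let f : EndotrivialComplexes.EndotrivialClass p k G →
      EndotrivialComplexes.SplendidAutoClass p k G :=
    Quotient.map EndotrivialComplexes.Endotrivial.ind fun _ _ h ↦
      EndotrivialComplexes.HEquiv.map _ h
  -- Followed by the injection into bimodule classes, f becomes the injective multiplicative map [C]
  -- ↦ [Ind C], so both claims about f are read off there.
  have hf (x) : (f x).bimoduleClass = x.indClass := by
    induction x using Quotient.inductionOn with | h C =>
    rfl
  refine ⟨MonoidHom.mk' f fun x y ↦ ?_, fun x y h ↦ ?_, fun C ↦ ⟨C.ind, rfl, rfl⟩⟩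
  · apply EndotrivialComplexes.SplendidAutoClass.bimoduleClass_injective
    rw [hf]
    induction x using Quotient.inductionOn with | h C =>
    induction y using Quotient.inductionOn with | h D =>
    exact C.1.indClass_tensor D.1
  · apply EndotrivialComplexes.EndotrivialClass.indClass_injective
    rw [← hf, ← hf]
    exact congrArg _ h
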